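/- Let $E=\mathbf{Q}(\sqrt{-D})$ be an imaginary quadratic field of discriminant $-D$, let $p$ be a prime, $E_p=E\otimes_{\mathbf{Q}}\mathbf{Q}_p$ (split, inert or ramified), $\delta=\sqrt{-D}$, and $$J=\begin{pmatrix}&&\delta^{-1}\\&1&\\-\delta^{-1}&&\end{pmatrix},\qquad G=\{g\in \mathrm{GL}_3(E_p): {}^t\bar g\,J\,g=\mu(g)J \text{ for some } \mu(g)\in\mathbf{Q}_p^\times\}.$$ Let $H=\{(g_1,\lambda)\in \mathrm{GL}_2(\mathbf{Q}_p)\times E_p^\times : \det g_1=\mathrm{Nm}(\lambda)\}$, embedded in $G$ by $$\left(\begin{pmatrix}a&b\\c&d\end{pmatrix},\lambda\right)\mapsto\begin{pmatrix}a&&b\\&\lambda&\\c&&d\end{pmatrix},$$ and let $U_2\cong\mathbf{Q}_p$ be the subgroup of $H$ of the elements $\left(\begin{pmatrix}1&x\\&1\end{pmatrix},1\right)$. Give $H$ and $U_2$ the Haar measures for which $H(\mathbf{Z}_p)=\{(g_1,\lambda)\in H: g_1\in\mathrm{GL}_2(\mathbf{Z}_p),\ \lambda\in(\mathcal{O}_E\otimes\mathbf{Z}_p)^\times\}$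 and $\mathbf{Z}_p$ have volume $1$, and $U_2\backslash H$ the quotient measure. Let $\psi$ be a nontrivial continuous unitary character of $\mathbf{Q}_p$ (for instance the standard one), and let $U_B\subset G$ be the group of upper triangular matrices in $G$ with $1$'s on the diagonal. Let $(\pi,V)$ be an irreducible admissible complex representation of $G$, let $\Lambda:V\to\mathbf{C}$ be a nonzero Whittaker functional, i.e. a linear functional with $\Lambda(\pi(u)v)=\psi(\mathrm{tr}_{E_p/\mathbf{Q}_p}(\delta^{-1}u_{23}))\Lambda(v)$ for $u\in U_B$, $v\in V$, and let $W(g)=\Lambda(\pi(g)\varphi)$ for some $\varphi\in V$. Let $\Phi:\mathbf{Q}_p^2\to\mathbf{C}$ be a Schwartz--Bruhat function (locally constant with compact support), and let $\nu_1:\mathbf{Q}_p^\times\to\overline{\mathbf{Q}}^\times\subset\mathbf{C}^\times$ be a continuous character with algebraic values (for instance one of finite order), where $\overline{\mathbf{Q}}$ is the field of algebraic numbers in $\mathbf{C}$. Put $$I(\Phi,W,\nu,s)=\int_{U_2\backslash H}\nu_1(\det g_1)\,|\det g_1|^s\,\Phi((0,1)g_1)\,W(g)\,dg .$$ Suppose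 that $\Phi$ and $W$ are both valued in $\overline{\mathbf{Q}}$. Then there are polynomials $P,Q\in\overline{\mathbf{Q}}[X]$, $Q\neq0$, such that for all $s$ with $\mathrm{Re}(s)$ sufficiently large the integral $I(\Phi,W,\nu,s)$ converges absolutely, $Q(p^{-s})\ne 0$ and $$I(\Phi,W,\nu,s)=\frac{P(p^{-s})}{Q(p^{-s})};$$ thus $I(\Phi,W,\nu,s)$ has a meromorphic continuation to $s\in\mathbf{C}$, given by the rational function $P(X)/Q(X)$ of $X=p^{-s}$. In particular, for every $s\in\mathbf{Q}$ at which the meromorphic continuation is finite, its value is in $\overline{\mathbf{Q}}$. -/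

import Mathlib

open MeasureTheory Matrix Filter Topology
open scoped ENNReal

noncomputable section

namespace PicardLocal

/-- `-D` is the discriminant of an imaginary quadratic field `E = ℚ(√-D)`. -/
def IsFundamental (D : ℕ) : Prop :=
  0 < D ∧
    (((-(D : ℤ)) % 4 = 1 ∧ Squarefree (-(D : ℤ))) ∨
      ∃ m : ℤ, -(D : ℤ) = 4 * m ∧ Squarefree m ∧ (m % 4 = 2 ∨ m % 4 = 3))

variable (p : ℕ) [Fact p.Prime] (D : ℕ)

/-! ### The local algebra `E_p = E ⊗ ℚ_p` -/

/-- `E_p = ℚ(√-D) ⊗ ℚ_p = ℚ_p[δ]` with `δ ^ 2 = -D`: elements are `re + im * δ`. The conjugation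
is `star`, the norm and the trace to `ℚ_p` are `QuadraticAlgebra.norm`, `QuadraticAlgebra.trace`.
It is a field if `p` does not split in `E`, and it is isomorphic to `ℚ_p × ℚ_p` if `p` splits. -/
abbrev Ep : Type := QuadraticAlgebra ℚ_[p] (-(D : ℚ_[p])) 0

/-- The topology of `E_p` as a two-dimensional vector space over `ℚ_p`. -/
instance : TopologicalSpace (Ep p D) :=
  TopologicalSpace.induced (QuadraticAlgebra.equivProd _ _) inferInstance

theorem isInducing_equivProd :
    IsInducing (QuadraticAlgebra.equivProd (-(D : ℚ_[p])) 0 : Ep p D → ℚ_[p] × ℚ_[p]) := ⟨rfl⟩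

def equivProdHomeo : Ep p D ≃ₜ ℚ_[p] × ℚ_[p] :=
  (QuadraticAlgebra.equivProd _ _).toHomeomorphOfIsInducing (isInducing_equivProd p D)

theorem continuous_re : Continuous (fun x : Ep p D => x.re) :=
  continuous_fst.comp (equivProdHomeo p D).continuous

theorem continuous_im : Continuous (fun x : Ep p D => x.im) :=
  continuous_snd.comp (equivProdHomeo p D).continuous

instance : IsTopologicalRing (Ep p D) where
  continuous_add := by
    rw [(isInducing_equivProd p D).continuous_iff]
    refine Continuous.prodMk ?_ ?_
    · exact ((continuous_re p D).comp continuous_fst).add ((continuous_re p D).comp continuous_snd)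
    · exact ((continuous_im p D).comp continuous_fst).add ((continuous_im p D).comp continuous_snd)
  continuous_mul := by
    have h1 := (continuous_re p D).comp (continuous_fst (X := Ep p D) (Y := Ep p D))
    have h2 := (continuous_re p D).comp (continuous_snd (X := Ep p D) (Y := Ep p D))
    have h3 := (continuous_im p D).comp (continuous_fst (X := Ep p D) (Y := Ep p D))
    have h4 := (continuous_im p D).comp (continuous_snd (X := Ep p D) (Y := Ep p D))
    rw [(isInducing_equivProd p D).continuous_iff]
    refine Continuous.prodMk ?_ ?_
    · exact (h1.mul h2).add ((continuous_const.mul h3).mul h4)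
    · exact ((h1.mul h4).add (h3.mul h2)).add ((continuous_const.mul h3).mul h4)
  continuous_neg := by
    rw [(isInducing_equivProd p D).continuous_iff]
    exact Continuous.prodMk (continuous_re p D).neg (continuous_im p D).neg

instance : T2Space (Ep p D) := (equivProdHomeo p D).symm.t2Space

instance : LocallyCompactSpace (Ep p D) :=
  (equivProdHomeo p D).isClosedEmbedding.locallyCompactSpace

instance : SecondCountableTopology (Ep p D) :=
  (equivProdHomeo p D).secondCountableTopology

/-- The element `δ⁻¹`, where `δ = √-D`. -/
def deltaInv : Ep p D := ⟨0, -(D : ℚ_[p])⁻¹⟩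

theorem omega_mul_deltaInv (hD : D ≠ 0) :
    (QuadraticAlgebra.omega : Ep p D) * deltaInv p D = 1 := by
  have : (D : ℚ_[p]) ≠ 0 := by exact_mod_cast hD
  ext <;> simp [deltaInv, this, QuadraticAlgebra.re_one, QuadraticAlgebra.im_one]

/-! ### The unitary similitude group `G = GU(2,1)` -/

/-- The hermitian form `J`. -/
def J : Matrix (Fin 3) (Fin 3) (Ep p D) :=
  !![0, 0, deltaInv p D; 0, 1, 0; -deltaInv p D, 0, 0]

/-- `G = GU(J)(ℚ_p)`: the `g` in `GL₃(E_p)` with `g* J g = μ J` for some `μ` in `ℚ_pˣ`. -/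
def GU : Subgroup (GL (Fin 3) (Ep p D)) where
  carrier := {g | ∃ m : ℚ_[p]ˣ,
    (g : Matrix (Fin 3) (Fin 3) (Ep p D))ᴴ * J p D * (g : Matrix (Fin 3) (Fin 3) (Ep p D)) =
      (m : ℚ_[p]) • J p D}
  one_mem' := ⟨1, by simp⟩
  mul_mem' := by
    rintro g h ⟨m, hm⟩ ⟨n, hn⟩
    refine ⟨m * n, ?_⟩
    rw [Units.val_mul, conjTranspose_mul, Units.val_mul, mul_smul, ← hn]
    rw [show (h.1)ᴴ * (g.1)ᴴ * J p D * (g.1 * h.1) = (h.1)ᴴ * ((g.1)ᴴ * J p D * g.1) * h.1 by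
      simp only [Matrix.mul_assoc], hm]
    simp
  inv_mem' := by
    rintro g ⟨m, hm⟩
    refine ⟨m⁻¹, ?_⟩
    have h1 : g.1 * (g⁻¹).1 = 1 := by rw [← Units.val_mul]; simp
    have h2 : ((g⁻¹).1)ᴴ * (g.1)ᴴ = 1 := by rw [← conjTranspose_mul, h1]; simp
    have h3 : ((g⁻¹).1)ᴴ * ((g.1)ᴴ * J p D * g.1) * (g⁻¹).1 = J p D := by
      rw [show ((g⁻¹).1)ᴴ * ((g.1)ᴴ * J p D * g.1) * (g⁻¹).1 =
        (((g⁻¹).1)ᴴ * (g.1)ᴴ) * J p D * (g.1 * (g⁻¹).1) by simp only [Matrix.mul_assoc], h1, h2]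
      simp
    rw [hm] at h3
    conv_rhs => rw [← h3]
    simp [smul_smul]

/-- `u` lies in the unipotent radical `U_B` of the upper triangular Borel subgroup of `G`: it is upper
triangular with diagonal entries `1`. -/
def IsUnipotentUpper (u : GU p D) : Prop :=
  ∀ i j, j ≤ i → u.1.1 i j = if i = j then 1 else 0

/-! ### The subgroup `H` -/

/-- The group `H` of pairs `(g, l)` in `GL₂(ℚ_p) × E_pˣ` with `det g = Nm l`. -/
def Hsub : Subgroup (GL (Fin 2) ℚ_[p] × (Ep p D)ˣ) where
  carrier := {h | (h.1 : Matrix (Fin 2) (Fin 2) ℚ_[p]).det = QuadraticAlgebra.norm (h.2 : Ep p D)}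
  one_mem' := by simp
  mul_mem' := by
    intro g h hg hh
    simp only [Set.mem_ofPred_eq] at *
    simp [hg, hh]
  inv_mem' := by
    intro g hg
    simp only [Set.mem_ofPred_eq] at *
    have h1 : (g.1 : Matrix (Fin 2) (Fin 2) ℚ_[p]).det *
        ((g⁻¹).1 : Matrix (Fin 2) (Fin 2) ℚ_[p]).det = 1 := by
      rw [← Matrix.det_mul, ← Units.val_mul]; simp
    have h2 : QuadraticAlgebra.norm (g.2 : Ep p D) *
        QuadraticAlgebra.norm ((g⁻¹).2 : Ep p D) = 1 := by
      rw [← map_mul, ← Units.val_mul]; simp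
    rw [hg] at h1
    exact mul_left_cancel₀ (left_ne_zero_of_mul_eq_one h2) (h1.trans h2.symm)

/-- The group `H` as a topological group. -/
def H : Type := ↥(Hsub p D)

instance : Group (H p D) := inferInstanceAs (Group (Hsub p D))
instance : TopologicalSpace (H p D) := inferInstanceAs (TopologicalSpace (Hsub p D))
instance : IsTopologicalGroup (H p D) := inferInstanceAs (IsTopologicalGroup (Hsub p D))
instance : MeasurableSpace (H p D) := borel _
instance : BorelSpace (H p D) := ⟨rfl⟩

variable {p D}

/-- The projection of `H` to `GL₂(ℚ_p)`. -/
def H.g₁ (h : H p D) : GL (Fin 2) ℚ_[p] := h.1.1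

/-- The projection of `H` to `E_pˣ`. -/
def H.l (h : H p D) : (Ep p D)ˣ := h.1.2

theorem H.det_eq (h : H p D) :
    (h.g₁ : Matrix (Fin 2) (Fin 2) ℚ_[p]).det = QuadraticAlgebra.norm (h.l : Ep p D) := h.2

theorem H.ext {h k : H p D} (h1 : h.g₁ = k.g₁) (h2 : h.l = k.l) : h = k :=
  Subtype.ext (Prod.ext h1 h2)

@[simp] theorem H.mul_g₁ (h k : H p D) : (h * k).g₁ = h.g₁ * k.g₁ := rfl
@[simp] theorem H.mul_l (h k : H p D) : (h * k).l = h.l * k.l := rfl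
@[simp] theorem H.one_g₁ : (1 : H p D).g₁ = 1 := rfl
@[simp] theorem H.one_l : (1 : H p D).l = 1 := rfl
@[simp] theorem H.inv_g₁ (h : H p D) : (h⁻¹).g₁ = h.g₁⁻¹ := rfl
@[simp] theorem H.inv_l (h : H p D) : (h⁻¹).l = h.l⁻¹ := rfl

/-- The matrix with rows `(a, 0, b)`, `(0, l, 0)`, `(c, 0, d)`. -/
def embedMatrix (g : Matrix (Fin 2) (Fin 2) ℚ_[p]) (l : Ep p D) :
    Matrix (Fin 3) (Fin 3) (Ep p D) :=
  !![algebraMap _ _ (g 0 0), 0, algebraMap _ _ (g 0 1);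
     0, l, 0;
     algebraMap _ _ (g 1 0), 0, algebraMap _ _ (g 1 1)]

theorem embedMatrix_mul (g g' : Matrix (Fin 2) (Fin 2) ℚ_[p]) (l l' : Ep p D) :
    embedMatrix g l * embedMatrix g' l' = embedMatrix (g * g') (l * l') := by
  ext1 i j
  fin_cases i <;> fin_cases j <;>
    simp [embedMatrix, Matrix.mul_apply, Fin.sum_univ_three, Fin.sum_univ_two]

theorem embedMatrix_one : embedMatrix (1 : Matrix (Fin 2) (Fin 2) ℚ_[p]) (1 : Ep p D) = 1 := by
  ext1 i j
  fin_cases i <;> fin_cases j <;> simp [embedMatrix]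

/-- The embedding of `H` into `G`. -/
def embed : H p D →* GU p D where
  toFun h := ⟨⟨embedMatrix h.g₁ h.l, embedMatrix (h⁻¹).g₁ (h⁻¹).l,
      by rw [embedMatrix_mul, ← Units.val_mul, ← Units.val_mul, ← H.mul_g₁, ← H.mul_l]
         simp [embedMatrix_one],
      by rw [embedMatrix_mul, ← Units.val_mul, ← Units.val_mul, ← H.mul_g₁, ← H.mul_l]
         simp [embedMatrix_one]⟩,
    ⟨Matrix.GeneralLinearGroup.det h.g₁, by
      have hdet := h.det_eq
      rw [Matrix.GeneralLinearGroup.val_det_apply]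
      have hl : star (h.l : Ep p D) * (h.l : Ep p D) =
          algebraMap _ _ ((h.g₁ : Matrix (Fin 2) (Fin 2) ℚ_[p]).det) := by
        rw [hdet, QuadraticAlgebra.algebraMap_norm_eq_mul_star, mul_comm]
      rw [Matrix.det_fin_two] at hl ⊢
      have hst : ∀ x : ℚ_[p], star (algebraMap ℚ_[p] (Ep p D) x) = algebraMap _ _ x := by
        intro x; ext <;> simp
      ext1 i j
      fin_cases i <;> fin_cases j <;>
        simp [embedMatrix, J, Matrix.mul_apply, Fin.sum_univ_three, hl, hst,
          Algebra.smul_def] <;> ring⟩⟩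
  map_one' := by
    apply Subtype.ext
    apply Units.ext
    simp [embedMatrix_one]
  map_mul' h k := by
    apply Subtype.ext
    apply Units.ext
    simp [embedMatrix_mul]

variable (p D)

/-- The subgroup `H(ℤ_p)`: `g` has integral entries together with its inverse, and `l` is a unit of
`O_E ⊗ ℤ_p`, the integral closure of `ℤ_p` in `E_p`. -/
def Hint : Set (H p D) :=
  {h | (∀ i j, ‖(h.g₁ : Matrix (Fin 2) (Fin 2) ℚ_[p]) i j‖ ≤ 1) ∧
    (∀ i j, ‖((h.g₁⁻¹ : GL (Fin 2) ℚ_[p]) : Matrix (Fin 2) (Fin 2) ℚ_[p]) i j‖ ≤ 1) ∧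
    IsIntegral ℤ_[p] (h.l : Ep p D) ∧ IsIntegral ℤ_[p] ((h.l⁻¹ : (Ep p D)ˣ) : Ep p D)}

variable {p D}

/-- The element of `H` with `g = (1, x; 0, 1)` and `l = 1`. -/
def u₂ (x : ℚ_[p]) : H p D :=
  ⟨(⟨!![1, x; 0, 1], !![1, -x; 0, 1], by simp [Matrix.one_fin_two], by simp [Matrix.one_fin_two]⟩,
    1), by simp [Hsub]⟩

@[simp] theorem u₂_g₁ (x : ℚ_[p]) :
    ((u₂ x : H p D).g₁ : Matrix (Fin 2) (Fin 2) ℚ_[p]) = !![1, x; 0, 1] := rfl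

@[simp] theorem u₂_l (x : ℚ_[p]) : (u₂ x : H p D).l = 1 := rfl

theorem u₂_add (x y : ℚ_[p]) : (u₂ (x + y) : H p D) = u₂ x * u₂ y := by
  apply H.ext
  · apply Units.ext
    simp [add_comm]
  · simp

variable (p D)

/-- The unipotent subgroup `U₂` of `H`. -/
def U₂ : Subgroup (H p D) where
  carrier := Set.range u₂
  one_mem' := ⟨0, by
    apply H.ext
    · apply Units.ext; simp [Matrix.one_fin_two]
    · simp⟩
  mul_mem' := by
    rintro _ _ ⟨x, rfl⟩ ⟨y, rfl⟩
    exact ⟨x + y, u₂_add x y⟩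
  inv_mem' := by
    rintro _ ⟨x, rfl⟩
    refine ⟨-x, ?_⟩
    rw [eq_inv_iff_mul_eq_one, ← u₂_add]
    apply H.ext
    · apply Units.ext; simp [Matrix.one_fin_two]
    · simp

/-- The space `U₂ \ H` of right cosets `U₂ h`. -/
abbrev UH : Type := Quotient (QuotientGroup.rightRel (U₂ p D))

/-! ### Topological properties of `H` and the Haar measures -/

theorem continuous_norm_Ep : Continuous (fun x : Ep p D => QuadraticAlgebra.norm x) := by
  have h1 := continuous_re p D
  have h2 := continuous_im p D
  simp only [QuadraticAlgebra.norm_def]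
  fun_prop

theorem isClosed_Hsub : IsClosed (Hsub p D : Set (GL (Fin 2) ℚ_[p] × (Ep p D)ˣ)) := by
  refine isClosed_eq ?_ ?_
  · exact Continuous.matrix_det (Units.continuous_val.comp continuous_fst)
  · exact (continuous_norm_Ep p D).comp (Units.continuous_val.comp continuous_snd)

instance : LocallyCompactSpace (Matrix (Fin 2) (Fin 2) ℚ_[p]) :=
  inferInstanceAs (LocallyCompactSpace (Fin 2 → Fin 2 → ℚ_[p]))

instance : LocallyCompactSpace (H p D) :=
  (isClosed_Hsub p D).isClosedEmbedding_subtypeVal.locallyCompactSpace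

instance : SecondCountableTopology (H p D) := by
  have : SecondCountableTopology (Matrix (Fin 2) (Fin 2) ℚ_[p]) :=
    inferInstanceAs (SecondCountableTopology (Fin 2 → Fin 2 → ℚ_[p]))
  have : SecondCountableTopology (Matrix (Fin 2) (Fin 2) ℚ_[p])ᵐᵒᵖ :=
    MulOpposite.opHomeomorph.symm.secondCountableTopology
  have : SecondCountableTopology (Ep p D)ᵐᵒᵖ :=
    MulOpposite.opHomeomorph.symm.secondCountableTopology
  have : SecondCountableTopology (GL (Fin 2) ℚ_[p]) :=
    Units.isEmbedding_embedProduct.secondCountableTopology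
  have : SecondCountableTopology (Ep p D)ˣ :=
    Units.isEmbedding_embedProduct.secondCountableTopology
  have : SecondCountableTopology (Hsub p D) :=
    (IsInducing.subtypeVal (t := (Hsub p D : Set (GL (Fin 2) ℚ_[p] × (Ep p D)ˣ)))).secondCountableTopology
  exact this

instance : MeasurableSpace ℚ_[p] := borel _
instance : BorelSpace ℚ_[p] := ⟨rfl⟩

/-- The Haar measure on `ℚ_p` of total mass `1` on `ℤ_p`. -/
def haarQp : Measure ℚ_[p] :=
  Measure.addHaarMeasure ⟨⟨Metric.closedBall 0 1, isCompact_closedBall 0 1⟩,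
    ⟨0, mem_interior_iff_mem_nhds.2 (Metric.closedBall_mem_nhds 0 one_pos)⟩⟩

instance : (haarQp p).IsAddHaarMeasure := by unfold haarQp; infer_instance

/-- The Haar measure on `H` of total mass `1` on the compact open subgroup `H(ℤ_p)`. -/
def haarH : Measure (H p D) := (Measure.haar (Hint p D))⁻¹ • Measure.haar

/-- The `h` in `H` with `c ≠ 0` and `a / c` in `ℤ_p`, where `a` and `c` are the entries of the first
column of `g`. Left multiplication by `u₂ x` fixes `c` and replaces `a` by `a + x * c`, so for every
`h` with `c ≠ 0`, that is, for almost every `h`, the set of `x` in `ℚ_p` with `u₂ x * h` in `slice`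
has volume one. -/
def slice : Set (H p D) :=
  {h | (h.g₁ : Matrix (Fin 2) (Fin 2) ℚ_[p]) 1 0 ≠ 0 ∧
    ‖(h.g₁ : Matrix (Fin 2) (Fin 2) ℚ_[p]) 0 0‖ ≤ ‖(h.g₁ : Matrix (Fin 2) (Fin 2) ℚ_[p]) 1 0‖}

/-- The quotient measure on `U₂ \ H` of `haarH` by the Haar measure `haarQp` of `U₂ = ℚ_p`; its
characteristic property is `lintegral_quotientMeasure`. -/
def quotientMeasure : Measure (UH p D) :=
  ((haarH p D).restrict (slice p D)).map (Quotient.mk _)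

theorem continuous_entry (i j : Fin 2) :
    Continuous (fun h : H p D => (h.g₁ : Matrix (Fin 2) (Fin 2) ℚ_[p]) i j) :=
  Continuous.matrix_elem
    (Units.continuous_val.comp (continuous_fst.comp continuous_subtype_val)) i j

theorem measurableSet_slice : MeasurableSet (slice p D) := by
  have h0 := (continuous_entry p D 0 0).measurable
  have h1 := (continuous_entry p D 1 0).measurable
  refine MeasurableSet.inter ?_ ?_
  · exact (h1 (measurableSet_singleton 0)).compl
  · exact measurableSet_le h0.norm h1.norm

theorem continuous_u₂ : Continuous (u₂ : ℚ_[p] → H p D) := by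
  refine Continuous.subtype_mk (Continuous.prodMk ?_ continuous_const) _
  rw [Units.continuous_iff]
  constructor
  · refine continuous_matrix ?_
    intro i j
    fin_cases i <;> fin_cases j <;> simp [continuous_const, continuous_id']
  · refine continuous_matrix ?_
    intro i j
    fin_cases i <;> fin_cases j <;> simp [continuous_const, continuous_neg]

/-- The element of `H` with `g = (1, 0; x, 1)` and `l = 1`. -/
def v₂ (x : ℚ_[p]) : H p D :=
  ⟨(⟨!![1, 0; x, 1], !![1, 0; -x, 1], by simp [Matrix.one_fin_two], by simp [Matrix.one_fin_two]⟩,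
    1), by simp [Hsub]⟩

theorem v₂_g₁ (x : ℚ_[p]) :
    ((v₂ p D x).g₁ : Matrix (Fin 2) (Fin 2) ℚ_[p]) = !![1, 0; x, 1] := rfl

theorem continuous_v₂ : Continuous (v₂ p D) := by
  refine Continuous.subtype_mk (Continuous.prodMk ?_ continuous_const) _
  rw [Units.continuous_iff]
  constructor
  · refine continuous_matrix ?_
    intro i j
    fin_cases i <;> fin_cases j <;> simp [continuous_const, continuous_id']
  · refine continuous_matrix ?_
    intro i j
    fin_cases i <;> fin_cases j <;> simp [continuous_const, continuous_neg]

theorem v₂_mul_entry (x : ℚ_[p]) (h : H p D) :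
    ((v₂ p D x * h).g₁ : Matrix (Fin 2) (Fin 2) ℚ_[p]) 1 0 =
      x * (h.g₁ : Matrix (Fin 2) (Fin 2) ℚ_[p]) 0 0 +
        (h.g₁ : Matrix (Fin 2) (Fin 2) ℚ_[p]) 1 0 := by
  rw [H.mul_g₁, Units.val_mul, v₂_g₁]
  simp [Matrix.mul_apply]

theorem u₂_mul_entry_one (x : ℚ_[p]) (h : H p D) :
    ((u₂ x * h).g₁ : Matrix (Fin 2) (Fin 2) ℚ_[p]) 1 0 =
        (h.g₁ : Matrix (Fin 2) (Fin 2) ℚ_[p]) 1 0 := by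
  simp [Matrix.mul_apply]

theorem u₂_mul_entry_zero (x : ℚ_[p]) (h : H p D) :
    ((u₂ x * h).g₁ : Matrix (Fin 2) (Fin 2) ℚ_[p]) 0 0 =
        (h.g₁ : Matrix (Fin 2) (Fin 2) ℚ_[p]) 0 0 +
        x * (h.g₁ : Matrix (Fin 2) (Fin 2) ℚ_[p]) 1 0 := by
  simp [Matrix.mul_apply]

theorem column_ne_zero (h : H p D) (h0 : (h.g₁ : Matrix (Fin 2) (Fin 2) ℚ_[p]) 1 0 = 0) :
    (h.g₁ : Matrix (Fin 2) (Fin 2) ℚ_[p]) 0 0 ≠ 0 := by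
  intro h1
  have := (Matrix.GeneralLinearGroup.det h.g₁).ne_zero
  rw [Matrix.GeneralLinearGroup.val_det_apply, Matrix.det_fin_two, h0, h1] at this
  simp at this

theorem u₂_inv (x : ℚ_[p]) : (u₂ x : H p D)⁻¹ = u₂ (-x) := by
  rw [inv_eq_iff_mul_eq_one, ← u₂_add]
  apply H.ext
  · apply Units.ext; simp [Matrix.one_fin_two]
  · simp

theorem haarQp_closedBall (y : ℚ_[p]) : haarQp p (Metric.closedBall y 1) = 1 := by
  have h : (fun x => x + -y) ⁻¹' Metric.closedBall 0 1 = Metric.closedBall y 1 := by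
    ext x; simp [dist_eq_norm, sub_eq_add_neg]
  rw [← h, measure_preimage_add_right]
  exact Measure.addHaarMeasure_self

theorem haarQp_slice (h : H p D)
    (hc : (h.g₁ : Matrix (Fin 2) (Fin 2) ℚ_[p]) 1 0 ≠ 0) :
    haarQp p {x | (u₂ x)⁻¹ * h ∈ slice p D} = 1 := by
  rw [← haarQp_closedBall p ((h.g₁ : Matrix (Fin 2) (Fin 2) ℚ_[p]) 0 0 /
    (h.g₁ : Matrix (Fin 2) (Fin 2) ℚ_[p]) 1 0)]
  congr 1
  ext x
  rw [Set.mem_ofPred_eq, slice, Set.mem_ofPred_eq, u₂_inv, u₂_mul_entry_one, u₂_mul_entry_zero,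
    Metric.mem_closedBall, dist_comm, dist_eq_norm, and_iff_right hc]
  generalize (h.g₁ : Matrix (Fin 2) (Fin 2) ℚ_[p]) 0 0 = a
  generalize (h.g₁ : Matrix (Fin 2) (Fin 2) ℚ_[p]) 1 0 = c at hc
  rw [show a + -x * c = (a / c - x) * c by field_simp; ring, norm_mul]
  exact mul_le_iff_le_one_left (norm_pos_iff.2 hc)

theorem measure_entry_eq_zero (μ : Measure (H p D)) [SFinite μ] [μ.IsMulLeftInvariant] :
    μ {h | (h.g₁ : Matrix (Fin 2) (Fin 2) ℚ_[p]) 1 0 = 0} = 0 := by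
  set N : Set (H p D) := {h | (h.g₁ : Matrix (Fin 2) (Fin 2) ℚ_[p]) 1 0 = 0} with hN
  have hNm : MeasurableSet N :=
    (continuous_entry p D 1 0).measurable (measurableSet_singleton 0)
  have hmeas : Measurable
      (fun z : ℚ_[p] × H p D => N.indicator (1 : H p D → ℝ≥0∞) (v₂ p D z.1 * z.2)) :=
    (measurable_one.indicator hNm).comp
      (((continuous_v₂ p D).comp continuous_fst).mul continuous_snd).measurable
  have h1 : ∫⁻ x, ∫⁻ h, N.indicator 1 (v₂ p D x * h) ∂μ ∂(haarQp p) =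
      μ N * haarQp p Set.univ := by
    simp_rw [lintegral_mul_left_eq_self (fun h => N.indicator (1 : H p D → ℝ≥0∞) h),
      lintegral_indicator_one hNm]
    simp
  have h2 : ∫⁻ x, ∫⁻ h, N.indicator 1 (v₂ p D x * h) ∂μ ∂(haarQp p) = 0 := by
    rw [lintegral_lintegral_swap hmeas.aemeasurable]
    refine (lintegral_congr fun h => ?_).trans lintegral_zero
    have hs : Set.Subsingleton {x | v₂ p D x * h ∈ N} := by
      intro x hx y hy
      simp only [hN, Set.mem_ofPred_eq, v₂_mul_entry] at hx hy
      have ha : (h.g₁ : Matrix (Fin 2) (Fin 2) ℚ_[p]) 0 0 ≠ 0 := by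
        intro ha
        rw [ha, mul_zero, zero_add] at hx
        exact column_ne_zero p D h hx ha
      exact mul_right_cancel₀ ha (add_right_cancel (hx.trans hy.symm))
    have hm : MeasurableSet {x | v₂ p D x * h ∈ N} := hs.measurableSet
    have : (fun x => N.indicator (1 : H p D → ℝ≥0∞) (v₂ p D x * h)) =
        Set.indicator {x | v₂ p D x * h ∈ N} 1 := by
      ext x; simp [Set.indicator]
    rw [this, lintegral_indicator_one hm]
    exact hs.measure_zero _
  rw [h1] at h2
  rcases mul_eq_zero.1 h2 with h | h
  · exact h
  · exact absurd h (NeZero.ne _)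

theorem lintegral_slice (μ : Measure (H p D)) [SFinite μ] [μ.IsMulLeftInvariant]
    {f : H p D → ℝ≥0∞} (hf : Measurable f) :
    ∫⁻ h in slice p D, ∫⁻ x, f (u₂ x * h) ∂(haarQp p) ∂μ = ∫⁻ h, f h ∂μ := by
  have hS := measurableSet_slice p D
  have hu : Measurable (fun z : H p D × ℚ_[p] => u₂ z.2 * z.1) :=
    (((continuous_u₂ p D).comp continuous_snd).mul continuous_fst).measurable
  have hu' : Measurable (fun z : ℚ_[p] × H p D => (u₂ z.1)⁻¹ * z.2) :=
    (((continuous_u₂ p D).comp continuous_fst).inv.mul continuous_snd).measurable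
  have hind : Measurable ((slice p D).indicator (1 : H p D → ℝ≥0∞)) :=
    measurable_one.indicator hS
  calc ∫⁻ h in slice p D, ∫⁻ x, f (u₂ x * h) ∂(haarQp p) ∂μ
      = ∫⁻ h, ∫⁻ x, (slice p D).indicator 1 h * f (u₂ x * h) ∂(haarQp p) ∂μ := by
        rw [← lintegral_indicator hS]
        refine lintegral_congr fun h => ?_
        by_cases hh : h ∈ slice p D <;> simp [hh]
    _ = ∫⁻ x, ∫⁻ h, (slice p D).indicator 1 h * f (u₂ x * h) ∂μ ∂(haarQp p) :=
        lintegral_lintegral_swap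
          ((hind.comp measurable_fst).mul (hf.comp hu)).aemeasurable
    _ = ∫⁻ x, ∫⁻ h, (slice p D).indicator 1 ((u₂ x)⁻¹ * h) * f h ∂μ ∂(haarQp p) := by
        refine lintegral_congr fun x => ?_
        have := lintegral_mul_left_eq_self (μ := μ)
          (fun h => (slice p D).indicator 1 ((u₂ x)⁻¹ * h) * f h) (u₂ x)
        simpa only [inv_mul_cancel_left] using this
    _ = ∫⁻ h, ∫⁻ x, (slice p D).indicator 1 ((u₂ x)⁻¹ * h) * f h ∂(haarQp p) ∂μ :=
        lintegral_lintegral_swap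
          ((hind.comp hu').mul (hf.comp measurable_snd)).aemeasurable
    _ = ∫⁻ h, f h ∂μ := by
        refine lintegral_congr_ae ?_
        have h0 : ∀ᵐ h ∂μ, (h.g₁ : Matrix (Fin 2) (Fin 2) ℚ_[p]) 1 0 ≠ 0 := by
          rw [ae_iff]; simpa using measure_entry_eq_zero p D μ
        filter_upwards [h0] with h hh
        have hm : Measurable (fun x : ℚ_[p] => (u₂ x)⁻¹ * h) :=
          ((continuous_u₂ p D).inv.mul continuous_const).measurable
        have hm' : Measurable (fun x => (slice p D).indicator (1 : H p D → ℝ≥0∞) ((u₂ x)⁻¹ * h)) :=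
          hind.comp hm
        rw [lintegral_mul_const _ hm']
        have : (fun x => (slice p D).indicator (1 : H p D → ℝ≥0∞) ((u₂ x)⁻¹ * h)) =
            Set.indicator {x | (u₂ x)⁻¹ * h ∈ slice p D} 1 := by
          ext x; simp [Set.indicator]
        have hm'' : MeasurableSet {x | (u₂ x)⁻¹ * h ∈ slice p D} := hm hS
        rw [this, lintegral_indicator_one hm'', haarQp_slice p D h hh, one_mul]

/-- `quotientMeasure` is the quotient measure: integrals over `H` are computed by integrating first
over `U₂` and then over `U₂ \ H`. (The inner integral does not depend on the representative.) -/
theorem lintegral_quotientMeasure {f : H p D → ℝ≥0∞} (hf : Measurable f) :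
    ∫⁻ q, ∫⁻ x, f (u₂ x * (q : UH p D).out) ∂(haarQp p) ∂(quotientMeasure p D) =
      ∫⁻ h, f h ∂(haarH p D) := by
  have hout : ∀ h : H p D, ∫⁻ x, f (u₂ x * (Quotient.mk _ h : UH p D).out) ∂(haarQp p) =
      ∫⁻ x, f (u₂ x * h) ∂(haarQp p) := by
    intro h
    obtain ⟨y, hy⟩ := QuotientGroup.rightRel_apply.1
      (Quotient.mk_out (s := QuotientGroup.rightRel (U₂ p D)) h)
    have h1 : h = u₂ y * (Quotient.mk (QuotientGroup.rightRel (U₂ p D)) h).out := by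
      rw [hy]; group
    conv_rhs => rw [h1]
    simp_rw [← mul_assoc, ← u₂_add]
    exact (lintegral_add_right_eq_self (fun x => f (u₂ x * _)) y).symm
  have hmeas : Measurable (fun h : H p D => ∫⁻ x, f (u₂ x * h) ∂(haarQp p)) := by
    have hu : Measurable (fun z : H p D × ℚ_[p] => u₂ z.2 * z.1) :=
      (((continuous_u₂ p D).comp continuous_snd).mul continuous_fst).measurable
    exact (hf.comp hu).lintegral_prod_right'
  rw [quotientMeasure, lintegral_map]
  · simp_rw [hout]
    rw [haarH, Measure.restrict_smul, lintegral_smul_measure, lintegral_smul_measure,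
      lintegral_slice p D _ hf]
  · refine measurable_from_quotient.2 ?_
    simpa only [Function.comp_def, hout] using hmeas
  · exact measurable_quotient_mk''

/-! ### Representations of `G` and Whittaker functions -/

variable {p D}

/-- A representation of `G` is smooth if every vector is fixed by an open subgroup. -/
def IsSmooth {V : Type*} [AddCommGroup V] [Module ℂ V] (π : Representation ℂ (GU p D) V) : Prop :=
  ∀ v, ∃ K : Subgroup (GU p D), IsOpen (K : Set (GU p D)) ∧ ∀ k ∈ K, π k v = v

/-- A representation of `G` is admissible if it is smooth and the vectors fixed by any given open
subgroup form a finite-dimensional space. -/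
def IsAdmissible {V : Type*} [AddCommGroup V] [Module ℂ V] (π : Representation ℂ (GU p D) V) :
    Prop :=
  IsSmooth π ∧ ∀ K : Subgroup (GU p D), IsOpen (K : Set (GU p D)) →
    FiniteDimensional ℂ (Representation.invariants (π.comp K.subtype))

/-- A Whittaker functional: `Λ (π u v) = ψ (tr (δ⁻¹ u₂₃)) Λ v` for `u` in `U_B`. -/
def IsWhittakerFunctional (ψ : AddChar ℚ_[p] Circle) {V : Type*} [AddCommGroup V] [Module ℂ V]
    (π : Representation ℂ (GU p D) V) (Λ : V →ₗ[ℂ] ℂ) : Prop :=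
  ∀ u : GU p D, IsUnipotentUpper p D u → ∀ v,
    Λ (π u v) = (ψ (QuadraticAlgebra.trace (deltaInv p D * u.1.1 1 2)) : ℂ) * Λ v

/-- The functions `g ↦ Λ (π g v)`, for a nonzero Whittaker functional `Λ` on an irreducible
admissible representation `π` of `G` on the space `V`. -/
def IsWhittakerFunction (ψ : AddChar ℚ_[p] Circle) {V : Type*} [AddCommGroup V] [Module ℂ V]
    (π : Representation ℂ (GU p D) V) (W : GU p D → ℂ) : Prop :=
  ∃ Λ : V →ₗ[ℂ] ℂ, Λ ≠ 0 ∧ IsWhittakerFunctional ψ π Λ ∧ ∃ v, ∀ g, W g = Λ (π g v)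

/-! ### The local integral -/

/-- The function `ν₁ (det g₁) |det g₁| ^ s Φ ((0, 1) g₁) W (g)` of `g` in `H`. -/
def integrand (Φ : (Fin 2 → ℚ_[p]) → ℂ) (W : GU p D → ℂ) (ν₁ : ℚ_[p]ˣ →* ℂˣ) (s : ℂ)
    (h : H p D) : ℂ :=
  (ν₁ (Matrix.GeneralLinearGroup.det h.g₁) : ℂ) *
    ((‖(h.g₁ : Matrix (Fin 2) (Fin 2) ℚ_[p]).det‖ : ℝ) : ℂ) ^ s *
    Φ (![0, 1] ᵥ* (h.g₁ : Matrix (Fin 2) (Fin 2) ℚ_[p])) * W (embed h)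

/-- `integrand` is a function on `U₂ \ H`. -/
theorem integrand_u₂_mul (Φ : (Fin 2 → ℚ_[p]) → ℂ) {W : GU p D → ℂ} (ν₁ : ℚ_[p]ˣ →* ℂˣ) (s : ℂ)
    {ψ : AddChar ℚ_[p] Circle} {V : Type*} [AddCommGroup V] [Module ℂ V]
    {π : Representation ℂ (GU p D) V} (hW : IsWhittakerFunction ψ π W) (x : ℚ_[p]) (h : H p D) :
    integrand Φ W ν₁ s (u₂ x * h) = integrand Φ W ν₁ s h := by
  obtain ⟨Λ, -, hΛ, v, hv⟩ := hW
  have hdet : Matrix.GeneralLinearGroup.det (u₂ x : H p D).g₁ = 1 := by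
    apply Units.ext
    simp [Matrix.det_fin_two]
  have hrow : (![0, 1] : Fin 2 → ℚ_[p]) ᵥ* !![1, x; 0, 1] = ![0, 1] := by
    ext i; fin_cases i <;> simp [Matrix.vecMul, dotProduct, Fin.sum_univ_two]
  have hu : (embed (u₂ x : H p D)).1.1 = embedMatrix !![1, x; 0, 1] 1 := rfl
  have hW' : W (embed (u₂ x * h)) = W (embed h) := by
    have hup : IsUnipotentUpper p D (embed (u₂ x : H p D)) := by
      intro i j hij
      rw [hu]
      fin_cases i <;> fin_cases j <;> simp_all [embedMatrix]
    rw [hv, hv, map_mul, map_mul, Module.End.mul_apply, hΛ _ hup, hu]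
    simp [embedMatrix]
  unfold integrand
  rw [hW', H.mul_g₁, map_mul, hdet, one_mul, Units.val_mul, u₂_g₁, Matrix.det_mul,
    ← Matrix.vecMul_vecMul, hrow]
  simp [Matrix.det_fin_two]

/-- Absolute convergence of the local integral. -/
def LocalIntegrable (Φ : (Fin 2 → ℚ_[p]) → ℂ) (W : GU p D → ℂ) (ν₁ : ℚ_[p]ˣ →* ℂˣ) (s : ℂ) :
    Prop :=
  Integrable (fun q : UH p D => integrand Φ W ν₁ s q.out) (quotientMeasure p D)

/-- The local integral `I(Φ, W, ν, s)` over `U₂ \ H`. -/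
def localIntegral (Φ : (Fin 2 → ℚ_[p]) → ℂ) (W : GU p D → ℂ) (ν₁ : ℚ_[p]ˣ →* ℂˣ) (s : ℂ) : ℂ :=
  ∫ q : UH p D, integrand Φ W ν₁ s q.out ∂(quotientMeasure p D)

end PicardLocal

end

/-! Write `X = p ^ (-s)`, `k` for the algebraic numbers, and `W g = Λ (π g v)`. The integrand is
right invariant under a compact open subgroup `K` of `H` that does not depend on `s`, and `H = U₂ T
K₀`, where `T` is a torus with parameters `(b, x)` in `ℚ_pˣ × E_pˣ` and `K₀` is compact open. Hence
the integral is the rational number `vol K` times a sum over `b = p ^ m`, over representatives `x`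
of `E_pˣ` modulo the units of an order, and over the finitely many cosets of `K` in `K₀`. A term is
a character value times `Φ (p ^ m • w)` times `f (t_x * p ^ m)` times `X ^ (2 * m + v (Nm x))`, with
`t_x = diag(Nm x, star x, 1)` and `f` a right translate of `W` (`integral_quotientMeasure`,
`integrand_torusPoint_mul`).

Rationality comes from one finite-dimensional space: the space `F` of the `k`-valued functions `g ↦
Λ (π g w)` with `w` fixed by a congruence subgroup `K_n` of `G`. Admissibility makes it
finite-dimensional over `k`, because finitely many points of `G` separate such functions. Invariance
under the unipotent elements of `K_n` forces `f (t_x) = 0` unless `x` lies in a lattice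
(`coefficient_torusG_eq_zero`). For `x` in this lattice and `y` in the order, `f (t_(x * y)) = (T_y
f) (t_x)`, where `T_y` is the normalised Hecke operator of `K_n t_y K_n` (`heckeOp_torusG`). Since
`T_y` preserves `F`, the values of `f` along the powers of one element are matrix coefficients of
the powers of an endomorphism, and their generating series is rational over `k` by Cramer's rule
(`rationalSum_end_pow`). The sum over `m` is of the same kind: `Φ (p ^ m • w)` is zero for very
negative `m` and constant for large `m`, and translation by the central element `p` is an
endomorphism of `F`. Neither asymptotics of Whittaker functions nor uniqueness of the Whittaker
model enters.

Modulo units, `E_pˣ` contains the powers of `p` with finite index if `E_p` is a field, and is free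
of rank two if `E_p` is split. `IsOrthantFamily` is the induction principle that covers both cases:
the lattice cuts out finitely many translated orthants, which are swept out by powers of nilpotent
directions.

Finally, a rational function over `k` in lowest terms takes algebraic values wherever it is finite
at an algebraic point, and `p ^ (-r)` is algebraic for rational `r`
(`IsRationalNearZero.exists_meromorphic`). -/

open MeasureTheory Matrix Filter Topology
open scoped ENNReal

noncomputable section

namespace PicardLocal

/-! ### Rational functions near zero and series with rational sum -/

section RationalSum

open Polynomial

/-- `f` agrees near `0`, away from `0`, with a rational function with coefficients in `k`. -/
def IsRationalNearZero (k : Type*) [Field k] [Algebra k ℂ] (f : ℂ → ℂ) : Prop :=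
  ∃ P Q : k[X], ∀ᶠ X in 𝓝[≠] (0 : ℂ), aeval X Q ≠ 0 ∧ f X = aeval X P / aeval X Q

/-- The series `∑ a i * X ^ e i` converges absolutely for small `X ≠ 0`, and its sum is a rational
function of `X` with coefficients in `k`. -/
def RationalSum (k : Type*) [Field k] [Algebra k ℂ] {ι : Type*} (a : ι → ℂ) (e : ι → ℤ) : Prop :=
  (∀ᶠ X in 𝓝[≠] (0 : ℂ), Summable fun i => ‖a i * X ^ e i‖) ∧
    IsRationalNearZero k fun X => ∑' i, a i * X ^ e i

variable {k : Type*} [Field k] [Algebra k ℂ] {ι κ : Type*}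

theorem IsRationalNearZero.congr {f g : ℂ → ℂ} (hf : IsRationalNearZero k f)
    (h : ∀ᶠ X in 𝓝[≠] (0 : ℂ), f X = g X) : IsRationalNearZero k g := by
  obtain ⟨P, Q, hPQ⟩ := hf
  refine ⟨P, Q, ?_⟩
  filter_upwards [hPQ, h] with X h1 h2
  exact ⟨h1.1, h2 ▸ h1.2⟩

theorem IsRationalNearZero.add {f g : ℂ → ℂ} (hf : IsRationalNearZero k f)
    (hg : IsRationalNearZero k g) : IsRationalNearZero k fun X => f X + g X := by
  obtain ⟨P, Q, h⟩ := hf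
  obtain ⟨P', Q', h'⟩ := hg
  refine ⟨P * Q' + Q * P', Q * Q', ?_⟩
  filter_upwards [h, h'] with X h1 h2
  refine ⟨by simpa using ⟨h1.1, h2.1⟩, ?_⟩
  rw [h1.2, h2.2, div_add_div _ _ h1.1 h2.1]
  simp

theorem IsRationalNearZero.mul {f g : ℂ → ℂ} (hf : IsRationalNearZero k f)
    (hg : IsRationalNearZero k g) : IsRationalNearZero k fun X => f X * g X := by
  obtain ⟨P, Q, h⟩ := hf
  obtain ⟨P', Q', h'⟩ := hg
  refine ⟨P * P', Q * Q', ?_⟩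
  filter_upwards [h, h'] with X h1 h2
  refine ⟨by simpa using ⟨h1.1, h2.1⟩, ?_⟩
  rw [h1.2, h2.2, div_mul_div_comm]
  simp

variable (k) in
theorem isRationalNearZero_monomial (c : k) (e : ℤ) :
    IsRationalNearZero k fun X => algebraMap k ℂ c * X ^ e := by
  -- At least one of the two exponents is zero, and `e.toNat - (-e).toNat = e`.
  refine ⟨C c * Polynomial.X ^ e.toNat, Polynomial.X ^ (-e).toNat, ?_⟩
  filter_upwards [self_mem_nhdsWithin] with X hX
  have hX : X ≠ 0 := hX
  refine ⟨by simp [hX], ?_⟩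
  rw [eq_div_iff (by simp [hX])]
  simp only [map_mul, map_pow, aeval_X, aeval_C]
  rw [mul_assoc, ← zpow_natCast, ← zpow_natCast, ← zpow_add₀ hX]
  congr 2
  omega

variable (k) in
theorem isRationalNearZero_zero : IsRationalNearZero k fun _ => 0 := by
  simpa using isRationalNearZero_monomial k 0 0

theorem IsRationalNearZero.sum {s : Finset ι} {f : ι → ℂ → ℂ}
    (hf : ∀ i ∈ s, IsRationalNearZero k (f i)) : IsRationalNearZero k fun X => ∑ i ∈ s, f i X := by
  classical
  induction s using Finset.induction_on with
  | empty => simpa using isRationalNearZero_zero k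
  | insert i s hi ih =>
    simp_rw [Finset.sum_insert hi]
    exact (hf i (Finset.mem_insert_self i s)).add
      (ih fun j hj => hf j (Finset.mem_insert_of_mem hj))

theorem RationalSum.add {a b : ι → ℂ} {e : ι → ℤ} (ha : RationalSum k a e)
    (hb : RationalSum k b e) : RationalSum k (fun i => a i + b i) e := by
  refine ⟨?_, (ha.2.add hb.2).congr ?_⟩
  · filter_upwards [ha.1, hb.1] with X h1 h2
    refine (h1.add h2).of_nonneg_of_le (fun i => norm_nonneg _) fun i => ?_
    rw [add_mul]
    exact norm_add_le _ _
  · filter_upwards [ha.1, hb.1] with X h1 h2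
    simp_rw [add_mul]
    exact (h1.of_norm.tsum_add h2.of_norm).symm

theorem RationalSum.const_mul {a : ι → ℂ} {e : ι → ℤ} (ha : RationalSum k a e) (c : k) :
    RationalSum k (fun i => algebraMap k ℂ c * a i) e := by
  refine ⟨?_, ((isRationalNearZero_monomial k c 0).mul ha.2).congr ?_⟩
  · filter_upwards [ha.1] with X h1
    simp_rw [mul_assoc, norm_mul (algebraMap k ℂ c)]
    exact h1.mul_left _
  · filter_upwards with X
    simp_rw [mul_assoc, zpow_zero, one_mul, tsum_mul_left]

variable (k) in
theorem rationalSum_zero (e : ι → ℤ) : RationalSum k (fun _ => 0) e :=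
  ⟨by simp [summable_zero], by simpa using isRationalNearZero_zero k⟩

theorem RationalSum.sum {s : Finset κ} {a : κ → ι → ℂ} {e : ι → ℤ}
    (ha : ∀ j ∈ s, RationalSum k (a j) e) : RationalSum k (fun i => ∑ j ∈ s, a j i) e := by
  classical
  induction s using Finset.induction_on with
  | empty => simpa using rationalSum_zero k e
  | insert i s hi ih =>
    simp_rw [Finset.sum_insert hi]
    exact (ha i (Finset.mem_insert_self i s)).add
      (ih fun j hj => ha j (Finset.mem_insert_of_mem hj))

theorem RationalSum.mul {a : ι → ℂ} {e : ι → ℤ} {b : κ → ℂ} {e' : κ → ℤ}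
    (ha : RationalSum k a e) (hb : RationalSum k b e') :
    RationalSum k (fun i : ι × κ => a i.1 * b i.2) (fun i => e i.1 + e' i.2) := by
  have key : ∀ X : ℂ, X ≠ 0 → ∀ i : ι × κ, a i.1 * b i.2 * X ^ (e i.1 + e' i.2) =
      (a i.1 * X ^ e i.1) * (b i.2 * X ^ e' i.2) := by
    intro X hX i
    rw [zpow_add₀ hX]
    ring
  refine ⟨?_, (ha.2.mul hb.2).congr ?_⟩
  · filter_upwards [ha.1, hb.1, self_mem_nhdsWithin] with X h1 h2 hX
    simp_rw [key X hX]
    exact Summable.mul_norm (f := fun i => a i * X ^ e i) (g := fun j => b j * X ^ e' j) h1 h2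
  · filter_upwards [ha.1, hb.1, self_mem_nhdsWithin] with X h1 h2 hX
    simp_rw [key X hX]
    exact tsum_mul_tsum_of_summable_norm (f := fun i => a i * X ^ e i)
      (g := fun j => b j * X ^ e' j) h1 h2

/-- Terms that vanish do not matter. -/
theorem RationalSum.of_injective {a : ι → ℂ} {e : ι → ℤ} {g : κ → ι} (hg : Function.Injective g)
    (h0 : ∀ i ∉ Set.range g, a i = 0) (h : RationalSum k (fun j => a (g j)) fun j => e (g j)) :
    RationalSum k a e := by
  refine ⟨?_, h.2.congr ?_⟩
  · filter_upwards [h.1] with X hX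
    exact (hg.summable_iff fun i hi => by simp [h0 i hi]).1 hX
  · filter_upwards with X
    exact hg.tsum_eq (f := fun i => a i * X ^ e i) fun i hi => by
      by_contra h1
      exact hi (by simp [h0 i h1])

theorem RationalSum.comp_equiv {a : ι → ℂ} {e : ι → ℤ} (h : RationalSum k a e) (g : κ ≃ ι) :
    RationalSum k (fun j => a (g j)) fun j => e (g j) := by
  refine RationalSum.of_injective (g := g.symm) g.symm.injective ?_ (by simpa using h)
  intro i hi
  exact absurd (g.symm.surjective i) hi

theorem rationalSum_of_finite [Finite ι] {a : ι → ℂ} (e : ι → ℤ)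
    (ha : ∀ i, a i ∈ (algebraMap k ℂ).range) : RationalSum k a e := by
  cases nonempty_fintype ι
  refine ⟨Eventually.of_forall fun X => (hasSum_fintype _).summable, ?_⟩
  simp_rw [tsum_fintype]
  refine IsRationalNearZero.sum fun i _ => ?_
  obtain ⟨c, hc⟩ := ha i
  simpa only [← hc] using isRationalNearZero_monomial k c (e i)

theorem IsRationalNearZero.comp_pow {f : ℂ → ℂ} (hf : IsRationalNearZero k f) {m : ℕ} (hm : 0 < m) :
    IsRationalNearZero k fun X => f (X ^ m) := by
  obtain ⟨P, Q, h⟩ := hf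
  refine ⟨expand k m P, expand k m Q, ?_⟩
  have ht : Tendsto (fun X : ℂ => X ^ m) (𝓝[≠] 0) (𝓝[≠] 0) := by
    refine tendsto_nhdsWithin_iff.2 ⟨?_, ?_⟩
    · have : Continuous fun X : ℂ => X ^ m := continuous_pow m
      simpa [hm.ne'] using (this.tendsto 0).mono_left nhdsWithin_le_nhds
    · filter_upwards [self_mem_nhdsWithin] with X hX
      exact pow_ne_zero m hX
  filter_upwards [ht.eventually h] with X hX
  simpa only [expand_aeval] using hX

section MatrixPowers

attribute [local instance] Matrix.linftyOpNormedRing Matrix.linftyOpNormedAlgebra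

/-- Where `Y • N` has norm less than one, `∑ (Y • N) ^ r` is the inverse of `1 - Y • N`, and
Cramer's rule writes its entries as quotients of polynomials in `Y` with coefficients in `k`. The
exponent `m * r` amounts to the substitution `Y = X ^ m`. -/
theorem rationalSum_matrix_pow {n : Type*} [Fintype n] [DecidableEq n] (M : Matrix n n k) (i j : n)
    {m : ℕ} (hm : 0 < m) :
    RationalSum k (fun r : ℕ => algebraMap k ℂ ((M ^ r) i j)) fun r => (m * r : ℕ) := by
  set N : Matrix n n ℂ := M.map (algebraMap k ℂ) with hN
  have hpow : ∀ r : ℕ, algebraMap k ℂ ((M ^ r) i j) = (N ^ r) i j := by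
    intro r
    have := congr_fun (congr_fun (Matrix.map_pow M (algebraMap k ℂ) r) i) j
    simpa using this
  have hsm : ∀ᶠ Y : ℂ in 𝓝 0, ‖Y • N‖ < 1 := by
    have : Continuous fun Y : ℂ => ‖Y • N‖ := by fun_prop
    exact this.continuousAt.eventually_lt continuousAt_const (by simp)
  have hterm : ∀ (Y : ℂ) (r : ℕ), (N ^ r) i j * Y ^ r = ((Y • N) ^ r) i j := by
    intro Y r
    rw [_root_.smul_pow]
    simp [mul_comm]
  have hentry : ∀ A : Matrix n n ℂ, ‖A i j‖ ≤ ‖A‖ := by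
    intro A
    rw [Matrix.linfty_opNorm_def]
    have h1 : ‖A i j‖₊ ≤ ∑ j', ‖A i j'‖₊ :=
      Finset.single_le_sum (f := fun j' => ‖A i j'‖₊) (fun _ _ => zero_le) (Finset.mem_univ j)
    have h2 : ∑ j', ‖A i j'‖₊ ≤ Finset.univ.sup fun i : n => ∑ j', ‖A i j'‖₊ :=
      Finset.le_sup (f := fun i : n => ∑ j', ‖A i j'‖₊) (Finset.mem_univ i)
    exact_mod_cast h1.trans h2
  have hsumm : ∀ᶠ Y : ℂ in 𝓝 0, Summable fun r : ℕ => ‖(N ^ r) i j * Y ^ r‖ := by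
    filter_upwards [hsm] with Y hY
    refine (summable_norm_geometric_of_norm_lt_one hY).of_nonneg_of_le (fun _ => norm_nonneg _) ?_
    intro r
    rw [hterm]
    exact hentry _
  have ht : Tendsto (fun X : ℂ => X ^ m) (𝓝[≠] 0) (𝓝 0) := by
    have : Continuous fun X : ℂ => X ^ m := continuous_pow m
    simpa [hm.ne'] using (this.tendsto 0).mono_left nhdsWithin_le_nhds
  have hrat : IsRationalNearZero k fun Y => ∑' r : ℕ, (N ^ r) i j * Y ^ r := by
    -- The polynomial matrix whose value at `Y` is `1 - Y • N`. Its adjugate and its determinant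
    -- give the numerator and the denominator.
    set A : Matrix n n k[X] := 1 - (Polynomial.X : k[X]) • M.map (C : k →+* k[X]) with hA
    have hev : ∀ Y : ℂ, (aeval Y : k[X] →ₐ[k] ℂ).toRingHom.mapMatrix A = 1 - Y • N := by
      intro Y
      ext a b
      by_cases hab : a = b <;> simp [hA, hN, hab] <;> ring
    refine ⟨A.adjugate i j, A.det, ?_⟩
    filter_upwards [nhdsWithin_le_nhds hsm] with Y hY
    obtain ⟨S, hSum⟩ := summable_geometric_of_norm_lt_one hY
    have hS : (1 - Y • N) * S = 1 := by rw [← hSum.tsum_eq, mul_neg_geom_series _ hY]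
    have hdet : aeval Y A.det = (1 - Y • N).det := by
      rw [← hev Y, ← RingHom.map_det]
      rfl
    have hadj : aeval Y (A.adjugate i j) = (1 - Y • N).adjugate i j := by
      rw [← hev Y, ← RingHom.map_adjugate]
      rfl
    have hdet0 : (1 - Y • N).det ≠ 0 := by
      intro h0
      have := congr_arg Matrix.det hS
      rw [Matrix.det_mul, h0] at this
      simp at this
    have hSadj : (1 - Y • N).adjugate = (1 - Y • N).det • S := by
      calc (1 - Y • N).adjugate = (1 - Y • N).adjugate * ((1 - Y • N) * S) := by rw [hS, mul_one]
        _ = (1 - Y • N).det • S := by rw [← mul_assoc, Matrix.adjugate_mul]; simp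
    refine ⟨by rwa [hdet], ?_⟩
    rw [hdet, hadj, hSadj, Matrix.smul_apply, smul_eq_mul, mul_div_cancel_left₀ _ hdet0]
    have hc : Continuous fun B : Matrix n n ℂ => B i j := continuous_id.matrix_elem i j
    have := hSum.map
      (Matrix.entryAddMonoidHom ℂ i j) hc
    simp_rw [hterm]
    exact this.tsum_eq
  simp_rw [hpow]
  have hexp : ∀ (X : ℂ) (r : ℕ), X ^ ((m * r : ℕ) : ℤ) = (X ^ m) ^ r := by
    intro X r
    rw [zpow_natCast, pow_mul]
  refine ⟨?_, ?_⟩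
  · simp_rw [hexp]
    exact ht.eventually hsumm
  · simp_rw [hexp]
    exact hrat.comp_pow hm

end MatrixPowers

/-- In a basis this is a finite `k`-linear combination of entries of matrix powers. It is applied
below to Hecke operators and to central translations. -/
theorem rationalSum_end_pow {F : Type*} [AddCommGroup F] [Module k F] [FiniteDimensional k F]
    (T : Module.End k F) (ℓ : F →ₗ[k] k) (f : F) {m : ℕ} (hm : 0 < m) :
    RationalSum k (fun r : ℕ => algebraMap k ℂ (ℓ ((T ^ r) f))) fun r => (m * r : ℕ) := by
  classical
  set b := Module.finBasis k F with hb
  set M := LinearMap.toMatrix b b T with hM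
  have h1 : ∀ r : ℕ, ℓ ((T ^ r) f) = ∑ i, ∑ j, (ℓ (b i) * b.repr f j) * (M ^ r) i j := by
    intro r
    have hpow : LinearMap.toMatrix b b (T ^ r) = M ^ r := by
      rw [hM, LinearMap.toMatrix_pow]
    have hv : ∀ i, b.repr ((T ^ r) f) i = ∑ j, (M ^ r) i j * b.repr f j := by
      intro i
      rw [← hpow, ← LinearMap.toMatrix_mulVec_repr b b (T ^ r) f]
      rfl
    conv_lhs => rw [← b.sum_repr ((T ^ r) f)]
    rw [map_sum]
    refine Finset.sum_congr rfl fun i _ => ?_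
    rw [map_smul, hv, smul_eq_mul, Finset.sum_mul]
    exact Finset.sum_congr rfl fun j _ => by ring
  simp_rw [h1, map_sum, map_mul (algebraMap k ℂ) (_ * _)]
  exact RationalSum.sum fun i _ => RationalSum.sum fun j _ =>
    (rationalSum_matrix_pow M i j hm).const_mul _

end RationalSum

/-! ### Rational functions of `p ^ (-s)` and their values at rational `s` -/

section Continuation

open Polynomial

variable {k : Type*} [Field k] [Algebra k ℂ]

/-- Its power of exponent `r.den` is the rational number `p ^ (-r.num)`. -/
theorem isAlgebraic_natCast_cpow_rat (p : ℕ) (hp : p ≠ 0) (r : ℚ) :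
    IsAlgebraic ℚ ((p : ℂ) ^ (-(r : ℂ))) := by
  have hp' : (p : ℂ) ≠ 0 := by exact_mod_cast hp
  refine IsAlgebraic.of_pow r.den_pos ?_
  have h : ((p : ℂ) ^ (-(r : ℂ))) ^ r.den = (p : ℂ) ^ (-r.num) := by
    rw [← Complex.cpow_nat_mul, ← Complex.cpow_intCast]
    congr 1
    have : (r : ℂ) * r.den = r.num := by exact_mod_cast Rat.mul_den_eq_num r
    push_cast
    rw [← this]
    ring
  rw [h, ← Rat.cast_natCast, ← Rat.cast_zpow]
  exact isAlgebraic_algebraMap (A := ℂ) ((p : ℚ) ^ (-r.num))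

/-- What holds for small `X ≠ 0` holds for `X = p ^ (-s)` if the real part of `s` is large. -/
theorem exists_forall_natCast_cpow (p : ℕ) [hp : Fact p.Prime] {q : ℂ → Prop}
    (h : ∀ᶠ X in 𝓝[≠] (0 : ℂ), q X) : ∃ σ : ℝ, ∀ s : ℂ, σ < s.re → q ((p : ℂ) ^ (-s)) := by
  have hp1 : (1 : ℝ) < p := by exact_mod_cast hp.out.one_lt
  have hp0 : (p : ℂ) ≠ 0 := by exact_mod_cast hp.out.ne_zero
  rw [eventually_nhdsWithin_iff, Metric.eventually_nhds_iff] at h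
  obtain ⟨ε, hε, h⟩ := h
  obtain ⟨n, hn⟩ := exists_pow_lt_of_lt_one hε (inv_lt_one_of_one_lt₀ hp1)
  refine ⟨n, fun s hs => ?_⟩
  have hX0 : (p : ℂ) ^ (-s) ≠ 0 := by simp [Complex.cpow_eq_zero_iff, hp0]
  have hXε : ‖(p : ℂ) ^ (-s)‖ < ε := by
    refine lt_trans ?_ hn
    rw [Complex.norm_natCast_cpow_of_pos hp.out.pos, inv_pow, ← Real.rpow_natCast,
      ← Real.rpow_neg (by positivity)]
    exact Real.rpow_lt_rpow_of_exponent_lt hp1 (by simpa using hs)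
  exact h (by simpa using hXε) hX0

/-- Lowest terms are what matters: if numerator and denominator are coprime, a finite limit at a
point forces the denominator to be nonzero there, so that the limit is a quotient of two algebraic
numbers. The common factor is divided out over `k`, before passing to `ℂ`. -/
theorem IsRationalNearZero.exists_meromorphic (hk : ∀ x : k, IsAlgebraic ℚ (algebraMap k ℂ x))
    (p : ℕ) [hp : Fact p.Prime] {f : ℂ → ℂ} (hf : IsRationalNearZero k f) :
    ∃ (M : ℂ → ℂ) (P Q : ℂ[X]),
      (∀ n, IsAlgebraic ℚ (P.coeff n)) ∧ (∀ n, IsAlgebraic ℚ (Q.coeff n)) ∧ Q ≠ 0 ∧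
      (∀ s : ℂ, M s = P.eval ((p : ℂ) ^ (-s)) / Q.eval ((p : ℂ) ^ (-s))) ∧
      Meromorphic M ∧
      (∃ σ : ℝ, ∀ s : ℂ, σ < s.re →
        Q.eval ((p : ℂ) ^ (-s)) ≠ 0 ∧ M s = f ((p : ℂ) ^ (-s))) ∧
      (∀ (r : ℚ) (c : ℂ), Tendsto M (𝓝[≠] (r : ℂ)) (𝓝 c) → IsAlgebraic ℚ c) := by
  classical
  have hp1 : (1 : ℝ) < p := by exact_mod_cast hp.out.one_lt
  have hp0 : (p : ℂ) ≠ 0 := by exact_mod_cast hp.out.ne_zero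
  obtain ⟨P₀, Q₀, h₀⟩ := hf
  have hQ₀ : Q₀ ≠ 0 := by
    rintro rfl
    obtain ⟨X, hX⟩ := h₀.exists
    simp at hX
  set g := EuclideanDomain.gcd P₀ Q₀ with hg
  obtain ⟨P₁, hP₁⟩ : g ∣ P₀ := EuclideanDomain.gcd_dvd_left P₀ Q₀
  obtain ⟨Q₁, hQ₁⟩ : g ∣ Q₀ := EuclideanDomain.gcd_dvd_right P₀ Q₀
  have hg0 : g ≠ 0 := by
    rintro h
    rw [h, zero_mul] at hQ₁
    exact hQ₀ hQ₁
  have hcop : IsCoprime P₁ Q₁ := by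
    have h1 := EuclideanDomain.gcd_eq_gcd_ab P₀ Q₀
    refine ⟨EuclideanDomain.gcdA P₀ Q₀, EuclideanDomain.gcdB P₀ Q₀, mul_left_cancel₀ hg0 ?_⟩
    rw [mul_one]
    conv_rhs => rw [hg, h1]
    nth_rewrite 3 [hP₁]
    nth_rewrite 4 [hQ₁]
    ring
  have hQ₁0 : Q₁ ≠ 0 := by
    rintro rfl
    simp [hQ₀] at hQ₁
  set P := P₁.map (algebraMap k ℂ) with hP
  set Q := Q₁.map (algebraMap k ℂ) with hQ
  have hQ0 : Q ≠ 0 := (Polynomial.map_ne_zero_iff (algebraMap k ℂ).injective).2 hQ₁0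
  have hPe : ∀ X, P.eval X = aeval X P₁ := fun X => by rw [hP, eval_map_algebraMap]
  have hQe : ∀ X, Q.eval X = aeval X Q₁ := fun X => by rw [hQ, eval_map_algebraMap]
  have han : ∀ s : ℂ, AnalyticAt ℂ (fun s : ℂ => (p : ℂ) ^ (-s)) s := by
    intro s
    have : Differentiable ℂ fun s : ℂ => (p : ℂ) ^ (-s) := fun s =>
      (differentiableAt_id.neg).const_cpow (Or.inl hp0)
    exact this.analyticAt s
  have hpoly : ∀ (R : ℂ[X]) (s : ℂ), AnalyticAt ℂ (fun s : ℂ => R.eval ((p : ℂ) ^ (-s))) s := by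
    intro R s
    have := (AnalyticOnNhd.eval_polynomial (A := ℂ) R (𝕜 := ℂ)) ((p : ℂ) ^ (-s)) (Set.mem_univ _)
    exact AnalyticAt.comp (g := fun z => R.eval z) (f := fun s : ℂ => (p : ℂ) ^ (-s)) this (han s)
  -- At a zero of the denominator this function has the default value `0`. The last claim is
  -- unaffected, since it concerns limits over punctured neighbourhoods.
  refine ⟨fun s => P.eval ((p : ℂ) ^ (-s)) / Q.eval ((p : ℂ) ^ (-s)), P, Q, ?_, ?_, hQ0,
    fun _ => rfl, ?_, ?_, ?_⟩
  · intro n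
    rw [hP, coeff_map]
    exact hk _
  · intro n
    rw [hQ, coeff_map]
    exact hk _
  · intro s
    exact (hpoly P s).meromorphicAt.div (hpoly Q s).meromorphicAt
  · obtain ⟨σ, hσ⟩ := exists_forall_natCast_cpow p h₀
    refine ⟨σ, fun s hs => ?_⟩
    obtain ⟨h1, h2⟩ := hσ s hs
    rw [hQ₁, map_mul] at h1
    refine ⟨by rw [hQe]; exact right_ne_zero_of_mul h1, ?_⟩
    simp only [hPe, hQe]
    rw [h2]
    nth_rewrite 1 [hP₁]
    nth_rewrite 1 [hQ₁]
    rw [map_mul, map_mul, mul_div_mul_left _ _ (left_ne_zero_of_mul h1)]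
  · intro r c hc
    set x₀ := (p : ℂ) ^ (-(r : ℂ)) with hx₀
    have hx₀alg : IsAlgebraic ℚ x₀ := isAlgebraic_natCast_cpow_rat p hp.out.ne_zero r
    have halg : ∀ R : k[X], IsAlgebraic ℚ (aeval x₀ R) := by
      intro R
      rw [aeval_eq_sum_range]
      refine mem_algebraicClosure_iff.1 (sum_mem fun i _ => mem_algebraicClosure_iff.2 ?_)
      rw [Algebra.smul_def]
      exact (hk _).mul (hx₀alg.pow _)
    -- The derivative of `s ↦ p ^ (-s)` does not vanish, so near `r` the value `x₀` is taken only at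
    -- `r`. This transports the absence of zeros of `Q` near `x₀`.
    have hxs : Tendsto (fun s : ℂ => (p : ℂ) ^ (-s)) (𝓝[≠] (r : ℂ)) (𝓝[≠] x₀) := by
      refine tendsto_nhdsWithin_iff.2 ⟨(han r).continuousAt.tendsto.mono_left nhdsWithin_le_nhds, ?_⟩
      have hd : HasDerivAt (fun s : ℂ => (p : ℂ) ^ (-s)) ((p : ℂ) ^ (-(r : ℂ)) * Complex.log p * -1)
          (r : ℂ) := (hasDerivAt_id (r : ℂ)).neg.const_cpow (Or.inl hp0)
      refine hd.eventually_ne ?_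
      have : Complex.log (p : ℂ) ≠ 0 := by
        rw [← Complex.natCast_log]
        exact_mod_cast (Real.log_pos hp1).ne'
      simp [Complex.cpow_eq_zero_iff, hp0, this]
    have hQne : ∀ᶠ X in 𝓝[≠] x₀, Q.eval X ≠ 0 := by
      have hfin : Set.Finite {X | Q.IsRoot X} := Polynomial.finite_setOfPred_isRoot hQ0
      have h1 : ({X | Q.IsRoot X} \ {x₀})ᶜ ∈ 𝓝 x₀ :=
        (hfin.subset Set.sdiff_subset).isClosed.isOpen_compl.mem_nhds (by simp)
      filter_upwards [nhdsWithin_le_nhds h1, self_mem_nhdsWithin] with X h2 h3 h4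
      exact h2 ⟨h4, h3⟩
    have hcont : ∀ R : ℂ[X], Tendsto (fun s : ℂ => R.eval ((p : ℂ) ^ (-s))) (𝓝[≠] (r : ℂ))
        (𝓝 (R.eval x₀)) := fun R =>
      (hpoly R r).continuousAt.tendsto.mono_left nhdsWithin_le_nhds
    have hlim : c * Q.eval x₀ = P.eval x₀ := by
      refine tendsto_nhds_unique ((hc.mul (hcont Q)).congr' ?_) (hcont P)
      filter_upwards [hxs.eventually hQne] with s hs
      exact div_mul_cancel₀ _ hs
    -- By `hlim` a zero of `Q₁` would be a zero of `P₁` too, against the Bézout identity.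
    have hQx : aeval x₀ Q₁ ≠ 0 := by
      intro h0
      obtain ⟨a, b, hab⟩ := hcop
      have := congr_arg (aeval x₀) hab
      rw [hQe, h0, mul_zero, hPe] at hlim
      simp [h0, ← hlim] at this
    have : c = aeval x₀ P₁ * (aeval x₀ Q₁)⁻¹ := by
      rw [← hPe, ← hlim, hQe, mul_inv_cancel_right₀ hQx]
    rw [this]
    exact (halg _).mul (halg _).inv

end Continuation

/-! ### Characters are locally constant -/

/-- `ℂˣ` has no small subgroups: as `z ^ 2 ^ n` is within `1/2` of `1`, the factor `z ^ 2 ^ n + 1`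
has absolute value at least `3/2`, so every squaring stretches the distance to `1` by at least
`3/2`. -/
theorem eq_one_of_forall_norm_pow_sub_one_le {z : ℂ} (h : ∀ n : ℕ, ‖z ^ n - 1‖ ≤ 1 / 2) : z = 1 := by
  have key : ∀ n : ℕ, (3 / 2 : ℝ) ^ n * ‖z - 1‖ ≤ ‖z ^ (2 ^ n) - 1‖ := by
    intro n
    induction n with
    | zero => simp
    | succ n ih =>
      have h1 : z ^ (2 ^ (n + 1)) - 1 = (z ^ (2 ^ n) + 1) * (z ^ (2 ^ n) - 1) := by ring
      have h2 : (3 / 2 : ℝ) ≤ ‖z ^ (2 ^ n) + 1‖ := by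
        have h3 : (2 : ℂ) = (z ^ (2 ^ n) + 1) - (z ^ (2 ^ n) - 1) := by ring
        have h4 := norm_sub_le (z ^ (2 ^ n) + 1) (z ^ (2 ^ n) - 1)
        rw [← h3, Complex.norm_ofNat] at h4
        linarith [h (2 ^ n)]
      rw [h1, norm_mul, pow_succ']
      nlinarith [norm_nonneg (z ^ (2 ^ n) - 1)]
  by_contra hz
  have hpos : 0 < ‖z - 1‖ := norm_pos_iff.2 (sub_ne_zero.2 hz)
  obtain ⟨n, hn⟩ := pow_unbounded_of_one_lt (1 / ‖z - 1‖) (by norm_num : (1 : ℝ) < 3 / 2)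
  rw [div_lt_iff₀ hpos] at hn
  linarith [key n, h (2 ^ n)]

/-- A homomorphism to `ℂˣ` is trivial on every subgroup that it maps near `1`. -/
theorem MonoidHom.eq_one_of_mapsTo {A : Type*} [Group A] (χ : A →* ℂˣ) {B : Subgroup A}
    (h : ∀ b ∈ B, ‖(χ b : ℂ) - 1‖ ≤ 1 / 2) {b : A} (hb : b ∈ B) : χ b = 1 := by
  refine Units.ext (eq_one_of_forall_norm_pow_sub_one_le fun n => ?_)
  simpa using h _ (B.pow_mem hb n)

section Orders

variable (p : ℕ) [hp : Fact p.Prime] (D : ℕ)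

/-! ### Orders of `E_p` -/

theorem natCast_prime_ne_zero : (p : ℚ_[p]) ≠ 0 := by exact_mod_cast hp.out.ne_zero

/-- `p` as a unit of `ℚ_p`. -/
def unitP : ℚ_[p]ˣ := Units.mk0 (p : ℚ_[p]) (natCast_prime_ne_zero p)

@[simp] theorem val_unitP : (unitP p : ℚ_[p]) = p := rfl

/-- The inclusion of `ℚ_pˣ` into `E_pˣ`. -/
def scalarUnit : ℚ_[p]ˣ →* (Ep p D)ˣ := Units.map (algebraMap ℚ_[p] (Ep p D)).toMonoidHom

@[simp] theorem val_scalarUnit (a : ℚ_[p]ˣ) :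
    (scalarUnit p D a : Ep p D) = algebraMap ℚ_[p] (Ep p D) a := rfl

/-- The norm `E_pˣ → ℚ_pˣ`. -/
def unitNorm : (Ep p D)ˣ →* ℚ_[p]ˣ := Units.map (QuadraticAlgebra.norm : Ep p D →* ℚ_[p])

@[simp] theorem val_unitNorm (x : (Ep p D)ˣ) :
    (unitNorm p D x : ℚ_[p]) = QuadraticAlgebra.norm (x : Ep p D) := rfl

/-- A compact open subring of `E_p`, stable under conjugation, that contains `ℤ_p` and `δ`. -/
structure LocalOrder extends Subring (Ep p D) where
  isOpen : IsOpen (carrier : Set (Ep p D))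
  isCompact : IsCompact (carrier : Set (Ep p D))
  star_mem : ∀ x ∈ carrier, star x ∈ carrier
  omega_mem : (QuadraticAlgebra.omega : Ep p D) ∈ carrier
  algebraMap_mem : ∀ a : ℚ_[p], ‖a‖ ≤ 1 → algebraMap ℚ_[p] (Ep p D) a ∈ carrier

variable {p D}

instance : SetLike (LocalOrder p D) (Ep p D) where
  coe O := O.carrier
  coe_injective := by
    rintro ⟨A, _⟩ ⟨B, _⟩ h
    congr
    exact SetLike.coe_injective h

instance : SubringClass (LocalOrder p D) (Ep p D) where
  mul_mem {O} := O.mul_mem'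
  one_mem O := O.one_mem'
  add_mem {O} := O.add_mem'
  zero_mem O := O.zero_mem'
  neg_mem {O} := O.neg_mem'

namespace LocalOrder

variable (O : LocalOrder p D)

/-- The unit group of an order, as a subgroup of `E_pˣ`. -/
def unitGroup : Subgroup (Ep p D)ˣ := O.toSubring.toSubmonoid.units

variable {O}

theorem mem_unitGroup {u : (Ep p D)ˣ} :
    u ∈ O.unitGroup ↔ (u : Ep p D) ∈ O ∧ ((u⁻¹ : (Ep p D)ˣ) : Ep p D) ∈ O := Iff.rfl

variable (O)

/-- The powers of `a` stay in the compact set `O`, so their norms are bounded. -/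
theorem norm_le_one_of_algebraMap_mem {a : ℚ_[p]} (ha : algebraMap ℚ_[p] (Ep p D) a ∈ O) :
    ‖a‖ ≤ 1 := by
  obtain ⟨C, hC⟩ := (O.isCompact.image (continuous_re p D)).isBounded.exists_norm_le
  have h : ∀ n : ℕ, ‖a‖ ^ n ≤ C := by
    intro n
    have h1 : algebraMap ℚ_[p] (Ep p D) (a ^ n) ∈ O := by
      rw [map_pow]
      exact pow_mem ha n
    rw [← norm_pow]
    exact hC _ ⟨_, h1, rfl⟩
  by_contra h1
  obtain ⟨n, hn⟩ := pow_unbounded_of_one_lt C (not_le.1 h1)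
  exact absurd (h n) (not_le.2 hn)

theorem norm_norm_le_one {x : Ep p D} (hx : x ∈ O) : ‖QuadraticAlgebra.norm x‖ ≤ 1 := by
  refine O.norm_le_one_of_algebraMap_mem ?_
  rw [QuadraticAlgebra.algebraMap_norm_eq_mul_star]
  exact mul_mem hx (O.star_mem x hx)

theorem norm_trace_le_one {x : Ep p D} (hx : x ∈ O) : ‖QuadraticAlgebra.trace x‖ ≤ 1 := by
  refine O.norm_le_one_of_algebraMap_mem ?_
  rw [QuadraticAlgebra.algebraMap_trace_eq_add_star]
  exact add_mem hx (O.star_mem x hx)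

theorem norm_unitNorm_eq_one {u : (Ep p D)ˣ} (hu : u ∈ O.unitGroup) :
    ‖(unitNorm p D u : ℚ_[p])‖ = 1 := by
  have h1 : ‖(unitNorm p D u : ℚ_[p])‖ ≤ 1 := O.norm_norm_le_one hu.1
  have h2 : ‖(unitNorm p D u⁻¹ : ℚ_[p])‖ ≤ 1 := O.norm_norm_le_one hu.2
  have h3 : (unitNorm p D u : ℚ_[p]) * (unitNorm p D u⁻¹ : ℚ_[p]) = 1 := by
    rw [← Units.val_mul, ← map_mul, mul_inv_cancel, map_one, Units.val_one]
  have h4 := congr_arg norm h3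
  rw [norm_mul, norm_one] at h4
  refine le_antisymm h1 ?_
  nlinarith [norm_nonneg (unitNorm p D u : ℚ_[p])]

theorem isOpen_unitGroup : IsOpen (O.unitGroup : Set (Ep p D)ˣ) :=
  (O.isOpen.preimage Units.continuous_val).inter
    (O.isOpen.preimage (Units.continuous_val.comp continuous_inv))

theorem prime_mem : algebraMap ℚ_[p] (Ep p D) p ∈ O :=
  O.algebraMap_mem _ (Padic.norm_p_lt_one.le)

theorem zpow_smul_mem_of_le {x : Ep p D} {m n : ℤ} (hmn : m ≤ n)
    {Ω : AddSubgroup (Ep p D)} (hΩ : ∀ o ∈ O, ∀ x ∈ Ω, o * x ∈ Ω)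
    (hx : (p : ℚ_[p]) ^ m • x ∈ Ω) : (p : ℚ_[p]) ^ n • x ∈ Ω := by
  obtain ⟨r, rfl⟩ := Int.le.dest hmn
  rw [add_comm, zpow_add₀ (natCast_prime_ne_zero p), mul_smul, zpow_natCast, Algebra.smul_def]
  refine hΩ _ ?_ _ hx
  rw [map_pow]
  exact pow_mem O.prime_mem r

/-- An `O`-submodule of `E_p` that is open and bounded: it absorbs every vector under
multiplication by powers of `p`, and contains no line. -/
structure IsLattice (Ω : AddSubgroup (Ep p D)) : Prop where
  mul_mem : ∀ o ∈ O, ∀ x ∈ Ω, o * x ∈ Ω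
  exists_mem : ∀ x, ∃ n : ℤ, (p : ℚ_[p]) ^ n • x ∈ Ω
  exists_notMem : ∀ x ≠ 0, ∃ n : ℤ, (p : ℚ_[p]) ^ n • x ∉ Ω

variable {O}

/-- The exponents in question form a nonempty set of integers that is bounded below and closed
upwards. -/
theorem IsLattice.exists_iff {Ω : AddSubgroup (Ep p D)} (hΩ : O.IsLattice Ω) {x : Ep p D}
    (hx : x ≠ 0) : ∃ a : ℤ, ∀ n : ℤ, (p : ℚ_[p]) ^ n • x ∈ Ω ↔ a ≤ n := by
  obtain ⟨b, hb⟩ := hΩ.exists_notMem x hx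
  obtain ⟨a, ha, hmin⟩ := Int.exists_least_of_bdd (P := fun n => (p : ℚ_[p]) ^ n • x ∈ Ω)
    ⟨b, fun z hz => by
      by_contra h
      exact hb (O.zpow_smul_mem_of_le (not_le.1 h).le hΩ.mul_mem hz)⟩ (hΩ.exists_mem x)
  exact ⟨a, fun n => ⟨hmin n, fun h => O.zpow_smul_mem_of_le h hΩ.mul_mem ha⟩⟩

variable (O)

/-- A family of representatives of `E_pˣ` modulo the units of `O`. -/
def IsTransversal {ι : Type} (x : ι → (Ep p D)ˣ) : Prop :=
  ∀ y : (Ep p D)ˣ, ∃! i, (x i)⁻¹ * y ∈ O.unitGroup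

/-- The part of the family `x` in the lattice `Ω` is built from finite families in `Ω` by repeated
multiplication with the powers of topologically nilpotent elements of `O`. -/
def IsOrthantFamily {ι : Type} (x : ι → (Ep p D)ˣ) : Prop :=
  ∀ Ω : AddSubgroup (Ep p D), O.IsLattice Ω → ∀ Good : ∀ {κ : Type}, (κ → (Ep p D)ˣ) → Prop,
    (∀ {κ κ' : Type} (g : κ ≃ κ') (y : κ' → (Ep p D)ˣ), Good (fun i => y (g i)) → Good y) →
    (∀ {κ : Type} [Finite κ] (y : κ → (Ep p D)ˣ), (∀ i, (y i : Ep p D) ∈ Ω) → Good y) →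
    (∀ {κ : Type} (y : κ → (Ep p D)ˣ), (∀ i, (y i : Ep p D) ∈ Ω) → Good y →
      ∀ w : (Ep p D)ˣ, (w : Ep p D) ∈ O → ‖(unitNorm p D w : ℚ_[p])‖ < 1 →
        Good (fun i : ℕ × κ => w ^ i.1 * y i.2)) →
    Good (fun i : {i : ι // (x i : Ep p D) ∈ Ω} => x i)

end LocalOrder

end Orders

/-! ### The order `ℤ_p[δ]`, and representatives of `E_pˣ` modulo units when `E_p` is a field -/

section Transversals

variable {p : ℕ} [hp : Fact p.Prime] {D : ℕ}

theorem mem_closedBall_zero_iff' {a : ℚ_[p]} : a ∈ Metric.closedBall (0 : ℚ_[p]) 1 ↔ ‖a‖ ≤ 1 := by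
  simp

theorem norm_mul_le_one {a b : ℚ_[p]} (ha : ‖a‖ ≤ 1) (hb : ‖b‖ ≤ 1) : ‖a * b‖ ≤ 1 := by
  rw [norm_mul]
  exact mul_le_one₀ ha (norm_nonneg _) hb

theorem norm_add_le_one {a b : ℚ_[p]} (ha : ‖a‖ ≤ 1) (hb : ‖b‖ ≤ 1) : ‖a + b‖ ≤ 1 :=
  (Padic.nonarchimedean a b).trans (max_le ha hb)

theorem isOpen_norm_le_one {X : Type*} [TopologicalSpace X] {f : X → ℚ_[p]} (hf : Continuous f) :
    IsOpen {x | ‖f x‖ ≤ 1} := by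
  have : {x | ‖f x‖ ≤ 1} = f ⁻¹' Metric.closedBall 0 1 := by ext; simp
  rw [this]
  exact (IsUltrametricDist.isOpen_closedBall 0 one_ne_zero).preimage hf

theorem norm_eq_one_of_zpow_sub {a : ℚ_[p]} (ha : a ≠ 0) (n : ℤ) :
    ‖(p : ℚ_[p]) ^ (-n) * a‖ = 1 ↔ n = a.valuation := by
  rw [norm_mul, Padic.norm_p_zpow, Padic.norm_eq_zpow_neg_valuation ha, neg_neg,
    ← zpow_add₀ (by exact_mod_cast hp.out.ne_zero : (p : ℝ) ≠ 0),
    zpow_eq_one_iff_right₀ (by positivity) (by exact_mod_cast hp.out.one_lt.ne')]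
  omega

variable (p D) in
/-- The order `ℤ_p[δ]`. -/
def quadraticOrder : LocalOrder p D where
  carrier := {x | ‖x.re‖ ≤ 1 ∧ ‖x.im‖ ≤ 1}
  mul_mem' := by
    rintro x y ⟨hx, hx'⟩ ⟨hy, hy'⟩
    have hD : ‖(-(D : ℚ_[p]))‖ ≤ 1 := by
      rw [norm_neg]
      exact_mod_cast Padic.norm_int_le_one (p := p) (D : ℤ)
    refine ⟨?_, ?_⟩
    · rw [QuadraticAlgebra.re_mul]
      exact norm_add_le_one (norm_mul_le_one hx hy) (norm_mul_le_one (norm_mul_le_one hD hx') hy')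
    · rw [QuadraticAlgebra.im_mul, zero_mul, zero_mul, add_zero]
      exact norm_add_le_one (norm_mul_le_one hx hy') (norm_mul_le_one hx' hy)
  one_mem' := by simp [QuadraticAlgebra.re_one, QuadraticAlgebra.im_one]
  add_mem' := by
    rintro x y ⟨hx, hx'⟩ ⟨hy, hy'⟩
    exact ⟨norm_add_le_one hx hy, norm_add_le_one hx' hy'⟩
  zero_mem' := by simp
  neg_mem' := by
    rintro x ⟨hx, hx'⟩
    exact ⟨by simpa using hx, by simpa using hx'⟩
  isOpen := (isOpen_norm_le_one (continuous_re p D)).inter (isOpen_norm_le_one (continuous_im p D))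
  isCompact := by
    have h : IsCompact (Metric.closedBall (0 : ℚ_[p]) 1 ×ˢ Metric.closedBall (0 : ℚ_[p]) 1) :=
      (isCompact_closedBall 0 1).prod (isCompact_closedBall 0 1)
    refine (((equivProdHomeo p D).isCompact_preimage).2 h).of_isClosed_subset ?_ ?_
    · exact (isClosed_le (continuous_re p D).norm continuous_const).inter
        (isClosed_le (continuous_im p D).norm continuous_const)
    · rintro x ⟨h1, h2⟩
      exact ⟨mem_closedBall_zero_iff'.2 h1, mem_closedBall_zero_iff'.2 h2⟩
  star_mem := by
    rintro x ⟨h1, h2⟩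
    exact ⟨by simpa using h1, by simpa using h2⟩
  omega_mem := by
    exact ⟨by simp, by simp⟩
  algebraMap_mem := by
    intro a ha
    exact ⟨by simpa using ha, by simp⟩

/-- Openness gives absorption, because `p ^ n • x` tends to `0`. Compactness bounds both coordinates
and so excludes lines. -/
theorem LocalOrder.isLattice_self (O : LocalOrder p D) : O.IsLattice O.toSubring.toAddSubgroup where
  mul_mem o ho x hx := mul_mem (S := LocalOrder p D) ho hx
  exists_mem x := by
    have h : Tendsto (fun n : ℕ => (p : ℚ_[p]) ^ n • x) atTop (𝓝 0) := by
      have h1 : Tendsto (fun n : ℕ => (p : ℚ_[p]) ^ n) atTop (𝓝 0) :=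
        tendsto_pow_atTop_nhds_zero_of_norm_lt_one Padic.norm_p_lt_one
      have h2 : Continuous fun a : ℚ_[p] => a • x := by
        have : Continuous (algebraMap ℚ_[p] (Ep p D)) := by
          rw [(isInducing_equivProd p D).continuous_iff]
          exact continuous_id.prodMk continuous_const
        simp_rw [Algebra.smul_def]
        exact this.mul continuous_const
      rw [← zero_smul ℚ_[p] x]
      exact (h2.tendsto 0).comp h1
    obtain ⟨n, hn⟩ := (h.eventually (O.isOpen.mem_nhds (zero_mem O))).exists
    refine ⟨n, ?_⟩
    rw [zpow_natCast]
    exact hn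
  exists_notMem x hx := by
    by_contra! h
    have key : ∀ f : Ep p D → ℚ_[p], Continuous f → (∀ a y, f (a • y) = a * f y) → f x = 0 := by
      intro f hf hfs
      by_contra h0
      obtain ⟨C, hC⟩ := (O.isCompact.image hf).isBounded.exists_norm_le
      obtain ⟨n, hn⟩ := pow_unbounded_of_one_lt (C / ‖f x‖)
        (by exact_mod_cast hp.out.one_lt : (1 : ℝ) < p)
      have h1 := hC _ ⟨_, h (-n), rfl⟩
      rw [hfs, norm_mul, Padic.norm_p_zpow, neg_neg, zpow_natCast] at h1
      rw [div_lt_iff₀ (norm_pos_iff.2 h0)] at hn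
      linarith
    refine hx ?_
    ext
    · exact key _ (continuous_re p D) fun _ _ => rfl
    · exact key _ (continuous_im p D) fun _ _ => rfl

theorem val_scalarUnit_unitP_zpow_mul (n : ℤ) (x : (Ep p D)ˣ) :
    ((scalarUnit p D (unitP p) ^ n * x : (Ep p D)ˣ) : Ep p D) = (p : ℚ_[p]) ^ n • (x : Ep p D) := by
  rw [← map_zpow, Units.val_mul, val_scalarUnit, Units.val_zpow_eq_zpow_val, val_unitP,
    Algebra.smul_def]

theorem norm_unitNorm_scalarUnit_zpow (n : ℤ) :
    ‖(unitNorm p D (scalarUnit p D (unitP p) ^ n) : ℚ_[p])‖ = (p : ℝ) ^ (-(2 * n)) := by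
  rw [map_zpow, Units.val_zpow_eq_zpow_val, val_unitNorm, val_scalarUnit,
    QuadraticAlgebra.norm_algebraMap, val_unitP, norm_zpow, norm_pow, Padic.norm_p,
    ← zpow_natCast, ← _root_.zpow_mul, _root_.inv_zpow, ← _root_.zpow_neg]
  norm_num

/-- The norm is `re ^ 2 + D * im ^ 2`, and a nontrivial zero would make `re / im` a square root of
`-D`. -/
theorem norm_ne_zero_of_nonsquare (hsq : ∀ d : ℚ_[p], d ^ 2 ≠ -(D : ℚ_[p])) {x : Ep p D}
    (hx : x ≠ 0) : QuadraticAlgebra.norm x ≠ 0 := by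
  intro h
  rw [QuadraticAlgebra.norm_def, zero_mul, zero_mul, add_zero] at h
  by_cases him : x.im = 0
  · refine hx ?_
    rw [him, mul_zero, sub_zero] at h
    ext
    · exact mul_self_eq_zero.1 h
    · exact him
  · refine hsq (x.re / x.im) ?_
    rw [div_pow, div_eq_iff (pow_ne_zero 2 him)]
    linear_combination h

/-- If `E_p` is a field, its multiplicative group has a cocompact discrete subgroup generated
by `p`. -/
theorem exists_isTransversal_of_nonsquare (hsq : ∀ d : ℚ_[p], d ^ 2 ≠ -(D : ℚ_[p])) :
    ∃ (O : LocalOrder p D) (ι : Type) (_ : Countable ι) (x : ι → (Ep p D)ˣ),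
      O.IsTransversal x ∧ O.IsOrthantFamily x := by
  set O := quadraticOrder p D
  set P := scalarUnit p D (unitP p) with hP
  set A : Subgroup (Ep p D)ˣ := O.unitGroup ⊔ Subgroup.zpowers P with hA
  have hAopen : IsOpen (A : Set (Ep p D)ˣ) :=
    Subgroup.isOpen_mono (le_sup_left : O.unitGroup ≤ A) O.isOpen_unitGroup
  have hdisc : DiscreteTopology ((Ep p D)ˣ ⧸ A) := QuotientGroup.discreteTopology hAopen
  -- The quotient is discrete because `A` is open, and compact because every class meets the shell
  -- `O \ pO`, which is a compact set of units.
  have hfin : Finite ((Ep p D)ˣ ⧸ A) := by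
    set S : Set (Ep p D) := {x | x ∈ O ∧ (p : ℚ_[p]) ^ (-1 : ℤ) • x ∉ O} with hS
    have hsmul : Continuous fun x : Ep p D => (p : ℚ_[p]) ^ (-1 : ℤ) • x := by
      simp_rw [Algebra.smul_def]
      exact continuous_const.mul continuous_id
    have hScomp : IsCompact S :=
      O.isCompact.inter_right ((O.isOpen.preimage hsmul).isClosed_compl)
    -- This is where `E_p` has to be a field: elements of the shell are nonzero, hence invertible.
    have hS0 : ∀ x : S, QuadraticAlgebra.norm (x : Ep p D) ≠ 0 := by
      rintro ⟨x, hx⟩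
      refine norm_ne_zero_of_nonsquare hsq ?_
      rintro rfl
      exact hx.2 (by simp [zero_mem])
    have hinv : ∀ x : S, (x : Ep p D) *
        ((QuadraticAlgebra.norm (x : Ep p D))⁻¹ • star (x : Ep p D)) = 1 := by
      intro x
      rw [mul_smul_comm, ← QuadraticAlgebra.algebraMap_norm_eq_mul_star, Algebra.smul_def,
        ← map_mul, inv_mul_cancel₀ (hS0 x), map_one]
    let f : S → (Ep p D)ˣ := fun x => ⟨x, (QuadraticAlgebra.norm (x : Ep p D))⁻¹ • star (x : Ep p D),
      hinv x, by rw [mul_comm]; exact hinv x⟩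
    have hf : Continuous f := by
      rw [Units.continuous_iff]
      refine ⟨continuous_subtype_val, ?_⟩
      have h1 : Continuous fun x : S => (QuadraticAlgebra.norm (x : Ep p D))⁻¹ :=
        ((continuous_norm_Ep p D).comp continuous_subtype_val).inv₀ hS0
      have h2 := (continuous_re p D).comp (continuous_subtype_val (p := (· ∈ S)))
      have h3 := (continuous_im p D).comp (continuous_subtype_val (p := (· ∈ S)))
      rw [(isInducing_equivProd p D).continuous_iff]
      refine Continuous.prodMk ?_ ?_
      · refine (h1.mul (h2.add ((continuous_const (y := (0 : ℚ_[p]))).mul h3))).congr fun x => ?_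
        rfl
      · exact h1.mul h3.neg
    have : CompactSpace S := isCompact_iff_compactSpace.1 hScomp
    have hsurj : Function.Surjective fun x : S => (QuotientGroup.mk (f x) : (Ep p D)ˣ ⧸ A) := by
      intro q
      obtain ⟨y, rfl⟩ := QuotientGroup.mk_surjective q
      obtain ⟨a, ha⟩ := O.isLattice_self.exists_iff y.ne_zero
      have hmemS : ((P ^ a * y : (Ep p D)ˣ) : Ep p D) ∈ S := by
        refine ⟨?_, ?_⟩
        · rw [val_scalarUnit_unitP_zpow_mul]
          exact (ha a).2 le_rfl
        · rw [val_scalarUnit_unitP_zpow_mul, smul_smul, ← zpow_add₀ (natCast_prime_ne_zero p)]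
          intro h
          have := (ha _).1 h
          omega
      refine ⟨⟨_, hmemS⟩, QuotientGroup.eq.2 (Subgroup.mem_sup_right ⟨-a, ?_⟩ : _ ∈ A)⟩
      have : f ⟨_, hmemS⟩ = P ^ a * y := Units.ext rfl
      rw [this]
      simp [mul_comm]
    have : CompactSpace ((Ep p D)ˣ ⧸ A) :=
      hsurj.compactSpace (QuotientGroup.continuous_mk.comp hf)
    exact finite_of_compact_of_discrete
  have hmemA : ∀ y : (Ep p D)ˣ, y ∈ A ↔ ∃ n : ℤ, P ^ (-n) * y ∈ O.unitGroup := by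
    intro y
    rw [hA, Subgroup.mem_sup]
    constructor
    · rintro ⟨o, ho, _, ⟨n, rfl⟩, rfl⟩
      exact ⟨n, by simpa [mul_comm o] using ho⟩
    · rintro ⟨n, hn⟩
      exact ⟨_, hn, P ^ n, ⟨n, rfl⟩, by rw [mul_comm, ← mul_assoc, ← _root_.zpow_add, add_neg_cancel, zpow_zero, one_mul]⟩
  let r : (Ep p D)ˣ ⧸ A → (Ep p D)ˣ := Quotient.out
  have hr : ∀ q, (QuotientGroup.mk (r q) : (Ep p D)ˣ ⧸ A) = q := QuotientGroup.out_eq'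
  refine ⟨O, ℤ × ((Ep p D)ˣ ⧸ A), inferInstance, fun i => P ^ i.1 * r i.2, ?_, ?_⟩
  · intro y
    have h1 : (r (QuotientGroup.mk y))⁻¹ * y ∈ A := QuotientGroup.eq.1 (hr _)
    obtain ⟨n, hn⟩ := (hmemA _).1 h1
    refine ⟨(n, QuotientGroup.mk y), ?_, ?_⟩
    · simpa [mul_assoc, mul_comm, mul_left_comm] using hn
    · rintro ⟨m, q⟩ hm
      have hm' : P ^ (-m) * ((r q)⁻¹ * y) ∈ O.unitGroup := by
        simpa [mul_assoc, mul_comm, mul_left_comm] using hm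
      have hq : q = QuotientGroup.mk y := by
        rw [← hr q]
        exact QuotientGroup.eq.2 ((hmemA _).2 ⟨m, hm'⟩)
      subst hq
      have h2 := O.unitGroup.mul_mem hm' (O.unitGroup.inv_mem hn)
      -- Two indices for the same class differ by a power of `p` that is a unit of `O`. Its norm has
      -- absolute value one, so the exponent is zero.
      have h3 : P ^ (-m) * ((r (QuotientGroup.mk y))⁻¹ * y) *
          (P ^ (-n) * ((r (QuotientGroup.mk y))⁻¹ * y))⁻¹ = P ^ (n - m) := by
        rw [mul_inv, mul_mul_mul_comm, mul_inv_cancel, mul_one, ← _root_.zpow_neg, ← _root_.zpow_add]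
        congr 1
        ring
      rw [h3] at h2
      have h4 := O.norm_unitNorm_eq_one h2
      rw [norm_unitNorm_scalarUnit_zpow, zpow_eq_one_iff_right₀ (by positivity)
        (by exact_mod_cast hp.out.one_lt.ne')] at h4
      have : m = n := by omega
      rw [this]
  · intro Ω hΩ Good hcongr hgfin hrec
    -- In each class of the finite quotient the exponents of `p` allowed by `Ω` form a half line
    -- starting at `a q`. The family is thus a finite set times `ℕ`, and one recursion step
    -- suffices.
    choose a ha using fun q => hΩ.exists_iff (r q).ne_zero
    have hmem : ∀ q (n : ℤ), ((P ^ n * r q : (Ep p D)ˣ) : Ep p D) ∈ Ω ↔ a q ≤ n := by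
      intro q n
      rw [val_scalarUnit_unitP_zpow_mul]
      exact ha q n
    have h0 : ∀ q, ((P ^ a q * r q : (Ep p D)ˣ) : Ep p D) ∈ Ω := fun q => (hmem q _).2 le_rfl
    have h1 := hrec (fun q => P ^ a q * r q) h0 (hgfin _ h0) P O.prime_mem (by
      have := norm_unitNorm_scalarUnit_zpow (p := p) (D := D) 1
      rw [zpow_one] at this
      rw [this]
      exact zpow_lt_one_of_neg₀ (by exact_mod_cast hp.out.one_lt) (by norm_num))
    let g : ℕ × ((Ep p D)ˣ ⧸ A) ≃ {i : ℤ × ((Ep p D)ˣ ⧸ A) //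
        ((P ^ i.1 * r i.2 : (Ep p D)ˣ) : Ep p D) ∈ Ω} :=
      { toFun := fun i => ⟨(i.1 + a i.2, i.2), (hmem i.2 _).2 (by omega)⟩
        invFun := fun i => ((i.1.1 - a i.1.2).toNat, i.1.2)
        left_inv := by
          rintro ⟨n, q⟩
          simp
        right_inv := by
          rintro ⟨⟨n, q⟩, h⟩
          have := (hmem q n).1 h
          simp [this] }
    refine hcongr g _ ?_
    convert! h1 using 2 with i
    simp only [g, Equiv.coe_fn_mk, ← mul_assoc, ← zpow_natCast, ← _root_.zpow_add]

end Transversals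

/-! ### Representatives of `E_pˣ` modulo units when `E_p` is split -/

section Split

variable {p : ℕ} [hp : Fact p.Prime] {D : ℕ}

/-- If `-D = d ^ 2` with `d ≠ 0`, then `E_p` is `ℚ_p × ℚ_p`. -/
def splitEquiv {d : ℚ_[p]} (hd : d ^ 2 = -(D : ℚ_[p])) (hd0 : d ≠ 0) :
    Ep p D ≃+* ℚ_[p] × ℚ_[p] where
  toFun x := (x.re + d * x.im, x.re - d * x.im)
  invFun y := ⟨(y.1 + y.2) / 2, (y.1 - y.2) / (2 * d)⟩
  left_inv x := by
    ext
    · simp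
    · field_simp
      ring
  right_inv y := by
    ext
    · field_simp
      ring
    · field_simp
      ring
  map_mul' x y := by
    ext
    · simp only [QuadraticAlgebra.re_mul, QuadraticAlgebra.im_mul, ← hd, Prod.mk_mul_mk]
      ring
    · simp only [QuadraticAlgebra.re_mul, QuadraticAlgebra.im_mul, ← hd, Prod.mk_mul_mk]
      ring
  map_add' x y := by
    ext
    · simp only [QuadraticAlgebra.re_add, QuadraticAlgebra.im_add, Prod.mk_add_mk]
      ring
    · simp only [QuadraticAlgebra.re_add, QuadraticAlgebra.im_add, Prod.mk_add_mk]
      ring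

variable {d : ℚ_[p]} (hd : d ^ 2 = -(D : ℚ_[p])) (hd0 : d ≠ 0)

theorem splitEquiv_fst (x : Ep p D) : (splitEquiv hd hd0 x).1 = x.re + d * x.im := rfl

theorem splitEquiv_snd (x : Ep p D) : (splitEquiv hd hd0 x).2 = x.re - d * x.im := rfl

theorem splitEquiv_star (x : Ep p D) : splitEquiv hd hd0 (star x) = (splitEquiv hd hd0 x).swap := by
  ext <;> simp [splitEquiv_fst, splitEquiv_snd, sub_eq_add_neg]

theorem splitEquiv_algebraMap (a : ℚ_[p]) :
    splitEquiv hd hd0 (algebraMap ℚ_[p] (Ep p D) a) = (a, a) := by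
  ext <;> simp [splitEquiv_fst, splitEquiv_snd]

theorem splitEquiv_smul (a : ℚ_[p]) (x : Ep p D) :
    splitEquiv hd hd0 (a • x) = a • splitEquiv hd hd0 x := by
  rw [Algebra.smul_def, map_mul, splitEquiv_algebraMap]
  rfl

theorem norm_eq_splitEquiv (x : Ep p D) :
    QuadraticAlgebra.norm x = (splitEquiv hd hd0 x).1 * (splitEquiv hd hd0 x).2 := by
  rw [splitEquiv_fst, splitEquiv_snd, QuadraticAlgebra.norm_def]
  linear_combination x.im ^ 2 * hd

theorem continuous_splitEquiv : Continuous (splitEquiv hd hd0) := by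
  have h1 := continuous_re p D
  have h2 := continuous_im p D
  exact (h1.add (continuous_const.mul h2)).prodMk (h1.sub (continuous_const.mul h2))

theorem continuous_splitEquiv_symm : Continuous (splitEquiv hd hd0).symm := by
  rw [(isInducing_equivProd p D).continuous_iff]
  exact ((continuous_fst.add continuous_snd).div_const 2).prodMk
    ((continuous_fst.sub continuous_snd).div_const (2 * d))

/-- The order `ℤ_p × ℤ_p` of a split `E_p`. -/
def splitOrder : LocalOrder p D where
  carrier := {x | ‖(splitEquiv hd hd0 x).1‖ ≤ 1 ∧ ‖(splitEquiv hd hd0 x).2‖ ≤ 1}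
  mul_mem' := by
    rintro x y ⟨hx, hx'⟩ ⟨hy, hy'⟩
    simp only [Set.mem_ofPred_eq, map_mul]
    exact ⟨norm_mul_le_one hx hy, norm_mul_le_one hx' hy'⟩
  one_mem' := by simp
  add_mem' := by
    rintro x y ⟨hx, hx'⟩ ⟨hy, hy'⟩
    simp only [Set.mem_ofPred_eq, map_add]
    exact ⟨norm_add_le_one hx hy, norm_add_le_one hx' hy'⟩
  zero_mem' := by simp
  neg_mem' := by
    rintro x ⟨hx, hx'⟩
    simp only [Set.mem_ofPred_eq, map_neg]
    exact ⟨by simpa using hx, by simpa using hx'⟩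
  isOpen := (isOpen_norm_le_one (continuous_fst.comp (continuous_splitEquiv hd hd0))).inter
    (isOpen_norm_le_one (continuous_snd.comp (continuous_splitEquiv hd hd0)))
  isCompact := by
    have h : IsCompact (Metric.closedBall (0 : ℚ_[p]) 1 ×ˢ Metric.closedBall (0 : ℚ_[p]) 1) :=
      (isCompact_closedBall 0 1).prod (isCompact_closedBall 0 1)
    convert! h.image (continuous_splitEquiv_symm hd hd0) using 1
    ext x
    constructor
    · rintro ⟨h1, h2⟩
      exact ⟨splitEquiv hd hd0 x, ⟨mem_closedBall_zero_iff'.2 h1, mem_closedBall_zero_iff'.2 h2⟩,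
        by simp⟩
    · rintro ⟨y, ⟨h1, h2⟩, rfl⟩
      exact ⟨by simpa using h1, by simpa using h2⟩
  star_mem := by
    rintro x ⟨h1, h2⟩
    simp only [Set.mem_ofPred_eq, splitEquiv_star]
    exact ⟨h2, h1⟩
  omega_mem := by
    have hdn : ‖d‖ ≤ 1 := by
      have h1 : ‖d‖ ^ 2 ≤ 1 := by
        rw [← norm_pow, hd, norm_neg]
        exact_mod_cast Padic.norm_int_le_one (p := p) (D : ℤ)
      exact (pow_le_one_iff_of_nonneg (norm_nonneg d) two_ne_zero).1 h1
    refine ⟨?_, ?_⟩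
    · simpa [splitEquiv_fst] using hdn
    · simpa [splitEquiv_snd] using hdn
  algebraMap_mem := by
    intro a ha
    simp only [Set.mem_ofPred_eq, splitEquiv_algebraMap]
    exact ⟨ha, ha⟩

theorem mem_splitOrder {x : Ep p D} : x ∈ splitOrder hd hd0 ↔
    ‖(splitEquiv hd hd0 x).1‖ ≤ 1 ∧ ‖(splitEquiv hd hd0 x).2‖ ≤ 1 := Iff.rfl

/-- The unit of a split `E_p` with the components `p ^ m` and `p ^ n`. -/
def splitUnit (m n : ℤ) : (Ep p D)ˣ :=
  Units.map (splitEquiv hd hd0).symm.toMonoidHom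
    (MulEquiv.prodUnits.symm (unitP p ^ m, unitP p ^ n))

theorem splitEquiv_splitUnit (m n : ℤ) :
    splitEquiv hd hd0 (splitUnit hd hd0 m n : Ep p D) = ((p : ℚ_[p]) ^ m, (p : ℚ_[p]) ^ n) := by
  have h : (splitUnit hd hd0 m n : Ep p D) =
      (splitEquiv hd hd0).symm ((p : ℚ_[p]) ^ m, (p : ℚ_[p]) ^ n) := by
    refine congr_arg (splitEquiv hd hd0).symm (Prod.ext ?_ ?_)
    · exact Units.val_zpow_eq_zpow_val _ _
    · exact Units.val_zpow_eq_zpow_val _ _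
  rw [h, RingEquiv.apply_symm_apply]

theorem splitUnit_mul (m n m' n' : ℤ) :
    splitUnit hd hd0 m n * splitUnit hd hd0 m' n' = splitUnit hd hd0 (m + m') (n + n') := by
  refine Units.ext ((splitEquiv hd hd0).injective ?_)
  rw [Units.val_mul, map_mul, splitEquiv_splitUnit, splitEquiv_splitUnit, splitEquiv_splitUnit,
    zpow_add₀ (natCast_prime_ne_zero p), zpow_add₀ (natCast_prime_ne_zero p)]
  rfl

theorem splitUnit_inv (m n : ℤ) :
    (splitUnit hd hd0 m n)⁻¹ = splitUnit hd hd0 (-m) (-n) := by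
  rw [inv_eq_iff_mul_eq_one, splitUnit_mul, add_neg_cancel, add_neg_cancel]
  refine Units.ext ((splitEquiv hd hd0).injective ?_)
  rw [splitEquiv_splitUnit]
  simp

theorem splitUnit_pow (m n : ℤ) (r : ℕ) :
    splitUnit hd hd0 m n ^ r = splitUnit hd hd0 (r * m) (r * n) := by
  refine Units.ext ((splitEquiv hd hd0).injective ?_)
  rw [Units.val_pow_eq_pow_val, map_pow, splitEquiv_splitUnit, splitEquiv_splitUnit, Prod.pow_mk,
    ← zpow_natCast, ← zpow_natCast, ← _root_.zpow_mul, ← _root_.zpow_mul, mul_comm m, mul_comm n]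

theorem mem_unitGroup_splitOrder {u : (Ep p D)ˣ} : u ∈ (splitOrder hd hd0).unitGroup ↔
    ‖(splitEquiv hd hd0 (u : Ep p D)).1‖ = 1 ∧ ‖(splitEquiv hd hd0 (u : Ep p D)).2‖ = 1 := by
  have h : splitEquiv hd hd0 (u : Ep p D) * splitEquiv hd hd0 ((u⁻¹ : (Ep p D)ˣ) : Ep p D) = 1 := by
    rw [← map_mul, Units.mul_inv, map_one]
  have h1 := congr_arg (fun z => ‖z.1‖) h
  have h2 := congr_arg (fun z => ‖z.2‖) h
  simp only [Prod.fst_mul, Prod.snd_mul, norm_mul, Prod.fst_one, Prod.snd_one, norm_one] at h1 h2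
  rw [LocalOrder.mem_unitGroup, mem_splitOrder, mem_splitOrder]
  have key : ∀ a b : ℝ, 0 ≤ a → a * b = 1 → ((a ≤ 1 ∧ b ≤ 1) ↔ a = 1) := by
    intro a b ha hab
    constructor
    · rintro ⟨h3, h4⟩
      nlinarith
    · rintro rfl
      exact ⟨le_rfl, by linarith⟩
  have := key _ _ (norm_nonneg _) h1
  have := key _ _ (norm_nonneg _) h2
  tauto

/-- If `E_p` is split, its multiplicative group is the product of the units of the maximal order
and a free group of rank two. -/
theorem exists_isTransversal_of_square {d : ℚ_[p]} (hd : d ^ 2 = -(D : ℚ_[p])) (hd0 : d ≠ 0) :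
    ∃ (O : LocalOrder p D) (ι : Type) (_ : Countable ι) (x : ι → (Ep p D)ˣ),
      O.IsTransversal x ∧ O.IsOrthantFamily x := by
  refine ⟨splitOrder hd hd0, ℤ × ℤ, inferInstance, fun i => splitUnit hd hd0 i.1 i.2, ?_, ?_⟩
  · intro y
    have hN : QuadraticAlgebra.norm (y : Ep p D) ≠ 0 := (unitNorm p D y).ne_zero
    rw [norm_eq_splitEquiv hd hd0] at hN
    have h1 : (splitEquiv hd hd0 (y : Ep p D)).1 ≠ 0 := left_ne_zero_of_mul hN
    have h2 : (splitEquiv hd hd0 (y : Ep p D)).2 ≠ 0 := right_ne_zero_of_mul hN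
    have key : ∀ m n : ℤ, (splitUnit hd hd0 m n)⁻¹ * y ∈ (splitOrder hd hd0).unitGroup ↔
        m = (splitEquiv hd hd0 (y : Ep p D)).1.valuation ∧
        n = (splitEquiv hd hd0 (y : Ep p D)).2.valuation := by
      intro m n
      rw [mem_unitGroup_splitOrder, splitUnit_inv, Units.val_mul, map_mul, splitEquiv_splitUnit,
        Prod.fst_mul, Prod.snd_mul, norm_eq_one_of_zpow_sub h1, norm_eq_one_of_zpow_sub h2]
    refine ⟨(_, _), (key _ _).2 ⟨rfl, rfl⟩, ?_⟩
    rintro ⟨m, n⟩ hmn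
    exact Prod.ext ((key m n).1 hmn).1 ((key m n).1 hmn).2
  · intro Ω hΩ Good hcongr hgfin hrec
    set O := splitOrder hd hd0
    -- The two idempotents lie in `O`. As `Ω` is an `O`-module, membership of `(p ^ m, p ^ n)`
    -- decouples into a condition on `m` and a condition on `n`.
    set e₁ : Ep p D := (splitEquiv hd hd0).symm (1, 0) with he₁
    set e₂ : Ep p D := (splitEquiv hd hd0).symm (0, 1) with he₂
    have he₁0 : e₁ ≠ 0 := by simp [he₁]
    have he₂0 : e₂ ≠ 0 := by simp [he₂]
    have he₁O : e₁ ∈ O := by simp [O, mem_splitOrder, he₁]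
    have he₂O : e₂ ∈ O := by simp [O, mem_splitOrder, he₂]
    obtain ⟨a, ha⟩ := hΩ.exists_iff he₁0
    obtain ⟨b, hb⟩ := hΩ.exists_iff he₂0
    have hmem : ∀ m n : ℤ, (splitUnit hd hd0 m n : Ep p D) ∈ Ω ↔ a ≤ m ∧ b ≤ n := by
      intro m n
      rw [← ha, ← hb]
      have h1 : (p : ℚ_[p]) ^ m • e₁ = e₁ * splitUnit hd hd0 m n := by
        refine (splitEquiv hd hd0).injective ?_
        rw [map_mul, splitEquiv_splitUnit, splitEquiv_smul]
        simp [he₁]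
      have h2 : (p : ℚ_[p]) ^ n • e₂ = e₂ * splitUnit hd hd0 m n := by
        refine (splitEquiv hd hd0).injective ?_
        rw [map_mul, splitEquiv_splitUnit, splitEquiv_smul]
        simp [he₂]
      have h3 : e₁ + e₂ = 1 := by
        refine (splitEquiv hd hd0).injective ?_
        simp [he₁, he₂, Prod.one_eq_mk]
      constructor
      · intro h
        rw [h1, h2]
        exact ⟨hΩ.mul_mem _ he₁O _ h, hΩ.mul_mem _ he₂O _ h⟩
      · rintro ⟨h, h'⟩
        have := add_mem h h'
        rwa [h1, h2, ← add_mul, h3, one_mul] at this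
    have hlt : (p : ℝ)⁻¹ < 1 := inv_lt_one_of_one_lt₀ (by exact_mod_cast hp.out.one_lt)
    have hstep : ∀ m n : ℤ, 0 ≤ m → 0 ≤ n → m + n = 1 →
        (splitUnit hd hd0 m n : Ep p D) ∈ O ∧
          ‖(unitNorm p D (splitUnit hd hd0 m n) : ℚ_[p])‖ < 1 := by
      intro m n hm hn hmn
      have hp1 : (1 : ℝ) < p := by exact_mod_cast hp.out.one_lt
      rw [mem_splitOrder, val_unitNorm, norm_eq_splitEquiv hd hd0, splitEquiv_splitUnit]
      simp only [norm_mul, Padic.norm_p_zpow]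
      refine ⟨⟨zpow_le_one_of_nonpos₀ hp1.le (by omega), zpow_le_one_of_nonpos₀ hp1.le (by omega)⟩, ?_⟩
      rw [← zpow_add₀ (by positivity)]
      exact zpow_lt_one_of_neg₀ hp1 (by omega)
    -- The quadrant with corner `(a, b)` arises from its corner by one recursion step in each
    -- coordinate direction, with the multipliers `(p, 1)` and `(1, p)`, both of norm `p`.
    have h0 := hgfin (fun _ : Unit => splitUnit hd hd0 a b) fun _ => (hmem a b).2 ⟨le_rfl, le_rfl⟩
    have h1 := hrec _ (fun _ => (hmem a b).2 ⟨le_rfl, le_rfl⟩) h0 _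
      (hstep 1 0 (by norm_num) le_rfl rfl).1 (hstep 1 0 (by norm_num) le_rfl rfl).2
    have hprod1 : ∀ i : ℕ × Unit, splitUnit hd hd0 1 0 ^ i.1 * splitUnit hd hd0 a b =
        splitUnit hd hd0 (i.1 + a) b := by
      intro i
      rw [splitUnit_pow, splitUnit_mul]
      simp
    simp_rw [hprod1] at h1
    have h2 := hrec _ (fun i => (hmem _ _).2 ⟨by omega, le_rfl⟩) h1 _
      (hstep 0 1 le_rfl (by norm_num) rfl).1 (hstep 0 1 le_rfl (by norm_num) rfl).2
    let g : ℕ × ℕ × Unit ≃ {i : ℤ × ℤ // (splitUnit hd hd0 i.1 i.2 : Ep p D) ∈ Ω} :=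
      { toFun := fun i => ⟨(i.2.1 + a, i.1 + b), (hmem _ _).2 ⟨by simp, by simp⟩⟩
        invFun := fun i => ((i.1.2 - b).toNat, (i.1.1 - a).toNat, ())
        left_inv := by
          rintro ⟨m, n, _⟩
          simp
        right_inv := by
          rintro ⟨⟨m, n⟩, h⟩
          have := (hmem m n).1 h
          simp [this] }
    refine hcongr g _ ?_
    convert! h2 using 2 with i
    rw [splitUnit_pow, splitUnit_mul]
    simp [g]

end Split

/-- The split case is the one where `-D` is a square in `ℚ_p`. Inert and ramified primes are treated
together, as the case of a field. -/
theorem exists_isTransversal (p : ℕ) [Fact p.Prime] {D : ℕ} (hD : D ≠ 0) :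
    ∃ (O : LocalOrder p D) (ι : Type) (_ : Countable ι) (x : ι → (Ep p D)ˣ),
      O.IsTransversal x ∧ O.IsOrthantFamily x := by
  by_cases h : ∀ d : ℚ_[p], d ^ 2 ≠ -(D : ℚ_[p])
  · exact exists_isTransversal_of_nonsquare h
  · push Not at h
    obtain ⟨d, hd⟩ := h
    refine exists_isTransversal_of_square hd ?_
    rintro rfl
    rw [zero_pow two_ne_zero, eq_comm, neg_eq_zero] at hd
    exact hD (by exact_mod_cast hd)

section TorusAndCongruence

variable {p : ℕ} [hp : Fact p.Prime] {D : ℕ}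

/-! ### The diagonal torus of `H` -/

/-- Diagonal matrices in `GL₂(ℚ_p)`. -/
def diagGL (a b : ℚ_[p]ˣ) : GL (Fin 2) ℚ_[p] :=
  ⟨!![a, 0; 0, b], !![(a⁻¹ : ℚ_[p]ˣ), 0; 0, (b⁻¹ : ℚ_[p]ˣ)],
    by simp [Matrix.one_fin_two], by simp [Matrix.one_fin_two]⟩

theorem diagGL_val (a b : ℚ_[p]ˣ) :
    (diagGL a b : Matrix (Fin 2) (Fin 2) ℚ_[p]) = !![(a : ℚ_[p]), 0; 0, b] := rfl

theorem diagGL_mul (a b a' b' : ℚ_[p]ˣ) :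
    diagGL (a * a') (b * b') = diagGL a b * diagGL a' b' := by
  apply Units.ext
  rw [Units.val_mul, diagGL_val, diagGL_val, diagGL_val]
  simp

/-- The element `(diag(b * Nm x, b), b * star x)` of `H`. -/
def torusElement (t : ℚ_[p]ˣ × (Ep p D)ˣ) : H p D :=
  ⟨(diagGL (t.1 * unitNorm p D t.2) t.1, scalarUnit p D t.1 * star t.2), by
    change (diagGL (t.1 * unitNorm p D t.2) t.1 : Matrix (Fin 2) (Fin 2) ℚ_[p]).det =
      QuadraticAlgebra.norm ((scalarUnit p D t.1 * star t.2 : (Ep p D)ˣ) : Ep p D)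
    rw [diagGL_val, Matrix.det_fin_two_of, Units.val_mul, Units.val_mul, map_mul, val_scalarUnit,
      QuadraticAlgebra.norm_algebraMap, Units.coe_star, QuadraticAlgebra.norm_star, val_unitNorm]
    ring⟩

/-- The homomorphism `(b, x) ↦ (diag(b * Nm x, b), b * star x)` to `H`. -/
def torus : ℚ_[p]ˣ × (Ep p D)ˣ →* H p D :=
  MonoidHom.mk' torusElement fun s t => by
    apply H.ext
    · change diagGL _ _ = diagGL _ _ * diagGL _ _
      rw [← diagGL_mul, Prod.snd_mul, Prod.fst_mul, map_mul, mul_mul_mul_comm]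
    · change scalarUnit p D (s.1 * t.1) * star (s.2 * t.2) =
        (scalarUnit p D s.1 * star s.2) * (scalarUnit p D t.1 * star t.2)
      rw [map_mul, star_mul, mul_comm (star t.2), mul_mul_mul_comm]

theorem torus_l' (b : ℚ_[p]ˣ) (x : (Ep p D)ˣ) :
    (torus (b, x)).l = scalarUnit p D b * star x := rfl

theorem torus_g₁ (b : ℚ_[p]ˣ) (x : (Ep p D)ˣ) :
    ((torus (b, x)).g₁ : Matrix (Fin 2) (Fin 2) ℚ_[p]) =
      !![(b : ℚ_[p]) * QuadraticAlgebra.norm (x : Ep p D), 0; 0, b] := rfl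

theorem torus_l (b : ℚ_[p]ˣ) (x : (Ep p D)ˣ) :
    ((torus (b, x)).l : Ep p D) = algebraMap ℚ_[p] (Ep p D) b * star (x : Ep p D) := rfl

/-- The image of `torus (b, x)` in `G` is `b * diag(Nm x, star x, 1)`. -/
theorem embed_torus (b : ℚ_[p]ˣ) (x : (Ep p D)ˣ) :
    ((embed (torus (b, x))).1 : Matrix (Fin 3) (Fin 3) (Ep p D)) =
      algebraMap ℚ_[p] (Ep p D) b •
        Matrix.diagonal ![(x : Ep p D) * star (x : Ep p D), star (x : Ep p D), 1] := by
  have h : ((embed (torus (b, x))).1 : Matrix (Fin 3) (Fin 3) (Ep p D)) =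
    embedMatrix (torus (b, x)).g₁ (torus (b, x)).l := rfl
  rw [h, torus_g₁, torus_l]
  ext1 i j
  fin_cases i <;> fin_cases j <;>
    simp [embedMatrix, QuadraticAlgebra.algebraMap_norm_eq_mul_star]

/-- The element `diag(Nm x, star x, 1)` of `G`. -/
def torusG : (Ep p D)ˣ →* GU p D := (embed.comp torus).comp (MonoidHom.inr _ _)

theorem torusG_val (x : (Ep p D)ˣ) : ((torusG x).1 : Matrix (Fin 3) (Fin 3) (Ep p D)) =
    Matrix.diagonal ![(x : Ep p D) * star (x : Ep p D), star (x : Ep p D), 1] := by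
  refine (embed_torus 1 x).trans ?_
  simp

/-- Scalar matrices with entries in `ℚ_pˣ`. -/
def scalarG : ℚ_[p]ˣ →* GU p D := (embed.comp torus).comp (MonoidHom.inl _ _)

theorem scalarG_val (b : ℚ_[p]ˣ) : ((scalarG b : GU p D).1 : Matrix (Fin 3) (Fin 3) (Ep p D)) =
    algebraMap ℚ_[p] (Ep p D) b • (1 : Matrix (Fin 3) (Fin 3) (Ep p D)) := by
  refine (embed_torus b 1).trans ?_
  congr 1
  ext1 i j
  fin_cases i <;> fin_cases j <;> simp

theorem scalarG_mul_comm (b : ℚ_[p]ˣ) (g : GU p D) : scalarG b * g = g * scalarG b := by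
  refine Subtype.ext (Units.ext ?_)
  change (scalarG b : GU p D).1.1 * g.1.1 = g.1.1 * (scalarG b : GU p D).1.1
  rw [scalarG_val]
  simp

theorem embed_torus_eq (b : ℚ_[p]ˣ) (x : (Ep p D)ˣ) :
    embed (torus (b, x)) = torusG x * scalarG b := by
  have : ((b, x) : ℚ_[p]ˣ × (Ep p D)ˣ) = (1, x) * (b, 1) := by simp
  rw [this, map_mul, map_mul]
  rfl

/-! ### Unipotent elements -/

theorem star_omega : star (QuadraticAlgebra.omega : Ep p D) = -QuadraticAlgebra.omega := by
  ext <;> simp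

/-- The unipotent element of `G` with last column `(c, e, 1)`. -/
def unipotent (hD : D ≠ 0) (e c : Ep p D)
    (h : c - star c = QuadraticAlgebra.omega * (e * star e)) : GU p D :=
  ⟨⟨!![1, QuadraticAlgebra.omega * star e, c; 0, 1, e; 0, 0, 1],
    !![1, -(QuadraticAlgebra.omega * star e), -star c; 0, 1, -e; 0, 0, 1], by
      ext1 i j
      fin_cases i <;> fin_cases j <;> simp [Matrix.mul_apply, Fin.sum_univ_three]
      linear_combination h, by
      ext1 i j
      fin_cases i <;> fin_cases j <;> simp [Matrix.mul_apply, Fin.sum_univ_three]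
      linear_combination h⟩, ⟨1, by
    have hω := omega_mul_deltaInv p D hD
    have hω' := star_omega (p := p) (D := D)
    ext1 i j
    fin_cases i <;> fin_cases j <;>
      simp [J, Matrix.mul_apply, Fin.sum_univ_three, hω']
    · linear_combination (-e) * hω
    · linear_combination (-star e) * hω
    · linear_combination (-deltaInv p D) * h - (e * star e) * hω⟩⟩

theorem unipotent_val (hD : D ≠ 0) (e c : Ep p D)
    (h : c - star c = QuadraticAlgebra.omega * (e * star e)) :
    (unipotent hD e c h).1.1 = !![1, QuadraticAlgebra.omega * star e, c; 0, 1, e; 0, 0, 1] := rfl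

theorem unipotent_inv_val (hD : D ≠ 0) (e c : Ep p D)
    (h : c - star c = QuadraticAlgebra.omega * (e * star e)) :
    ((unipotent hD e c h)⁻¹).1.1 =
      !![1, -(QuadraticAlgebra.omega * star e), -star c; 0, 1, -e; 0, 0, 1] := rfl

theorem isUnipotentUpper_unipotent (hD : D ≠ 0) (e c : Ep p D)
    (h : c - star c = QuadraticAlgebra.omega * (e * star e)) :
    IsUnipotentUpper p D (unipotent hD e c h) := by
  intro i j hij
  rw [unipotent_val]
  fin_cases i <;> fin_cases j <;> simp_all

/-- Conjugating by the torus. -/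
theorem IsUnipotentUpper.torusG_conj {u : GU p D} (hu : IsUnipotentUpper p D u) (x : (Ep p D)ˣ) :
    IsUnipotentUpper p D (torusG x * u * (torusG x)⁻¹) ∧
      (torusG x * u * (torusG x)⁻¹).1.1 1 2 = star (x : Ep p D) * u.1.1 1 2 := by
  have h : (torusG x * u * (torusG x)⁻¹).1.1 =
      (torusG x).1.1 * u.1.1 * (torusG x⁻¹).1.1 := by rw [map_inv]; rfl
  have hx : star (x : Ep p D) * star ((x⁻¹ : (Ep p D)ˣ) : Ep p D) = 1 := by
    rw [← star_mul, Units.inv_mul, star_one]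
  have hx' := Units.mul_inv x
  rw [h, torusG_val, torusG_val, IsUnipotentUpper, h, torusG_val, torusG_val]
  refine ⟨fun i j hij => ?_, by simp⟩
  rw [Matrix.mul_diagonal, Matrix.diagonal_mul, hu i j hij]
  split_ifs with hij'
  · subst hij'
    fin_cases i
    · simp
      linear_combination hx' + (x : Ep p D) * ((x⁻¹ : (Ep p D)ˣ) : Ep p D) * hx
    · simpa using hx
    · simp
  · simp

/-! ### Congruence subgroups of `G` -/

namespace LocalOrder

variable (O : LocalOrder p D)

/-- The ideal `p ^ n O`. -/
def primePow (n : ℕ) : AddSubgroup (Ep p D) where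
  carrier := {e | (p : ℚ_[p]) ^ (-(n : ℤ)) • e ∈ O}
  add_mem' := by
    intro a b ha hb
    simp only [Set.mem_ofPred_eq, smul_add]
    exact add_mem ha hb
  zero_mem' := by
    simp only [Set.mem_ofPred_eq, smul_zero]
    exact zero_mem O
  neg_mem' := by
    intro a ha
    simp only [Set.mem_ofPred_eq, smul_neg]
    exact neg_mem ha

variable {O} {n : ℕ}

theorem mem_primePow {e : Ep p D} : e ∈ O.primePow n ↔ (p : ℚ_[p]) ^ (-(n : ℤ)) • e ∈ O := Iff.rfl

theorem pow_smul_mem_primePow {e : Ep p D} : (p : ℚ_[p]) ^ n • e ∈ O.primePow n ↔ e ∈ O := by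
  rw [mem_primePow, smul_smul, ← zpow_natCast, ← zpow_add₀ (natCast_prime_ne_zero p),
    neg_add_cancel, zpow_zero, one_smul]

theorem exists_eq_of_mem_primePow {e : Ep p D} (he : e ∈ O.primePow n) :
    ∃ a ∈ O, e = (p : ℚ_[p]) ^ n • a := by
  refine ⟨_, he, ?_⟩
  rw [smul_smul, ← zpow_natCast, ← zpow_add₀ (natCast_prime_ne_zero p), add_neg_cancel, zpow_zero,
    one_smul]

theorem mul_mem_primePow {o e : Ep p D} (ho : o ∈ O) (he : e ∈ O.primePow n) :
    o * e ∈ O.primePow n := by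
  rw [mem_primePow, ← mul_smul_comm]
  exact mul_mem ho he

theorem smul_mem {a : ℚ_[p]} (ha : ‖a‖ ≤ 1) {e : Ep p D} (he : e ∈ O) : a • e ∈ O := by
  rw [Algebra.smul_def]
  exact mul_mem (O.algebraMap_mem a ha) he

theorem mem_of_mem_primePow {e : Ep p D} (he : e ∈ O.primePow n) : e ∈ O := by
  obtain ⟨a, ha, rfl⟩ := exists_eq_of_mem_primePow he
  refine smul_mem ?_ ha
  rw [norm_pow]
  exact pow_le_one₀ (norm_nonneg _) Padic.norm_p_lt_one.le

theorem star_mem_primePow {e : Ep p D} (he : e ∈ O.primePow n) : star e ∈ O.primePow n := by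
  obtain ⟨a, ha, rfl⟩ := exists_eq_of_mem_primePow he
  have : star ((p : ℚ_[p]) ^ n • a) = (p : ℚ_[p]) ^ n • star a := by
    ext <;> simp
  rw [this, pow_smul_mem_primePow]
  exact O.star_mem a ha

variable (O n) in
theorem isOpen_primePow : IsOpen (O.primePow n : Set (Ep p D)) := by
  have : Continuous fun e : Ep p D => (p : ℚ_[p]) ^ (-(n : ℤ)) • e := by
    simp_rw [Algebra.smul_def]
    exact continuous_const.mul continuous_id
  exact O.isOpen.preimage this

/-- Elements of `1 + p ^ n O` are units. -/
theorem exists_inv_of_mem_primePow (hn : 1 ≤ n) {e : Ep p D} (he : e ∈ O.primePow n) :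
    ∃ f ∈ O, (1 + e) * f = 1 := by
  obtain ⟨a, ha, rfl⟩ := exists_eq_of_mem_primePow he
  set e : Ep p D := (p : ℚ_[p]) ^ n • a with he
  have hq : ‖(p : ℚ_[p]) ^ n‖ < 1 := by
    rw [norm_pow]
    exact pow_lt_one₀ (norm_nonneg _) Padic.norm_p_lt_one (by omega)
  -- `1 + b` is the norm of `1 + e`. As `b` is divisible by `p`, this norm is a unit of `ℤ_p`, and
  -- `star (1 + e) / (1 + b)` is the inverse.
  set b : ℚ_[p] := (p : ℚ_[p]) ^ n * (QuadraticAlgebra.trace a +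
    (p : ℚ_[p]) ^ n * QuadraticAlgebra.norm a) with hb
  have hb1 : ‖b‖ < 1 := by
    rw [hb, norm_mul]
    have h2 : ‖QuadraticAlgebra.trace a + (p : ℚ_[p]) ^ n * QuadraticAlgebra.norm a‖ ≤ 1 :=
      norm_add_le_one (O.norm_trace_le_one ha) (norm_mul_le_one hq.le (O.norm_norm_le_one ha))
    exact (mul_le_of_le_one_right (norm_nonneg _) h2).trans_lt hq
  have hN : QuadraticAlgebra.norm (1 + e) = 1 + b := by
    simp only [he, hb, QuadraticAlgebra.norm_def, QuadraticAlgebra.trace_def,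
      QuadraticAlgebra.re_add, QuadraticAlgebra.im_add, QuadraticAlgebra.re_one,
      QuadraticAlgebra.im_one, QuadraticAlgebra.re_smul, QuadraticAlgebra.im_smul, smul_eq_mul]
    ring
  have hN1 : ‖1 + b‖ = 1 := by
    rw [Padic.add_eq_max_of_ne (by rw [norm_one]; exact hb1.ne'), norm_one, max_eq_left hb1.le]
  have hN0 : 1 + b ≠ 0 := by
    intro h
    rw [h, norm_zero] at hN1
    exact zero_ne_one hN1
  refine ⟨(1 + b)⁻¹ • star (1 + e), smul_mem (by rw [norm_inv, hN1, inv_one])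
    (O.star_mem _ (add_mem (one_mem O) (mem_of_mem_primePow (pow_smul_mem_primePow.2 ha)))), ?_⟩
  rw [mul_smul_comm, ← QuadraticAlgebra.algebraMap_norm_eq_mul_star, hN, Algebra.smul_def,
    ← map_mul, inv_mul_cancel₀ hN0, map_one]

/-- `δ * Nm e / 2` is divisible by `p ^ n` if `e` is. -/
theorem half_omega_norm_mem_primePow (hn : 1 ≤ n) {e : Ep p D} (he : e ∈ O.primePow n) :
    (2 : ℚ_[p])⁻¹ • (QuadraticAlgebra.omega * (e * star e)) ∈ O.primePow n := by
  obtain ⟨a, ha, rfl⟩ := exists_eq_of_mem_primePow he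
  have h1 : star ((p : ℚ_[p]) ^ n • a) = (p : ℚ_[p]) ^ n • star a := by
    ext <;> simp
  have h2 : (2 : ℚ_[p])⁻¹ • ((QuadraticAlgebra.omega : Ep p D) *
      (((p : ℚ_[p]) ^ n • a) * star ((p : ℚ_[p]) ^ n • a))) =
      (p : ℚ_[p]) ^ n • (((2 : ℚ_[p])⁻¹ * (p : ℚ_[p]) ^ n) •
        (QuadraticAlgebra.omega * (a * star a))) := by
    rw [h1]
    simp only [smul_mul_assoc, mul_smul_comm, smul_smul]
    congr 1
    ring
  rw [h2, pow_smul_mem_primePow]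
  refine smul_mem ?_ (mul_mem O.omega_mem (mul_mem ha (O.star_mem a ha)))
  -- `Nm e` is divisible by `p ^ (2 * n)`. The surplus factor `p ^ n` absorbs the denominator `2`,
  -- even for `p = 2`, because `1 ≤ n`.
  have h3 : ‖(p : ℚ_[p])‖ ≤ ‖(2 : ℚ_[p])‖ := by
    rcases eq_or_ne p 2 with rfl | h
    · exact_mod_cast le_rfl
    · have : ‖(2 : ℚ_[p])‖ = 1 := by
        have := (Padic.norm_natCast_eq_one_iff (p := p) (n := 2)).2
          ((Nat.coprime_primes hp.out Nat.prime_two).2 h)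
        exact_mod_cast this
      rw [this]
      exact Padic.norm_p_lt_one.le
  rw [norm_mul, norm_inv, inv_mul_le_iff₀ (norm_pos_iff.2 two_ne_zero), mul_one, norm_pow]
  refine le_trans ?_ h3
  exact pow_le_of_le_one (norm_nonneg _) Padic.norm_p_lt_one.le (by omega)

variable (O n) in
/-- The principal congruence subgroup of level `p ^ n` of `G`. -/
def congruence : Subgroup (GU p D) where
  carrier := {g | (∀ i j, (g.1.1 - 1) i j ∈ O.primePow n) ∧
    ∀ i j, ((g⁻¹).1.1 - 1) i j ∈ O.primePow n}
  mul_mem' := by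
    have key : ∀ A B : Matrix (Fin 3) (Fin 3) (Ep p D), (∀ i j, (A - 1) i j ∈ O.primePow n) →
        (∀ i j, (B - 1) i j ∈ O.primePow n) → ∀ i j, (A * B - 1) i j ∈ O.primePow n := by
      intro A B hA hB i j
      have h : A * B - 1 = (A - 1) * (B - 1) + (A - 1) + (B - 1) := by noncomm_ring
      rw [h, Matrix.add_apply, Matrix.add_apply, Matrix.mul_apply]
      exact add_mem (add_mem (sum_mem fun l _ => mul_mem_primePow
        (mem_of_mem_primePow (hA i l)) (hB l j)) (hA i j)) (hB i j)
    rintro g h ⟨hg, hg'⟩ ⟨hh, hh'⟩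
    refine ⟨key _ _ hg hh, ?_⟩
    rw [_root_.mul_inv_rev]
    exact key _ _ hh' hg'
  one_mem' := by
    refine ⟨fun i j => ?_, fun i j => ?_⟩
    · simp [zero_mem]
    · rw [inv_one]
      simp [zero_mem]
  inv_mem' := by
    rintro g ⟨hg, hg'⟩
    refine ⟨hg', ?_⟩
    rwa [inv_inv]

theorem mem_congruence {g : GU p D} : g ∈ O.congruence n ↔
    (∀ i j, (g.1.1 - 1) i j ∈ O.primePow n) ∧ ∀ i j, ((g⁻¹).1.1 - 1) i j ∈ O.primePow n := Iff.rfl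

theorem unipotent_mem_congruence (hD : D ≠ 0) {e c : Ep p D}
    (h : c - star c = QuadraticAlgebra.omega * (e * star e)) (he : e ∈ O.primePow n)
    (hc : c ∈ O.primePow n) : unipotent hD e c h ∈ O.congruence n := by
  have hω := mul_mem_primePow O.omega_mem (star_mem_primePow he)
  have hc' := star_mem_primePow hc
  rw [mem_congruence, unipotent_val, unipotent_inv_val]
  refine ⟨fun i j => ?_, fun i j => ?_⟩ <;>
  · fin_cases i <;> fin_cases j <;> simp [zero_mem, he, hc, hω, hc']

end LocalOrder

end TorusAndCongruence

section Factorization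

variable {p : ℕ} [hp : Fact p.Prime] {D : ℕ}

/-! ### Factorization of congruence subgroups -/

theorem GU.exists_similitude (g : GU p D) : ∃ m : ℚ_[p],
    ((g.1 : Matrix (Fin 3) (Fin 3) (Ep p D))ᴴ * J p D * g.1.1) = m • J p D := by
  obtain ⟨m, hm⟩ := g.2
  exact ⟨m, hm⟩

theorem GU.inv_mul_val (g : GU p D) : (g⁻¹).1.1 * g.1.1 = 1 := by
  rw [← Units.val_mul, ← Subgroup.coe_mul, inv_mul_cancel]
  rfl

/-- The last column of an element of `G` is isotropic. -/
theorem GU.last_column (hD : D ≠ 0) (g : GU p D) :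
    g.1.1 0 2 * star (g.1.1 2 2) - star (g.1.1 0 2) * g.1.1 2 2 =
      QuadraticAlgebra.omega * (g.1.1 1 2 * star (g.1.1 1 2)) := by
  obtain ⟨m, hm⟩ := GU.exists_similitude g
  have h := congr_fun (congr_fun hm 2) 2
  simp [J, Matrix.mul_apply, Fin.sum_univ_three] at h
  have hω := omega_mul_deltaInv p D hD
  linear_combination (-QuadraticAlgebra.omega) * h + (star (g.1.1 0 2) * g.1.1 2 2 -
    g.1.1 0 2 * star (g.1.1 2 2)) * hω

/-- The entries of `g` above the diagonal vanish. -/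
def IsLower (g : GU p D) : Prop := g.1.1 0 1 = 0 ∧ g.1.1 0 2 = 0 ∧ g.1.1 1 2 = 0

/-- A similitude that preserves the line of the last basis vector preserves its orthogonal
complement, which kills the remaining entry above the diagonal. The entry `g 2 2` may be cancelled
although `E_p` can have zero divisors, because `g⁻¹ 2 2` is an inverse of it. -/
theorem isLower_of_last_column (hD : D ≠ 0) {g : GU p D} (h0 : g.1.1 0 2 = 0)
    (h1 : g.1.1 1 2 = 0) : IsLower g ∧ IsLower g⁻¹ := by
  have key : ∀ g : GU p D, g.1.1 0 2 = 0 → g.1.1 1 2 = 0 →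
      g.1.1 0 1 = 0 ∧ (g⁻¹).1.1 0 2 = 0 ∧ (g⁻¹).1.1 1 2 = 0 := by
    intro g h0 h1
    have hi : ∀ i, (g⁻¹).1.1 i 2 * g.1.1 2 2 = (1 : Matrix (Fin 3) (Fin 3) (Ep p D)) i 2 := by
      intro i
      rw [← GU.inv_mul_val g, Matrix.mul_apply, Fin.sum_univ_three, h0, h1]
      ring
    have h2 := hi 2
    rw [Matrix.one_apply_eq] at h2
    have hcancel : ∀ a : Ep p D, a * g.1.1 2 2 = 0 → a = 0 := by
      intro a ha
      linear_combination (g⁻¹).1.1 2 2 * ha - a * h2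
    refine ⟨?_, hcancel _ ?_, hcancel _ ?_⟩
    · obtain ⟨m, hm⟩ := GU.exists_similitude g
      have h := congr_fun (congr_fun hm 1) 2
      simp [J, Matrix.mul_apply, Fin.sum_univ_three, h0, h1] at h
      have hω := omega_mul_deltaInv p D hD
      rw [← star_eq_zero]
      refine hcancel _ ?_
      linear_combination QuadraticAlgebra.omega * h - (star (g.1.1 0 1) * g.1.1 2 2) * hω
    · rw [hi]
      simp
    · rw [hi]
      simp
  obtain ⟨h2, h3, h4⟩ := key g h0 h1
  obtain ⟨h5, -, -⟩ := key g⁻¹ h3 h4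
  exact ⟨⟨h2, h0, h1⟩, ⟨h5, h3, h4⟩⟩

variable {O : LocalOrder p D} {n : ℕ}

/-- The unipotent factor is the one whose last column is that of `g` divided by the unit `g 2 2`.
The isotropy of that column is exactly the condition for such an element to lie in `G`, and the
quotient then satisfies `isLower_of_last_column`. -/
theorem exists_unipotent_mul (hD : D ≠ 0) (hn : 1 ≤ n) {g : GU p D} (hg : g ∈ O.congruence n) :
    ∃ u ∈ O.congruence n, IsUnipotentUpper p D u ∧ ∃ l ∈ O.congruence n,
      IsLower l ∧ IsLower l⁻¹ ∧ g = u * l := by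
  have h02 : g.1.1 0 2 ∈ O.primePow n := by simpa using hg.1 0 2
  have h12 : g.1.1 1 2 ∈ O.primePow n := by simpa using hg.1 1 2
  have h22 : g.1.1 2 2 - 1 ∈ O.primePow n := by simpa using hg.1 2 2
  obtain ⟨f, hf, hf1⟩ := LocalOrder.exists_inv_of_mem_primePow hn h22
  rw [add_sub_cancel] at hf1
  have hcol := GU.last_column hD g
  have hf2 : star f * star (g.1.1 2 2) = 1 := by rw [← star_mul, hf1, star_one]
  have h : f * g.1.1 0 2 - star (f * g.1.1 0 2) =
      QuadraticAlgebra.omega * ((f * g.1.1 1 2) * star (f * g.1.1 1 2)) := by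
    rw [star_mul, star_mul]
    linear_combination (f * star f) * hcol - f * g.1.1 0 2 * hf2 + star f * star (g.1.1 0 2) * hf1
  set u := unipotent hD _ _ h with hu
  have huK : u ∈ O.congruence n := LocalOrder.unipotent_mem_congruence hD h
    (LocalOrder.mul_mem_primePow hf h12) (LocalOrder.mul_mem_primePow hf h02)
  have hl : (u⁻¹ * g).1.1 = (u⁻¹).1.1 * g.1.1 := rfl
  have hlow := isLower_of_last_column hD (g := u⁻¹ * g) (by
    rw [hl, hu, unipotent_inv_val, Matrix.mul_apply, Fin.sum_univ_three]
    simp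
    linear_combination star f * hcol - g.1.1 0 2 * hf2) (by
    rw [hl, hu, unipotent_inv_val, Matrix.mul_apply, Fin.sum_univ_three]
    simp
    linear_combination (-g.1.1 1 2) * hf1)
  exact ⟨u, huK, isUnipotentUpper_unipotent hD _ _ h, u⁻¹ * g,
    mul_mem (inv_mem huK) hg, hlow.1, hlow.2, by group⟩

/-- Conjugation by `torusG y⁻¹` with `y` integral contracts the lower triangular part. -/
theorem torusG_conj_mem_congruence {l : GU p D} (hl : l ∈ O.congruence n) (h1 : IsLower l)
    (h2 : IsLower l⁻¹) {y : (Ep p D)ˣ} (hy : (y : Ep p D) ∈ O) :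
    (torusG y)⁻¹ * l * torusG y ∈ O.congruence n := by
  have hy' := O.star_mem _ hy
  have key : ∀ l : GU p D, IsLower l → (∀ i j, (l.1.1 - 1) i j ∈ O.primePow n) →
      ∀ i j, (((torusG y)⁻¹ * l * torusG y).1.1 - 1) i j ∈ O.primePow n := by
    intro l h1 hl i j
    have h : ((torusG y)⁻¹ * l * torusG y).1.1 =
      (torusG y⁻¹).1.1 * l.1.1 * (torusG y).1.1 := by rw [map_inv]; rfl
    have hx' := Units.inv_mul y
    have hx : star ((y⁻¹ : (Ep p D)ˣ) : Ep p D) * star (y : Ep p D) = 1 := by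
      rw [← star_mul, Units.mul_inv, star_one]
    rw [Matrix.sub_apply, h, torusG_val, torusG_val, Matrix.mul_diagonal, Matrix.diagonal_mul]
    obtain ⟨h01, h02, h12⟩ := h1
    have hl' := hl i j
    rw [Matrix.sub_apply] at hl'
    set z : Ep p D := ((y⁻¹ : (Ep p D)ˣ) : Ep p D)
    fin_cases i <;> fin_cases j
    · convert! hl' using 1
      simp
      linear_combination l.1.1 0 0 * hx + l.1.1 0 0 * star z * star (y : Ep p D) * hx'
    · simp [h01, zero_mem]
    · simp [h02, zero_mem]
    · convert! LocalOrder.mul_mem_primePow hy hl' using 1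
      simp
      linear_combination l.1.1 1 0 * (y : Ep p D) * hx
    · convert! hl' using 1
      simp
      linear_combination l.1.1 1 1 * hx
    · simp [h12, zero_mem]
    · convert! LocalOrder.mul_mem_primePow (mul_mem hy hy') hl' using 1
      simp
      ring
    · convert! LocalOrder.mul_mem_primePow hy' hl' using 1
      simp
      ring
    · convert! hl' using 1
      simp
  refine ⟨key l h1 hl.1, ?_⟩
  have := key l⁻¹ h2 hl.2
  convert! this using 6
  group

end Factorization

section TopologyOfG

variable {p : ℕ} [hp : Fact p.Prime] {D : ℕ}

/-! ### The topology of `G` -/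

theorem continuous_algebraMap_Ep : Continuous (algebraMap ℚ_[p] (Ep p D)) := by
  rw [(isInducing_equivProd p D).continuous_iff]
  exact continuous_id.prodMk continuous_const

instance : ContinuousSMul ℚ_[p] (Ep p D) where
  continuous_smul := by
    simp_rw [Algebra.smul_def]
    exact (continuous_algebraMap_Ep.comp continuous_fst).mul continuous_snd

instance : ContinuousStar (Ep p D) where
  continuous_star := by
    rw [(isInducing_equivProd p D).continuous_iff]
    have h : Continuous fun x : Ep p D => x.re + 0 * x.im :=
      (continuous_re p D).add (continuous_const.mul (continuous_im p D))
    exact h.prodMk (continuous_im p D).neg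

/-- The middle entry of `J` is `1`, so the multiplier can be read off from the middle entry of `gᴴ *
J * g`, and membership becomes an equation between continuous functions. The multiplier so obtained
is nonzero because `g` is invertible. -/
theorem isClosed_GU : IsClosed (GU p D : Set (GL (Fin 3) (Ep p D))) := by
  have h : (GU p D : Set (GL (Fin 3) (Ep p D))) = {g | (g.1)ᴴ * J p D * g.1 =
      (((g.1)ᴴ * J p D * g.1) 1 1).re • J p D} := by
    have hJ : J p D 1 1 = 1 := rfl
    ext g
    constructor
    · rintro ⟨m, hm⟩
      rw [Set.mem_ofPred_eq, hm]
      congr 1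
      rw [Matrix.smul_apply, hJ]
      simp [QuadraticAlgebra.re_one]
    · intro hg
      rw [Set.mem_ofPred_eq] at hg
      have hm : (((g.1)ᴴ * J p D * g.1) 1 1).re ≠ 0 := by
        intro h0
        rw [h0, zero_smul] at hg
        have h1 : g.1 * (g⁻¹).1 = 1 := by rw [← Units.val_mul]; simp
        have h2 : ((g⁻¹).1)ᴴ * (g.1)ᴴ = 1 := by rw [← conjTranspose_mul, h1]; simp
        have h3 : ((g⁻¹).1)ᴴ * ((g.1)ᴴ * J p D * g.1) * (g⁻¹).1 = J p D := by
          rw [show ((g⁻¹).1)ᴴ * ((g.1)ᴴ * J p D * g.1) * (g⁻¹).1 =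
            (((g⁻¹).1)ᴴ * (g.1)ᴴ) * J p D * (g.1 * (g⁻¹).1) by simp only [Matrix.mul_assoc], h1, h2]
          simp
        rw [hg] at h3
        have h4 := congr_fun (congr_fun h3 1) 1
        rw [hJ] at h4
        simp at h4
      exact ⟨Units.mk0 _ hm, hg⟩
  rw [h]
  have hc : Continuous fun g : GL (Fin 3) (Ep p D) => (g.1)ᴴ * J p D * g.1 :=
    ((Units.continuous_val.matrix_conjTranspose).mul continuous_const).mul Units.continuous_val
  exact isClosed_eq hc (((continuous_re p D).comp (hc.matrix_elem 1 1)).smul continuous_const)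

theorem isClosedEmbedding_GU : IsClosedEmbedding fun g : GU p D =>
    Units.embedProduct (Matrix (Fin 3) (Fin 3) (Ep p D)) g.1 :=
  Units.isClosedEmbedding_embedProduct.comp isClosed_GU.isClosedEmbedding_subtypeVal

theorem continuous_GU_entry (i j : Fin 3) : Continuous fun g : GU p D => g.1.1 i j :=
  (Units.continuous_val.comp continuous_subtype_val).matrix_elem i j

namespace LocalOrder

variable (O : LocalOrder p D) (n : ℕ)

theorem isOpen_congruence : IsOpen (O.congruence n : Set (GU p D)) := by
  have h : ∀ i j, Continuous fun g : GU p D => (g.1.1 - 1) i j := fun i j =>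
    (continuous_GU_entry i j).sub continuous_const
  have h1 : IsOpen {g : GU p D | ∀ i j, (g.1.1 - 1) i j ∈ O.primePow n} := by
    simp_rw [Set.ofPred_forall]
    exact isOpen_iInter_of_finite fun i => isOpen_iInter_of_finite fun j =>
      (O.isOpen_primePow n).preimage (h i j)
  exact h1.inter (h1.preimage continuous_inv)

theorem isCompact_integralMatrices :
    IsCompact {A : Matrix (Fin 3) (Fin 3) (Ep p D) | ∀ i j, A i j ∈ O} := by
  have h : {A : Matrix (Fin 3) (Fin 3) (Ep p D) | ∀ i j, A i j ∈ O} =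
      Set.pi Set.univ fun _ => Set.pi Set.univ fun _ => (O : Set (Ep p D)) := by
    ext A
    exact ⟨fun h i _ j _ => h i j, fun h i j => h i trivial j trivial⟩
  rw [h]
  exact isCompact_univ_pi fun _ => isCompact_univ_pi fun _ => O.isCompact

theorem isCompact_congruence : IsCompact (O.congruence n : Set (GU p D)) := by
  have hC := O.isCompact_integralMatrices
  have h := isClosedEmbedding_GU.isCompact_preimage
    (hC.prod (MulOpposite.opHomeomorph.symm.isCompact_preimage.2 hC))
  refine h.of_isClosed_subset (Subgroup.isClosed_of_isOpen _ (O.isOpen_congruence n)) ?_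
  have key : ∀ A : Matrix (Fin 3) (Fin 3) (Ep p D), (∀ i j, (A - 1) i j ∈ O.primePow n) →
      ∀ i j, A i j ∈ O := by
    intro A hA i j
    have h1 : (1 : Matrix (Fin 3) (Fin 3) (Ep p D)) i j ∈ O := by
      rw [Matrix.one_apply]
      split_ifs
      exacts [one_mem O, zero_mem O]
    have := add_mem (mem_of_mem_primePow (hA i j)) h1
    simpa using this
  rintro g ⟨hg, hg'⟩
  exact ⟨key _ hg, key _ hg'⟩

/-- The congruence subgroups form a basis of neighbourhoods of `1`. -/
theorem exists_congruence_subset {U : Set (GU p D)} (hU : U ∈ 𝓝 1) :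
    ∃ n, 1 ≤ n ∧ (O.congruence n : Set (GU p D)) ⊆ U := by
  rw [isClosedEmbedding_GU.isInducing.nhds_eq_comap, mem_comap] at hU
  obtain ⟨V, hV, hVU⟩ := hU
  obtain ⟨V', hV'V, hV'o, hV'1⟩ := mem_nhds_iff.1 hV
  set C := {A : Matrix (Fin 3) (Fin 3) (Ep p D) | ∀ i j, A i j ∈ O} with hC
  have hCc : IsCompact C := O.isCompact_integralMatrices
  -- For parameter `0` the value is `(1, 1)`. The tube lemma over the compact set of pairs of
  -- integral matrices yields one power of `p` that is good for all of them.
  let F : ℚ_[p] × (Matrix (Fin 3) (Fin 3) (Ep p D) × Matrix (Fin 3) (Fin 3) (Ep p D)) →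
      Matrix (Fin 3) (Fin 3) (Ep p D) × (Matrix (Fin 3) (Fin 3) (Ep p D))ᵐᵒᵖ :=
    fun x => (1 + x.1 • x.2.1, MulOpposite.op (1 + x.1 • x.2.2))
  have hF : Continuous F := by
    refine Continuous.prodMk ?_ (MulOpposite.continuous_op.comp ?_)
    · exact continuous_const.add (continuous_fst.smul (continuous_fst.comp continuous_snd))
    · exact continuous_const.add (continuous_fst.smul (continuous_snd.comp continuous_snd))
  obtain ⟨u, v, hu, -, h0u, hCv, huv⟩ := generalized_tube_lemma
    (isCompact_singleton (x := (0 : ℚ_[p]))) (hCc.prod hCc) (hV'o.preimage hF) (by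
      rintro ⟨a, A, B⟩ ⟨rfl, -⟩
      simp only [Set.mem_preimage, F, zero_smul, add_zero]
      exact hV'1)
  have ht : Tendsto (fun n : ℕ => (p : ℚ_[p]) ^ n) atTop (𝓝 0) :=
    tendsto_pow_atTop_nhds_zero_of_norm_lt_one Padic.norm_p_lt_one
  obtain ⟨n, hn, hn1⟩ :=
    ((ht.eventually (hu.mem_nhds (h0u rfl))).and (eventually_ge_atTop 1)).exists
  refine ⟨n, hn1, fun g hg => hVU (hV'V ?_)⟩
  have key : ∀ A : Matrix (Fin 3) (Fin 3) (Ep p D),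
      1 + (p : ℚ_[p]) ^ n • ((p : ℚ_[p]) ^ (-(n : ℤ)) • (A - 1)) = A := by
    intro A
    rw [smul_smul, ← zpow_natCast, ← zpow_add₀ (natCast_prime_ne_zero p), add_neg_cancel, zpow_zero,
      one_smul, add_sub_cancel]
  have h := @huv ((p : ℚ_[p]) ^ n, ((p : ℚ_[p]) ^ (-(n : ℤ)) • (g.1.1 - 1),
    (p : ℚ_[p]) ^ (-(n : ℤ)) • ((g⁻¹).1.1 - 1))) ⟨hn, hCv ⟨hg.1, hg.2⟩⟩
  simp only [Set.mem_preimage, F, key] at h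
  exact h

end LocalOrder

end TopologyOfG

/-! ### Hecke operators -/

section Hecke

variable {G : Type*} [Group G] (K : Subgroup G) (t : G)

/-- The subgroup `K ∩ t K t⁻¹` of `K`. -/
def heckeSubgroup : Subgroup K := (K.comap (MulAut.conj t⁻¹).toMonoidHom).subgroupOf K

variable {K t}

theorem mem_heckeSubgroup {c : K} : c ∈ heckeSubgroup K t ↔ t⁻¹ * c * t ∈ K := by
  rw [heckeSubgroup, Subgroup.mem_subgroupOf, Subgroup.mem_comap]
  simp

variable [Fintype (K ⧸ heckeSubgroup K t)]

variable (K t) in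
/-- The normalised Hecke operator of the double coset `K t K` on functions on `G`. -/
def heckeOp (k : Type*) [Field k] [Algebra k ℂ] : (G → ℂ) →ₗ[k] (G → ℂ) where
  toFun f g := (Fintype.card (K ⧸ heckeSubgroup K t) : ℂ)⁻¹ *
    ∑ q : K ⧸ heckeSubgroup K t, f (g * ((q.out : K) : G) * t)
  map_add' f f' := by
    ext g
    simp [Finset.sum_add_distrib, mul_add]
  map_smul' c f := by
    ext g
    simp [Algebra.smul_def, Finset.mul_sum, mul_left_comm]

theorem heckeOp_apply (k : Type*) [Field k] [Algebra k ℂ] (f : G → ℂ) (g : G) :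
    heckeOp K t k f g = (Fintype.card (K ⧸ heckeSubgroup K t) : ℂ)⁻¹ *
      ∑ q : K ⧸ heckeSubgroup K t, f (g * ((q.out : K) : G) * t) := rfl

/-- Because the operator is an average, the number of cosets never has to be computed. -/
theorem heckeOp_apply_of_forall (k : Type*) [Field k] [Algebra k ℂ] {f : G → ℂ} {g : G} {c : ℂ}
    (h : ∀ κ ∈ K, f (g * κ * t) = c) : heckeOp K t k f g = c := by
  rw [heckeOp_apply, Finset.sum_congr rfl fun q _ => h _ (q.out : K).2, Finset.sum_const,
    Finset.card_univ, nsmul_eq_mul, inv_mul_cancel_left₀]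
  exact_mod_cast Fintype.card_ne_zero

/-- The Hecke operator on matrix coefficients comes from the averaging operator on `K`-invariant
vectors. -/
theorem exists_heckeOp_eq {V : Type*} [AddCommGroup V] [Module ℂ V] (π : Representation ℂ G V)
    (k : Type*) [Field k] [Algebra k ℂ] {w : V} (hw : ∀ κ ∈ K, π κ w = w) :
    ∃ w', (∀ κ ∈ K, π κ w' = w') ∧ ∀ Λ : V →ₗ[ℂ] ℂ,
      heckeOp K t k (fun g => Λ (π g w)) = fun g => Λ (π g w') := by
  refine ⟨(Fintype.card (K ⧸ heckeSubgroup K t) : ℂ)⁻¹ •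
    ∑ q : K ⧸ heckeSubgroup K t, π (((q.out : K) : G) * t) w, fun κ hκ => ?_, fun Λ => ?_⟩
  · rw [map_smul, map_sum]
    congr 1
    -- Left multiplication by `κ` permutes the cosets. The resulting change of representative lies
    -- in `K ∩ t K t⁻¹`, so after passing `t` it acts on `w` through `K`, that is, trivially.
    refine Fintype.sum_equiv (MulAction.toPerm (⟨κ, hκ⟩ : K)) _ _ fun q => ?_
    have h1 : (QuotientGroup.mk ((⟨κ, hκ⟩ : K) * q.out) : K ⧸ heckeSubgroup K t) =
        (⟨κ, hκ⟩ : K) • q := by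
      conv_rhs => rw [← QuotientGroup.out_eq' q]
      rfl
    have h2 : ((((⟨κ, hκ⟩ : K) • q).out)⁻¹ * ((⟨κ, hκ⟩ : K) * q.out)) ∈ heckeSubgroup K t := by
      rw [← QuotientGroup.eq, h1, QuotientGroup.out_eq']
    have h3 := hw _ (mem_heckeSubgroup.1 h2)
    rw [MulAction.toPerm_apply, ← Module.End.mul_apply, ← map_mul]
    conv_rhs => rw [← h3]
    rw [← Module.End.mul_apply, ← map_mul]
    congr 2
    simp only [Subgroup.coe_mul, Subgroup.coe_inv]
    group
  · ext g
    rw [heckeOp_apply, map_smul, map_sum, map_smul, map_sum, smul_eq_mul]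
    congr 1
    refine Finset.sum_congr rfl fun q _ => ?_
    rw [mul_assoc, map_mul π g, Module.End.mul_apply]

end Hecke

/-! ### Functions with values in a subfield -/

section ValuesInSubfield

variable (k : Type*) [Field k] [Algebra k ℂ] {X : Type*}

/-- The functions in `E` with values in `k`. -/
def kValued (E : Submodule ℂ (X → ℂ)) : Submodule k (X → ℂ) where
  carrier := {f | f ∈ E ∧ ∀ x, f x ∈ (algebraMap k ℂ).range}
  add_mem' := fun ⟨h1, h2⟩ ⟨h3, h4⟩ => ⟨add_mem h1 h3, fun x => add_mem (h2 x) (h4 x)⟩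
  zero_mem' := ⟨zero_mem _, fun _ => zero_mem _⟩
  smul_mem' c f hf := by
    refine ⟨?_, fun x => ?_⟩
    · rw [← algebraMap_smul ℂ c f]
      exact E.smul_mem _ hf.1
    · rw [Pi.smul_apply, Algebra.smul_def]
      exact mul_mem ⟨c, rfl⟩ (hf.2 x)

/-- Choose `S` for which the space of functions vanishing on `S` is minimal. One more point cannot
make it smaller, so its elements vanish everywhere. -/
theorem exists_finset_separating (E : Submodule ℂ (X → ℂ)) [FiniteDimensional ℂ E] :
    ∃ S : Finset X, ∀ f ∈ E, (∀ x ∈ S, f x = 0) → f = 0 := by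
  classical
  let A : Finset X → Submodule ℂ E := fun S =>
    { carrier := {f | ∀ x ∈ S, f.1 x = 0}
      add_mem' := fun hf hg x hx => by simp [hf x hx, hg x hx]
      zero_mem' := fun _ _ => rfl
      smul_mem' := fun c f hf x hx => by simp [hf x hx] }
  obtain ⟨_, ⟨S, rfl⟩, hS⟩ := IsArtinian.set_has_minimal (Set.range A) (Set.range_nonempty A)
  refine ⟨S, fun f hf h => funext fun x => ?_⟩
  have hle : A (insert x S) ≤ A S := fun g hg y hy => hg y (Finset.mem_insert_of_mem hy)
  have heq : A (insert x S) = A S := hle.eq_of_not_lt (hS _ ⟨_, rfl⟩)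
  have hmem : (⟨f, hf⟩ : E) ∈ A S := h
  rw [← heq] at hmem
  exact hmem x (Finset.mem_insert_self x S)

/-- The values on a finite separating set embed these functions in `S → k`. Finiteness thus descends
from `ℂ` to `k` without a `k`-structure on the representation. -/
instance finiteDimensional_kValued (E : Submodule ℂ (X → ℂ)) [FiniteDimensional ℂ E] :
    FiniteDimensional k (kValued k E) := by
  obtain ⟨S, hS⟩ := exists_finset_separating E
  let j : (S → k) →ₗ[k] (S → ℂ) := LinearMap.compLeft (Algebra.linearMap k ℂ) S
  let r : kValued k E →ₗ[k] (S → ℂ) := (LinearMap.funLeft k ℂ (fun s : S => (s : X))).comp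
    (kValued k E).subtype
  have hr : ∀ f, r f ∈ LinearMap.range j := by
    intro f
    choose a ha using f.2.2
    exact ⟨fun s => a s, funext fun s => ha s⟩
  refine FiniteDimensional.of_injective (r.codRestrict (LinearMap.range j) hr) ?_
  rw [← LinearMap.ker_eq_bot, LinearMap.ker_codRestrict, LinearMap.ker_eq_bot']
  intro f hf
  refine Subtype.ext (hS _ f.2.1 fun x hx => ?_)
  exact congr_fun hf ⟨x, hx⟩

end ValuesInSubfield

/-! ### Whittaker functions on the torus -/

section Whittaker

variable {p : ℕ} [hp : Fact p.Prime] {D : ℕ}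

/-- The functions `g ↦ Λ (π g w)`, where `w` is fixed by `K`. -/
def coefficientSpace {V : Type*} [AddCommGroup V] [Module ℂ V] (π : Representation ℂ (GU p D) V)
    (Λ : V →ₗ[ℂ] ℂ) (K : Subgroup (GU p D)) : Submodule ℂ (GU p D → ℂ) where
  carrier := {f | ∃ w, (∀ κ ∈ K, π κ w = w) ∧ f = fun g => Λ (π g w)}
  add_mem' := by
    rintro _ _ ⟨w, hw, rfl⟩ ⟨w', hw', rfl⟩
    exact ⟨w + w', fun κ hκ => by rw [map_add, hw κ hκ, hw' κ hκ], by ext; simp⟩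
  zero_mem' := ⟨0, by simp, by ext; simp⟩
  smul_mem' := by
    rintro c _ ⟨w, hw, rfl⟩
    exact ⟨c • w, fun κ hκ => by rw [map_smul, hw κ hκ], by ext; simp⟩

variable {V : Type*} [AddCommGroup V] [Module ℂ V] {π : Representation ℂ (GU p D) V}
  {Λ : V →ₗ[ℂ] ℂ} {K : Subgroup (GU p D)}

theorem finiteDimensional_coefficientSpace (hadm : IsAdmissible π)
    (hK : IsOpen (K : Set (GU p D))) : FiniteDimensional ℂ (coefficientSpace π Λ K) := by
  have := hadm.2 K hK
  let F : V →ₗ[ℂ] (GU p D → ℂ) := LinearMap.pi fun g => Λ.comp (π g)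
  have h : coefficientSpace π Λ K = (Representation.invariants (π.comp K.subtype)).map F := by
    ext f
    rw [Submodule.mem_map]
    constructor
    · rintro ⟨w, hw, rfl⟩
      exact ⟨w, fun κ => hw κ κ.2, rfl⟩
    · rintro ⟨w, hw, rfl⟩
      exact ⟨w, fun κ hκ => hw ⟨κ, hκ⟩, rfl⟩
  rw [h]
  infer_instance

theorem coefficientSpace_mul_right {f : GU p D → ℂ} (hf : f ∈ coefficientSpace π Λ K) {κ : GU p D}
    (hκ : κ ∈ K) (g : GU p D) : f (g * κ) = f g := by
  obtain ⟨w, hw, rfl⟩ := hf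
  simp only [map_mul, Module.End.mul_apply, hw κ hκ]

theorem coefficientSpace_unipotent_mul {ψ : AddChar ℚ_[p] Circle}
    (hΛ : IsWhittakerFunctional ψ π Λ) {f : GU p D → ℂ} (hf : f ∈ coefficientSpace π Λ K)
    {u : GU p D} (hu : IsUnipotentUpper p D u) (g : GU p D) :
    f (u * g) = (ψ (QuadraticAlgebra.trace (deltaInv p D * u.1.1 1 2)) : ℂ) * f g := by
  obtain ⟨w, hw, rfl⟩ := hf
  simp only [map_mul π u, Module.End.mul_apply, hΛ u hu]

variable {O : LocalOrder p D} {n : ℕ}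

variable (O n) in
/-- The `x` such that the character `e ↦ ψ (tr (δ⁻¹ * star x * e))` is trivial on `p ^ n O`. -/
def dualLattice (ψ : AddChar ℚ_[p] Circle) : AddSubgroup (Ep p D) where
  carrier := {x | ∀ e ∈ O.primePow n,
    ψ (QuadraticAlgebra.trace (deltaInv p D * (star x * e))) = 1}
  add_mem' := by
    intro x y hx hy e he
    rw [star_add, add_mul, mul_add, map_add, AddChar.map_add_eq_mul, hx e he, hy e he, one_mul]
  zero_mem' := by
    intro e _
    simp
  neg_mem' := by
    intro x hx e he
    rw [star_neg, neg_mul, mul_neg, map_neg, AddChar.map_neg_eq_inv, hx e he, inv_one]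

theorem mem_dualLattice {ψ : AddChar ℚ_[p] Circle} {x : Ep p D} : x ∈ dualLattice O n ψ ↔
    ∀ e ∈ O.primePow n, ψ (QuadraticAlgebra.trace (deltaInv p D * (star x * e))) = 1 := Iff.rfl

theorem star_smul_Ep (a : ℚ_[p]) (x : Ep p D) : star (a • x) = a • star x := by
  ext <;> simp

theorem exists_pow_smul_mem_primePow (x : Ep p D) :
    ∃ m : ℤ, (p : ℚ_[p]) ^ m • x ∈ O.primePow n := by
  obtain ⟨m, hm⟩ := O.isLattice_self.exists_mem x
  refine ⟨n + m, ?_⟩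
  rw [zpow_add₀ (natCast_prime_ne_zero p), mul_smul, zpow_natCast,
    LocalOrder.pow_smul_mem_primePow]
  exact hm

/-- By continuity some ball `p ^ m ℤ_p` is mapped close to `1`. The ball is closed under integer
multiples and the circle has no small subgroups. -/
theorem exists_ball_le_ker {ψ : AddChar ℚ_[p] Circle} (hψ : Continuous ψ) :
    ∃ m : ℕ, ∀ a : ℚ_[p], ‖a‖ ≤ 1 → ψ ((p : ℚ_[p]) ^ m * a) = 1 := by
  have hcont : Continuous fun a : ℚ_[p] => ‖(ψ a : ℂ) - 1‖ :=
    ((continuous_subtype_val.comp hψ).sub continuous_const).norm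
  have hnhds : {a : ℚ_[p] | ‖(ψ a : ℂ) - 1‖ < 1 / 2} ∈ 𝓝 (0 : ℚ_[p]) :=
    hcont.continuousAt.preimage_mem_nhds (Iio_mem_nhds (by simp))
  obtain ⟨ε, hε, hball⟩ := Metric.mem_nhds_iff.1 hnhds
  obtain ⟨m, hm⟩ := exists_pow_lt_of_lt_one hε
    (inv_lt_one_of_one_lt₀ (by exact_mod_cast hp.out.one_lt : (1 : ℝ) < p))
  refine ⟨m, fun a ha => ?_⟩
  refine Circle.ext (eq_one_of_forall_norm_pow_sub_one_le fun r => ?_)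
  have h1 : (ψ ((r : ℚ_[p]) * ((p : ℚ_[p]) ^ m * a)) : ℂ) = (ψ ((p : ℚ_[p]) ^ m * a) : ℂ) ^ r := by
    rw [← nsmul_eq_mul, AddChar.map_nsmul_eq_pow, Circle.coe_pow]
  rw [← h1]
  refine le_of_lt (hball ?_)
  rw [mem_ball_zero_iff, norm_mul, norm_mul, norm_pow, Padic.norm_p]
  have h2 : ‖(r : ℚ_[p])‖ ≤ 1 := by exact_mod_cast Padic.norm_int_le_one (p := p) (r : ℤ)
  have h3 : (p : ℝ)⁻¹ ^ m * ‖a‖ ≤ (p : ℝ)⁻¹ ^ m := mul_le_of_le_one_right (by positivity) ha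
  calc ‖(r : ℚ_[p])‖ * ((p : ℝ)⁻¹ ^ m * ‖a‖) ≤ 1 * ((p : ℝ)⁻¹ ^ m * ‖a‖) := by gcongr
    _ < ε := by rw [one_mul]; exact h3.trans_lt hm

/-- Continuity of `ψ` gives absorption. Nontriviality of `ψ`, together with nondegeneracy of the
pairing `tr (δ⁻¹ * star x * e)`, excludes lines. -/
theorem isLattice_dualLattice (hD : D ≠ 0) {ψ : AddChar ℚ_[p] Circle} (hψ : Continuous ψ)
    (hψ1 : ψ ≠ 1) : O.IsLattice (dualLattice O n ψ) where
  mul_mem o ho x hx e he := by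
    rw [star_mul, mul_assoc]
    exact hx _ (LocalOrder.mul_mem_primePow (O.star_mem o ho) he)
  exists_mem x := by
    obtain ⟨m, hm⟩ := exists_ball_le_ker hψ
    obtain ⟨l, hl⟩ := O.isLattice_self.exists_mem (deltaInv p D * star x)
    refine ⟨m + l, fun e he => ?_⟩
    have h : QuadraticAlgebra.trace (deltaInv p D * (star ((p : ℚ_[p]) ^ ((m : ℤ) + l) • x) * e)) =
        (p : ℚ_[p]) ^ m * QuadraticAlgebra.trace (((p : ℚ_[p]) ^ l • (deltaInv p D * star x)) * e) := by
      rw [star_smul_Ep, zpow_add₀ (natCast_prime_ne_zero p), zpow_natCast, mul_smul, smul_mul_assoc,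
        mul_smul_comm, map_smul, smul_eq_mul, smul_mul_assoc, smul_mul_assoc, mul_smul_comm,
        mul_assoc]
    rw [h]
    exact hm _ (O.norm_trace_le_one (mul_mem (S := LocalOrder p D) hl
      (LocalOrder.mem_of_mem_primePow he)))
  exists_notMem x hx := by
    obtain ⟨a, ha⟩ : ∃ a, ψ a ≠ 1 := by
      by_contra! h
      exact hψ1 (DFunLike.ext _ _ h)
    -- Pairing with `1` and with `δ` recovers both coordinates of `x`.
    obtain ⟨e₀, he₀⟩ : ∃ e₀ : Ep p D,
        QuadraticAlgebra.trace (deltaInv p D * (star x * e₀)) ≠ 0 := by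
      by_contra! h
      have hD' : (D : ℚ_[p]) ≠ 0 := by exact_mod_cast hD
      have h1 := h 1
      have h2 := h QuadraticAlgebra.omega
      simp [deltaInv, QuadraticAlgebra.trace_def, hD'] at h1
      simp [deltaInv, QuadraticAlgebra.trace_def, hD'] at h2
      exact hx (by ext <;> simp [h1, h2])
    set t := QuadraticAlgebra.trace (deltaInv p D * (star x * e₀)) with ht
    -- The rescaled `e₀` pairs with `x` to `a`, where `ψ` is not `1`. The power `p ^ m` that brings
    -- it into `p ^ n O` is undone by `p ^ (-m)` on `x`.
    obtain ⟨m, hm⟩ := exists_pow_smul_mem_primePow (O := O) (n := n) ((a / t) • e₀)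
    refine ⟨-m, fun h => ha ?_⟩
    have h1 := h _ hm
    have h2 : QuadraticAlgebra.trace (deltaInv p D * (star ((p : ℚ_[p]) ^ (-m) • x) *
        ((p : ℚ_[p]) ^ m • (a / t) • e₀))) = a := by
      rw [star_smul_Ep, smul_mul_assoc, mul_smul_comm, map_smul, mul_smul_comm, mul_smul_comm,
        mul_smul_comm, mul_smul_comm, map_smul, map_smul, ← ht, smul_smul,
        ← zpow_add₀ (natCast_prime_ne_zero p), neg_add_cancel, zpow_zero, one_smul, smul_eq_mul,
        div_mul_cancel₀ _ he₀]
    rwa [h2] at h1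

variable {ψ : AddChar ℚ_[p] Circle}

/-- Let `t = torusG x`, and let `u` be unipotent in the congruence subgroup with `u₂₃ = e`.
Invariance on the right and `t * u = (t * u * t⁻¹) * t` give `f t = ψ (tr (δ⁻¹ * star x * e)) * f
t`. Outside the dual lattice some `e` makes the factor different from `1`. -/
theorem coefficient_torusG_eq_zero (hD : D ≠ 0) (hn : 1 ≤ n) (hΛ : IsWhittakerFunctional ψ π Λ)
    {f : GU p D → ℂ} (hf : f ∈ coefficientSpace π Λ (O.congruence n)) {x : (Ep p D)ˣ}
    (hx : (x : Ep p D) ∉ dualLattice O n ψ) : f (torusG x) = 0 := by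
  rw [mem_dualLattice] at hx
  push Not at hx
  obtain ⟨e, he, hne⟩ := hx
  have hN := LocalOrder.half_omega_norm_mem_primePow hn he
  -- The corner entry of `u`: half of `δ * Nm e` solves the equation that puts `u` in `G`, and it is
  -- still divisible by `p ^ n`.
  set c : Ep p D := (2 : ℚ_[p])⁻¹ • (QuadraticAlgebra.omega * (e * star e)) with hc
  have h : c - star c = QuadraticAlgebra.omega * (e * star e) := by
    rw [hc, star_smul_Ep, star_mul, star_mul, star_star, star_omega, mul_comm (e * star e), neg_mul,
      smul_neg, sub_neg_eq_add, ← add_smul]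
    norm_num
  have hu := isUnipotentUpper_unipotent hD e c h
  have huK := LocalOrder.unipotent_mem_congruence hD h he hN
  obtain ⟨h1, h2⟩ := hu.torusG_conj x
  have h3 := coefficientSpace_mul_right hf huK (torusG x)
  have h4 := coefficientSpace_unipotent_mul hΛ hf h1 (torusG x)
  rw [h2, inv_mul_cancel_right, h3, unipotent_val] at h4
  have h5 : (ψ (QuadraticAlgebra.trace (deltaInv p D * (star (x : Ep p D) * e))) : ℂ) ≠ 1 := by
    intro h6
    exact hne (Circle.ext h6)
  by_contra h0
  exact h5 (mul_right_cancel₀ h0 ((one_mul _).trans h4).symm)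

theorem finite_quotient_heckeSubgroup {G : Type*} [Group G] [TopologicalSpace G]
    [IsTopologicalGroup G] {K : Subgroup G} (hK : IsOpen (K : Set G)) (hK' : IsCompact (K : Set G))
    (t : G) : Finite (K ⧸ heckeSubgroup K t) := by
  have : CompactSpace K := isCompact_iff_compactSpace.1 hK'
  refine Subgroup.quotient_finite_of_isOpen _ ?_
  have hc : Continuous fun κ : K => t⁻¹ * (κ : G) * t := by fun_prop
  convert! hK.preimage hc using 1
  ext κ
  exact mem_heckeSubgroup

instance (t : GU p D) : Finite (O.congruence n ⧸ heckeSubgroup (O.congruence n) t) :=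
  finite_quotient_heckeSubgroup (O.isOpen_congruence n) (O.isCompact_congruence n) t

instance (t : GU p D) : Fintype (O.congruence n ⧸ heckeSubgroup (O.congruence n) t) :=
  Fintype.ofFinite _

/-- All terms of the average are equal. Factor `κ = u * l`. Moved to the left past `torusG x`, the
factor `u` contributes a value of `ψ`, which is `1` because `x` is in the dual lattice. Moved to the
right past `torusG y`, the factor `l` stays in the congruence subgroup because `y` is integral. -/
theorem heckeOp_torusG (k : Type*) [Field k] [Algebra k ℂ] (hD : D ≠ 0) (hn : 1 ≤ n)
    (hΛ : IsWhittakerFunctional ψ π Λ) {f : GU p D → ℂ}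
    (hf : f ∈ coefficientSpace π Λ (O.congruence n)) {x y : (Ep p D)ˣ}
    (hx : (x : Ep p D) ∈ dualLattice O n ψ) (hy : (y : Ep p D) ∈ O) :
    heckeOp (O.congruence n) (torusG y) k f (torusG x) = f (torusG (x * y)) := by
  refine heckeOp_apply_of_forall k fun κ hκ => ?_
  obtain ⟨u, huK, hu, l, hlK, hl, hl', rfl⟩ := exists_unipotent_mul hD hn hκ
  obtain ⟨h1, h2⟩ := hu.torusG_conj x
  have h3 : torusG x * (u * l) * torusG y =
      (torusG x * u * (torusG x)⁻¹) * (torusG (x * y) * ((torusG y)⁻¹ * l * torusG y)) := by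
    rw [map_mul]
    group
  have hu12 : u.1.1 1 2 ∈ O.primePow n := by simpa using huK.1 1 2
  rw [h3, coefficientSpace_unipotent_mul hΛ hf h1, h2, hx _ hu12, Circle.coe_one, one_mul,
    coefficientSpace_mul_right hf (torusG_conj_mem_congruence hlK hl hl' hy)]

end Whittaker

/-! ### Power series of Whittaker functions along the torus -/

section TorusSeries

theorem IsRationalNearZero.mul_zpow {k : Type*} [Field k] [Algebra k ℂ] {f : ℂ → ℂ}
    (hf : IsRationalNearZero k f) (c : ℤ) : IsRationalNearZero k fun X => X ^ c * f X := by
  simpa using (isRationalNearZero_monomial k 1 c).mul hf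

theorem RationalSum.shift {k : Type*} [Field k] [Algebra k ℂ] {ι : Type*} {a : ι → ℂ} {e : ι → ℤ}
    (h : RationalSum k a e) (c : ℤ) : RationalSum k a fun i => c + e i := by
  have key : ∀ X : ℂ, X ≠ 0 → ∀ i, a i * X ^ (c + e i) = X ^ c * (a i * X ^ e i) := by
    intro X hX i
    rw [zpow_add₀ hX]
    ring
  refine ⟨?_, (h.2.mul_zpow c).congr ?_⟩
  · filter_upwards [h.1, self_mem_nhdsWithin] with X h1 hX
    simp_rw [key X hX, norm_mul (X ^ c)]
    exact h1.mul_left _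
  · filter_upwards [self_mem_nhdsWithin] with X hX
    simp_rw [key X hX, tsum_mul_left]

variable {p : ℕ} [hp : Fact p.Prime] {D : ℕ} {V : Type*} [AddCommGroup V] [Module ℂ V]
  {π : Representation ℂ (GU p D) V} {Λ : V →ₗ[ℂ] ℂ} {O : LocalOrder p D} {n : ℕ}
  {ψ : AddChar ℚ_[p] Circle} {k : Type*} [Field k] [Algebra k ℂ]

variable (π Λ O n k) in
/-- The `k`-valued functions `g ↦ Λ (π g w)`, where `w` is fixed by a congruence subgroup. -/
abbrev algebraicCoefficients : Submodule k (GU p D → ℂ) :=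
  kValued k (coefficientSpace π Λ (O.congruence n))

theorem inv_natCast_mem_range (N : ℕ) : ((N : ℂ))⁻¹ ∈ (algebraMap k ℂ).range :=
  ⟨(N : k)⁻¹, by simp⟩

/-- The operator preserves the fixed vectors by `exists_heckeOp_eq`, and averaging only divides by a
positive integer, so values remain in `k`. -/
theorem heckeOp_mem (t : GU p D) {f : GU p D → ℂ} (hf : f ∈ algebraicCoefficients π Λ O n k) :
    heckeOp (O.congruence n) t k f ∈ algebraicCoefficients π Λ O n k := by
  obtain ⟨⟨w, hw, rfl⟩, hk⟩ := hf
  obtain ⟨w', hw', h⟩ := exists_heckeOp_eq (t := t) π k hw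
  refine ⟨⟨w', hw', h Λ⟩, fun g => ?_⟩
  rw [heckeOp_apply]
  exact mul_mem (inv_natCast_mem_range _) (sum_mem fun q _ => hk _)

/-- Scalar matrices are central, so they act on the vectors fixed by the congruence subgroup. -/
theorem translate_scalarG_mem (b : ℚ_[p]ˣ) {f : GU p D → ℂ}
    (hf : f ∈ algebraicCoefficients π Λ O n k) :
    (fun g => f (g * scalarG b)) ∈ algebraicCoefficients π Λ O n k := by
  obtain ⟨⟨w, hw, rfl⟩, hk⟩ := hf
  refine ⟨⟨π (scalarG b) w, fun κ hκ => ?_, ?_⟩, fun g => hk _⟩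
  · rw [← Module.End.mul_apply, ← map_mul, ← scalarG_mul_comm, map_mul, Module.End.mul_apply,
      hw κ hκ]
  · ext g
    simp only [map_mul, Module.End.mul_apply]

theorem coe_repr_expansion {X : Type*} {F : Submodule k (X → ℂ)} {ι : Type*} [Fintype ι]
    (b : Module.Basis ι k F) (f : F) (x : X) :
    (f : X → ℂ) x = ∑ j, algebraMap k ℂ (b.repr f j) * (b j : X → ℂ) x := by
  have h := congr_arg (fun g : F => (g : X → ℂ) x) (b.sum_repr f)
  simp only [Submodule.coe_sum, Finset.sum_apply, Submodule.coe_smul,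
    Algebra.smul_def] at h
  exact h.symm

/-- Series over a product, obtained by expanding vectors of a finite-dimensional space of functions
in coordinates. -/
theorem RationalSum.of_coords {X α κ : Type*} {F : Submodule k (X → ℂ)} [FiniteDimensional k F]
    {a : α → ℂ} {v : α → F} {e : α → ℤ}
    (ha : ∀ l : F →ₗ[k] k, RationalSum k (fun i => a i * algebraMap k ℂ (l (v i))) e)
    {c : κ → ℂ} {y : κ → X} {e' : κ → ℤ}
    (h : ∀ g ∈ F, RationalSum k (fun i => c i * g (y i)) e') :
    RationalSum k (fun i : α × κ => a i.1 * (c i.2 * (v i.1 : X → ℂ) (y i.2)))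
      fun i => e i.1 + e' i.2 := by
  let b := Module.finBasis k F
  have hterm : ∀ i : α × κ, a i.1 * (c i.2 * (v i.1 : X → ℂ) (y i.2)) =
      ∑ j, (a i.1 * algebraMap k ℂ (b.coord j (v i.1))) * (c i.2 * (b j : X → ℂ) (y i.2)) := by
    intro i
    rw [coe_repr_expansion b, Finset.mul_sum, Finset.mul_sum]
    refine Finset.sum_congr rfl fun j _ => ?_
    rw [Module.Basis.coord_apply]
    ring
  simp_rw [hterm]
  refine RationalSum.sum fun j _ => ?_
  exact RationalSum.mul (a := fun i => a i * algebraMap k ℂ (b.coord j (v i)))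
    (b := fun i => c i * (b j : X → ℂ) (y i)) (ha (b.coord j)) (h (b j) (b j).2)

theorem unitNorm_valuation_pow_mul (w y : (Ep p D)ˣ) (r : ℕ) :
    (unitNorm p D (w ^ r * y) : ℚ_[p]).valuation =
      r * (unitNorm p D w : ℚ_[p]).valuation + (unitNorm p D y : ℚ_[p]).valuation := by
  rw [map_mul, map_pow, Units.val_mul, Units.val_pow_eq_pow_val,
    Padic.valuation_mul (pow_ne_zero _ (Units.ne_zero _)) (Units.ne_zero _), Padic.valuation_pow]

theorem valuation_pos_of_norm_lt_one {a : ℚ_[p]} (ha : a ≠ 0) (h : ‖a‖ < 1) : 0 < a.valuation := by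
  rw [Padic.norm_eq_zpow_neg_valuation ha] at h
  by_contra h1
  exact absurd h (not_lt.2 (one_le_zpow₀ (by exact_mod_cast hp.out.one_lt.le) (by omega)))

/-- The series over `E_pˣ` of the values of a Whittaker function on the torus. -/
theorem rationalSum_torusG (hadm : IsAdmissible π) (hD : D ≠ 0) (hn : 1 ≤ n) (hψ : Continuous ψ)
    (hψ1 : ψ ≠ 1) (hΛ : IsWhittakerFunctional ψ π Λ) (χ : (Ep p D)ˣ →* ℂˣ)
    (hχ : ∀ x, (χ x : ℂ) ∈ (algebraMap k ℂ).range) {ι : Type} {x : ι → (Ep p D)ˣ}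
    (hx : O.IsOrthantFamily x) {f : GU p D → ℂ} (hf : f ∈ algebraicCoefficients π Λ O n k) :
    RationalSum k (fun i => (χ (x i) : ℂ) * f (torusG (x i)))
      fun i => (unitNorm p D (x i) : ℚ_[p]).valuation := by
  have := finiteDimensional_coefficientSpace (Λ := Λ) hadm (O.isOpen_congruence n)
  have hFfin : FiniteDimensional k (algebraicCoefficients π Λ O n k) :=
    finiteDimensional_kValued k _
  have hFmem : ∀ f ∈ algebraicCoefficients π Λ O n k,
    f ∈ coefficientSpace π Λ (O.congruence n) ∧ ∀ g, f g ∈ (algebraMap k ℂ).range := fun f hf => hf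
  have hFT : ∀ t : GU p D, ∀ f ∈ algebraicCoefficients π Λ O n k,
    heckeOp (O.congruence n) t k f ∈ algebraicCoefficients π Λ O n k := fun t f hf => heckeOp_mem t hf
  generalize algebraicCoefficients π Λ O n k = F at *
  -- The property carried through the recursion concerns all `f` in `F` at once, because a step
  -- expands the iterates `T ^ r f` in a basis of `F`.
  have main := hx (dualLattice O n ψ) (isLattice_dualLattice hD hψ hψ1)
    (fun {κ} y => ∀ f ∈ F, RationalSum k (fun i => (χ (y i) : ℂ) * f (torusG (y i)))
      fun i => (unitNorm p D (y i) : ℚ_[p]).valuation) ?_ ?_ ?_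
  · refine RationalSum.of_injective (g := Subtype.val) Subtype.val_injective ?_ (main f hf)
    intro i hi
    rw [coefficient_torusG_eq_zero (n := n) (ψ := ψ) hD hn hΛ (hFmem f hf).1 (x := x i) fun h => hi ⟨⟨i, h⟩, rfl⟩,
      mul_zero]
  · intro κ κ' g y h f hf
    have := (h f hf).comp_equiv g.symm
    simpa using this
  · intro κ _ y _ f hf
    exact rationalSum_of_finite _ fun i => mul_mem (hχ _) ((hFmem f hf).2 _)
  · intro κ y hy h w hw hw1 f hf
    obtain ⟨c, hc⟩ := hχ w
    obtain ⟨m, hm⟩ := Int.eq_ofNat_of_zero_le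
      (valuation_pos_of_norm_lt_one (Units.ne_zero (unitNorm p D w)) hw1).le
    have hm0 : 0 < m := by
      have := valuation_pos_of_norm_lt_one (Units.ne_zero (unitNorm p D w)) hw1
      omega
    set T : Module.End k F := (heckeOp (O.congruence n) (torusG w) k).restrict
      (hFT (torusG w)) with hT
    -- Multiplying the argument by `w ^ r` becomes applying `T ^ r`. The dual lattice is stable
    -- under `w`, so `heckeOp_torusG` is available at every stage.
    have hiter : ∀ (r : ℕ) (f : F) (z : (Ep p D)ˣ), (z : Ep p D) ∈ dualLattice O n ψ →
        ((T ^ r) f : GU p D → ℂ) (torusG z) = (f : GU p D → ℂ) (torusG (w ^ r * z)) := by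
      intro r
      induction r with
      | zero =>
        intro f z _
        simp
      | succ r ih =>
        intro f z hz
        have hzw : ((z * w : (Ep p D)ˣ) : Ep p D) ∈ dualLattice O n ψ := by
          rw [Units.val_mul, mul_comm]
          exact (isLattice_dualLattice hD hψ hψ1).mul_mem _ hw _ hz
        have h1 : ((T ^ (r + 1)) f : GU p D → ℂ) =
            heckeOp (O.congruence n) (torusG w) k ((T ^ r) f : GU p D → ℂ) := by
          rw [pow_succ', Module.End.mul_apply]
          rfl
        rw [h1, heckeOp_torusG k hD hn hΛ (hFmem _ ((T ^ r) f).2).1 hz hw, ih f _ hzw]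
        rw [pow_succ, mul_comm z w, mul_assoc]
    have hpow : ∀ r, ((c • T) ^ r) ⟨f, hf⟩ = c ^ r • (T ^ r) ⟨f, hf⟩ := by
      intro r
      rw [_root_.smul_pow]
      rfl
    have hterm : ∀ i : ℕ × κ, (χ (w ^ i.1 * y i.2) : ℂ) * f (torusG (w ^ i.1 * y i.2)) =
        algebraMap k ℂ c ^ i.1 * ((χ (y i.2) : ℂ) *
          ((T ^ i.1) ⟨f, hf⟩ : GU p D → ℂ) (torusG (y i.2))) := by
      rintro ⟨r, i⟩
      simp only
      rw [hiter r ⟨f, hf⟩ (y i) (hy i), map_mul χ, map_pow χ, Units.val_mul,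
        Units.val_pow_eq_pow_val, hc, mul_assoc]
    have hexp : ∀ i : ℕ × κ, (unitNorm p D (w ^ i.1 * y i.2) : ℚ_[p]).valuation =
        ((m * i.1 : ℕ) : ℤ) + (unitNorm p D (y i.2) : ℚ_[p]).valuation := by
      intro i
      rw [unitNorm_valuation_pow_mul, hm]
      push_cast
      ring
    simp_rw [hterm, hexp]
    -- The factor `χ w ^ r` is absorbed into the endomorphism `c • T`. The step `m` of the exponent
    -- is the valuation of `Nm w`, positive because `‖Nm w‖ < 1`.
    have h5 : ∀ l : F →ₗ[k] k, RationalSum k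
        (fun r : ℕ => algebraMap k ℂ c ^ r * algebraMap k ℂ (l ((T ^ r) ⟨f, hf⟩)))
        fun r : ℕ => ((m * r : ℕ) : ℤ) := by
      intro l
      have h1 := rationalSum_end_pow (c • T) l ⟨f, hf⟩ hm0
      simp_rw [hpow, map_smul, smul_eq_mul, map_mul, map_pow] at h1
      exact h1
    exact RationalSum.of_coords (F := F) h5 (c := fun i => (χ (y i) : ℂ))
      (y := fun i => torusG (y i)) (e' := fun i => (unitNorm p D (y i) : ℚ_[p]).valuation) h

/-- The series over `ℚ_pˣ × E_pˣ`. -/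
theorem rationalSum_scalarG_torusG (hadm : IsAdmissible π) (hD : D ≠ 0) (hn : 1 ≤ n)
    (hψ : Continuous ψ) (hψ1 : ψ ≠ 1) (hΛ : IsWhittakerFunctional ψ π Λ) (χ : (Ep p D)ˣ →* ℂˣ)
    (hχ : ∀ x, (χ x : ℂ) ∈ (algebraMap k ℂ).range) {ι : Type} {x : ι → (Ep p D)ˣ}
    (hx : O.IsOrthantFamily x) {f : GU p D → ℂ} (hf : f ∈ algebraicCoefficients π Λ O n k)
    (η : ℂˣ) (hη : ∀ m : ℤ, ((η ^ m : ℂˣ) : ℂ) ∈ (algebraMap k ℂ).range) (φ : ℤ → ℂ)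
    (hφ : ∀ m, φ m ∈ (algebraMap k ℂ).range) {A B : ℤ} (hA : ∀ m < A, φ m = 0)
    (hB : ∀ m, B ≤ m → φ m = φ B) :
    RationalSum k (fun i : ℤ × ι => ((η ^ i.1 : ℂˣ) : ℂ) * φ i.1 *
        ((χ (x i.2) : ℂ) * f (torusG (x i.2) * scalarG (unitP p ^ i.1))))
      fun i => 2 * i.1 + (unitNorm p D (x i.2) : ℚ_[p]).valuation := by
  have := finiteDimensional_coefficientSpace (Λ := Λ) hadm (O.isOpen_congruence n)
  have hFfin : FiniteDimensional k (algebraicCoefficients π Λ O n k) :=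
    finiteDimensional_kValued k _
  have hFk : ∀ f ∈ algebraicCoefficients π Λ O n k, RationalSum k
      (fun i => (χ (x i) : ℂ) * f (torusG (x i)))
      fun i => (unitNorm p D (x i) : ℚ_[p]).valuation :=
    fun f hf => rationalSum_torusG hadm hD hn hψ hψ1 hΛ χ hχ hx hf
  have hFT : ∀ b : ℚ_[p]ˣ, ∀ f ∈ algebraicCoefficients π Λ O n k,
    (fun g => f (g * scalarG b)) ∈ algebraicCoefficients π Λ O n k :=
      fun b f hf => translate_scalarG_mem b hf
  generalize algebraicCoefficients π Λ O n k = F at *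
  let fm : ℤ → F := fun m => ⟨_, hFT (unitP p ^ m) f hf⟩
  suffices h5 : ∀ l : F →ₗ[k] k, RationalSum k
      (fun m : ℤ => ((η ^ m : ℂˣ) : ℂ) * φ m * algebraMap k ℂ (l (fm m))) fun m : ℤ => 2 * m from
    RationalSum.of_coords (F := F) h5 (c := fun i => (χ (x i) : ℂ))
      (y := fun i => torusG (x i)) (e' := fun i => (unitNorm p D (x i) : ℚ_[p]).valuation) hFk
  intro l
  set a : ℤ → ℂ := fun m : ℤ => ((η ^ m : ℂˣ) : ℂ) * φ m * algebraMap k ℂ (l (fm m)) with ha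
  -- Only finitely many terms below `B` are nonzero. From `B` on, `φ` is constant and the terms come
  -- from the powers of a single endomorphism.
  have hsplit : a = fun m => (if m < B then a m else 0) + (if B ≤ m then a m else 0) := by
    ext m
    by_cases h : m < B
    · simp [h]
    · simp [h, not_lt.1 h]
  rw [hsplit]
  refine RationalSum.add ?_ ?_
  · refine RationalSum.of_injective (g := (Subtype.val : Set.Ico A B → ℤ)) Subtype.val_injective
      ?_ (rationalSum_of_finite _ ?_)
    · intro m hm
      by_cases h : m < B
      · have : m < A := by
          by_contra h1
          exact hm ⟨⟨m, not_lt.1 h1, h⟩, rfl⟩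
        simp [ha, hA m this]
      · simp [h]
    · intro m
      rw [if_pos m.2.2]
      exact mul_mem (mul_mem (hη _) (hφ _)) ⟨_, rfl⟩
  · obtain ⟨c, hc⟩ := hη 1
    obtain ⟨c', hc'⟩ := mul_mem (hη B) (hφ B)
    rw [zpow_one] at hc
    -- Translation by the central element `p`. Each application raises the exponent of `X` by two.
    let Z : Module.End k F := (LinearMap.funLeft k ℂ fun g : GU p D => g * scalarG (unitP p)).restrict
      (hFT (unitP p))
    have hZ : ∀ r : ℕ, (Z ^ r) (fm B) = fm (B + r) := by
      intro r
      induction r with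
      | zero => simp
      | succ r ih =>
        rw [pow_succ', Module.End.mul_apply, ih]
        refine Subtype.ext (funext fun g => ?_)
        change f (g * scalarG (unitP p) * scalarG (unitP p ^ (B + (r : ℤ)))) =
          f (g * scalarG (unitP p ^ (B + ((r + 1 : ℕ) : ℤ))))
        rw [mul_assoc, ← map_mul, ← _root_.zpow_one_add]
        congr 4
        push_cast
        ring
    refine RationalSum.of_injective (g := fun r : ℕ => B + (r : ℤ)) (fun r s h => by simpa using h)
      ?_ ?_
    · intro m hm
      refine if_neg fun h => hm ⟨(m - B).toNat, ?_⟩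
      simp [h]
    · have h1 := ((rationalSum_end_pow (c • Z) l (fm B) two_pos).const_mul c').shift (2 * B)
      convert! h1 using 2 with r r
      · rw [if_pos (by omega), _root_.smul_pow, LinearMap.smul_apply, hZ, map_smul, smul_eq_mul,
          map_mul, map_pow, hc, hc', ha]
        simp only
        rw [hB _ (by omega), _root_.zpow_add, Units.val_mul, zpow_natCast, Units.val_pow_eq_pow_val]
        ring
      · push_cast
        ring

end TorusSeries

/-! ### The maximal compact subgroup and the Iwasawa decomposition of `H` -/

section Iwasawa

variable {p : ℕ} [hp : Fact p.Prime] {D : ℕ}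

theorem norm_mul_apply_le_one {A B : Matrix (Fin 2) (Fin 2) ℚ_[p]} (hA : ∀ i j, ‖A i j‖ ≤ 1)
    (hB : ∀ i j, ‖B i j‖ ≤ 1) (i j : Fin 2) : ‖(A * B) i j‖ ≤ 1 := by
  rw [Matrix.mul_apply, Fin.sum_univ_two]
  exact norm_add_le_one (norm_mul_le_one (hA _ _) (hB _ _)) (norm_mul_le_one (hA _ _) (hB _ _))

theorem norm_one_apply_le_one (i j : Fin 2) :
    ‖(1 : Matrix (Fin 2) (Fin 2) ℚ_[p]) i j‖ ≤ 1 := by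
  rw [Matrix.one_apply]
  split_ifs <;> simp

/-- The compact open subgroup of `H` of the pairs `(g, l)` with `g` in `GL₂(ℤ_p)` and `l` in `Oˣ`. -/
def LocalOrder.integralSubgroup (O : LocalOrder p D) : Subgroup (H p D) where
  carrier := {h | (∀ i j, ‖(h.g₁ : Matrix (Fin 2) (Fin 2) ℚ_[p]) i j‖ ≤ 1) ∧
    (∀ i j, ‖((h⁻¹).g₁ : Matrix (Fin 2) (Fin 2) ℚ_[p]) i j‖ ≤ 1) ∧ h.l ∈ O.unitGroup}
  one_mem' := ⟨norm_one_apply_le_one, by simp [norm_one_apply_le_one], one_mem _⟩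
  mul_mem' := by
    rintro g h ⟨h1, h2, h3⟩ ⟨h4, h5, h6⟩
    refine ⟨?_, ?_, mul_mem h3 h6⟩
    · rw [H.mul_g₁, Units.val_mul]
      exact norm_mul_apply_le_one h1 h4
    · rw [_root_.mul_inv_rev, H.mul_g₁, Units.val_mul]
      exact norm_mul_apply_le_one h5 h2
  inv_mem' := by
    rintro g ⟨h1, h2, h3⟩
    exact ⟨h2, by simpa using h1, inv_mem h3⟩

variable {O : LocalOrder p D}

theorem continuous_l : Continuous (H.l : H p D → (Ep p D)ˣ) :=
  continuous_snd.comp continuous_subtype_val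

theorem continuous_g₁ : Continuous (H.g₁ : H p D → GL (Fin 2) ℚ_[p]) :=
  continuous_fst.comp continuous_subtype_val

variable (p D) in
theorem isOpen_norm_entry_le_one :
    IsOpen {h : H p D | ∀ i j, ‖(h.g₁ : Matrix (Fin 2) (Fin 2) ℚ_[p]) i j‖ ≤ 1} := by
  simp_rw [Set.ofPred_forall]
  exact isOpen_iInter_of_finite fun i => isOpen_iInter_of_finite fun j =>
    isOpen_norm_le_one (continuous_entry p D i j)

variable (O) in
theorem LocalOrder.isOpen_integralSubgroup : IsOpen (O.integralSubgroup : Set (H p D)) :=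
  (isOpen_norm_entry_le_one p D).inter (((isOpen_norm_entry_le_one p D).preimage
    continuous_inv).inter (O.isOpen_unitGroup.preimage continuous_l))

theorem isClosedEmbedding_H : IsClosedEmbedding fun h : H p D =>
    (Units.embedProduct (Matrix (Fin 2) (Fin 2) ℚ_[p]) h.g₁, Units.embedProduct (Ep p D) h.l) :=
  (Units.isClosedEmbedding_embedProduct.prodMap Units.isClosedEmbedding_embedProduct).comp
    (isClosed_Hsub p D).isClosedEmbedding_subtypeVal

/-- A closed subset of `H` is compact if its elements and their inverses have integral entries and a
component in a fixed compact subset of `E_p`. -/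
theorem isCompact_of_subset {S : Set (H p D)} (hS : IsClosed S) {C : Set (Ep p D)} (hC : IsCompact C)
    (h : ∀ g ∈ S, (∀ i j, ‖(g.g₁ : Matrix (Fin 2) (Fin 2) ℚ_[p]) i j‖ ≤ 1) ∧
      (∀ i j, ‖((g⁻¹).g₁ : Matrix (Fin 2) (Fin 2) ℚ_[p]) i j‖ ≤ 1) ∧
      (g.l : Ep p D) ∈ C ∧ ((g⁻¹).l : Ep p D) ∈ C) : IsCompact S := by
  have hM : IsCompact {A : Matrix (Fin 2) (Fin 2) ℚ_[p] | ∀ i j, ‖A i j‖ ≤ 1} := by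
    have h : {A : Matrix (Fin 2) (Fin 2) ℚ_[p] | ∀ i j, ‖A i j‖ ≤ 1} =
        Set.pi Set.univ fun _ => Set.pi Set.univ fun _ => Metric.closedBall (0 : ℚ_[p]) 1 := by
      ext A
      exact ⟨fun h i _ j _ => mem_closedBall_zero_iff.2 (h i j),
        fun h i j => mem_closedBall_zero_iff.1 (h i trivial j trivial)⟩
    rw [h]
    exact isCompact_univ_pi fun _ => isCompact_univ_pi fun _ => isCompact_closedBall 0 1
  refine (isClosedEmbedding_H.isCompact_preimage
    ((hM.prod (MulOpposite.opHomeomorph.symm.isCompact_preimage.2 hM)).prod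
      (hC.prod (MulOpposite.opHomeomorph.symm.isCompact_preimage.2 hC)))).of_isClosed_subset hS ?_
  intro g hg
  obtain ⟨h1, h2, h3, h4⟩ := h g hg
  exact ⟨⟨h1, h2⟩, ⟨h3, h4⟩⟩

variable (O) in
theorem LocalOrder.isCompact_integralSubgroup : IsCompact (O.integralSubgroup : Set (H p D)) :=
  isCompact_of_subset (Subgroup.isClosed_of_isOpen _ O.isOpen_integralSubgroup) O.isCompact
    fun _ hg => ⟨hg.1, hg.2.1, hg.2.2.1, hg.2.2.2⟩

theorem LocalOrder.norm_det_eq_one {h : H p D} (hh : h ∈ O.integralSubgroup) :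
    ‖(h.g₁ : Matrix (Fin 2) (Fin 2) ℚ_[p]).det‖ = 1 := by
  rw [h.det_eq]
  exact O.norm_unitNorm_eq_one hh.2.2

theorem LocalOrder.star_mem_unitGroup {u : (Ep p D)ˣ} (hu : u ∈ O.unitGroup) :
    star u ∈ O.unitGroup :=
  ⟨O.star_mem _ hu.1, O.star_mem _ hu.2⟩

theorem LocalOrder.scalarUnit_mem_unitGroup {b : ℚ_[p]ˣ} (hb : ‖(b : ℚ_[p])‖ = 1) :
    scalarUnit p D b ∈ O.unitGroup := by
  rw [mem_unitGroup, ← map_inv]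
  refine ⟨O.algebraMap_mem _ hb.le, ?_⟩
  refine O.algebraMap_mem _ ?_
  rw [Units.val_inv_eq_inv_val, norm_inv, hb, inv_one]

theorem u₂_mem_integralSubgroup {ξ : ℚ_[p]} (hξ : ‖ξ‖ ≤ 1) : u₂ ξ ∈ O.integralSubgroup := by
  have key : ∀ ξ : ℚ_[p], ‖ξ‖ ≤ 1 → ∀ i j,
      ‖((u₂ ξ : H p D).g₁ : Matrix (Fin 2) (Fin 2) ℚ_[p]) i j‖ ≤ 1 := by
    intro ξ hξ i j
    rw [u₂_g₁]
    fin_cases i <;> fin_cases j <;> simp [hξ]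
  refine ⟨key ξ hξ, ?_, one_mem _⟩
  rw [u₂_inv]
  exact key _ (by rwa [norm_neg])

theorem torus_mem_integralSubgroup {b : ℚ_[p]ˣ} {x : (Ep p D)ˣ} (hb : ‖(b : ℚ_[p])‖ = 1)
    (hx : x ∈ O.unitGroup) : torus (b, x) ∈ O.integralSubgroup := by
  have key : ∀ {b : ℚ_[p]ˣ} {x : (Ep p D)ˣ}, ‖(b : ℚ_[p])‖ = 1 → x ∈ O.unitGroup → ∀ i j,
      ‖((torus (b, x)).g₁ : Matrix (Fin 2) (Fin 2) ℚ_[p]) i j‖ ≤ 1 := by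
    intro b x hb hx i j
    have h1 := O.norm_unitNorm_eq_one hx
    rw [val_unitNorm] at h1
    rw [torus_g₁]
    fin_cases i <;> fin_cases j <;> simp [hb, h1]
  refine ⟨key hb hx, ?_, mul_mem (O.scalarUnit_mem_unitGroup hb) (O.star_mem_unitGroup hx)⟩
  rw [← map_inv]
  refine key ?_ (inv_mem hx)
  change ‖((b⁻¹ : ℚ_[p]ˣ) : ℚ_[p])‖ = 1
  rw [Units.val_inv_eq_inv_val, norm_inv, hb, inv_one]

theorem u₂_mul_torus_mem_integralSubgroup {b : ℚ_[p]ˣ} {x : (Ep p D)ˣ} {ξ : ℚ_[p]} :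
    u₂ ξ * torus (b, x) ∈ O.integralSubgroup ↔
      ‖(b : ℚ_[p])‖ = 1 ∧ x ∈ O.unitGroup ∧ ‖ξ‖ ≤ 1 := by
  constructor
  · rintro ⟨h1, h2, h3⟩
    have h4 := h1 1 1
    have h5 := h2 1 1
    have h6 := h1 0 1
    rw [_root_.mul_inv_rev, u₂_inv, ← map_inv, H.mul_g₁, Units.val_mul, u₂_g₁, Prod.inv_mk,
      torus_g₁] at h5
    rw [H.mul_g₁, Units.val_mul, u₂_g₁, torus_g₁] at h4 h6
    simp [Matrix.mul_apply] at h4 h5 h6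
    have h7 : ‖(b : ℚ_[p])‖ = 1 := by
      refine le_antisymm h4 ?_
      rwa [inv_le_one₀ (norm_pos_iff.2 b.ne_zero)] at h5
    rw [h7, mul_one] at h6
    refine ⟨h7, ?_, h6⟩
    rw [H.mul_l, u₂_l, one_mul, torus_l'] at h3
    have h8 := O.star_mem_unitGroup
      ((Subgroup.mul_mem_cancel_left _ (O.scalarUnit_mem_unitGroup h7)).1 h3)
    rwa [star_star] at h8
  · rintro ⟨h1, h2, h3⟩
    exact mul_mem (u₂_mem_integralSubgroup h3) (torus_mem_integralSubgroup h1 h2)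

theorem u₂_mul_torus (b : ℚ_[p]ˣ) (x : (Ep p D)ˣ) (ξ : ℚ_[p]) :
    u₂ ξ * torus (b, x) = torus (b, x) * u₂ (ξ / (unitNorm p D x : ℚ_[p])) := by
  refine H.ext (Units.ext ?_) ?_
  · have h := (unitNorm p D x).ne_zero
    rw [val_unitNorm] at h
    rw [H.mul_g₁, H.mul_g₁, Units.val_mul, Units.val_mul, torus_g₁, u₂_g₁, u₂_g₁, val_unitNorm]
    ext i j
    fin_cases i <;> fin_cases j <;> simp [Matrix.mul_apply]
    field_simp
  · rw [H.mul_l, H.mul_l, u₂_l, u₂_l, one_mul, mul_one]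

theorem torus_inv_mul_mem_integralSubgroup {b b' : ℚ_[p]ˣ} {x x' : (Ep p D)ˣ} {ξ : ℚ_[p]} :
    (torus (b', x'))⁻¹ * (u₂ ξ * torus (b, x)) ∈ O.integralSubgroup ↔
      ‖(b : ℚ_[p])‖ = ‖(b' : ℚ_[p])‖ ∧ x'⁻¹ * x ∈ O.unitGroup ∧
        ‖ξ‖ ≤ ‖(unitNorm p D x' : ℚ_[p])‖ := by
  have h1 : (torus (b', x'))⁻¹ * (u₂ ξ * torus (b, x)) =
      u₂ (ξ / (unitNorm p D x' : ℚ_[p])) * torus (b'⁻¹ * b, x'⁻¹ * x) := by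
    have h2 := u₂_mul_torus b' x' ξ
    rw [← inv_mul_eq_iff_eq_mul, ← mul_assoc, ← eq_mul_inv_iff_mul_eq] at h2
    rw [← mul_assoc, h2, mul_assoc, ← map_inv, ← map_mul]
    rfl
  rw [h1, u₂_mul_torus_mem_integralSubgroup, Units.val_mul, Units.val_inv_eq_inv_val, norm_mul,
    norm_inv, norm_div, inv_mul_eq_one₀ (norm_ne_zero_iff.2 b'.ne_zero),
    div_le_one (norm_pos_iff.2 (Units.ne_zero _)), eq_comm]

/-- The element of `H` given by a matrix of determinant `1`. -/
def specialElement (a b c d : ℚ_[p]) (h : a * d - b * c = 1) : H p D :=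
  ⟨(⟨!![a, b; c, d], !![d, -b; -c, a],
      by rw [Matrix.mul_fin_two, Matrix.one_fin_two, ← h]; ring_nf,
      by rw [Matrix.mul_fin_two, Matrix.one_fin_two, ← h]; ring_nf⟩, 1), by
    change Matrix.det !![a, b; c, d] = QuadraticAlgebra.norm (1 : Ep p D)
    rw [Matrix.det_fin_two_of, h, map_one]⟩

theorem specialElement_g₁ {a b c d : ℚ_[p]} (h : a * d - b * c = 1) :
    ((specialElement a b c d h : H p D).g₁ : Matrix (Fin 2) (Fin 2) ℚ_[p]) = !![a, b; c, d] := rfl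

theorem specialElement_mem {a b c d : ℚ_[p]} (h : a * d - b * c = 1) (ha : ‖a‖ ≤ 1) (hb : ‖b‖ ≤ 1)
    (hc : ‖c‖ ≤ 1) (hd : ‖d‖ ≤ 1) : specialElement a b c d h ∈ O.integralSubgroup := by
  refine ⟨?_, ?_, one_mem _⟩
  · rw [specialElement_g₁]
    intro i j
    fin_cases i <;> fin_cases j <;> simpa
  · intro i j
    change ‖!![d, -b; -c, a] i j‖ ≤ 1
    fin_cases i <;> fin_cases j <;> simpa

variable (O) in
-- A column operation clears the lower left entry, and dividing by the larger of the two bottom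
-- entries keeps it integral.
theorem exists_upper_triangular (h : H p D) : ∃ κ ∈ O.integralSubgroup,
    ((h * κ).g₁ : Matrix (Fin 2) (Fin 2) ℚ_[p]) 1 0 = 0 := by
  set c := (h.g₁ : Matrix (Fin 2) (Fin 2) ℚ_[p]) 1 0 with hc
  set d := (h.g₁ : Matrix (Fin 2) (Fin 2) ℚ_[p]) 1 1 with hd
  rcases le_or_gt ‖c‖ ‖d‖ with hcd | hcd
  · refine ⟨specialElement 1 0 (-(c / d)) 1 (by ring), specialElement_mem _ (by simp) (by simp) ?_
      (by simp), ?_⟩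
    · rw [norm_neg, norm_div]
      exact div_le_one_of_le₀ hcd (norm_nonneg _)
    · rw [H.mul_g₁, Units.val_mul, specialElement_g₁, Matrix.mul_apply, Fin.sum_univ_two, ← hc, ← hd]
      -- Here `‖c‖ ≤ ‖d‖` forces `c = 0`, so the default value of `c / 0` does no harm.
      by_cases h0 : d = 0
      · have : c = 0 := by simpa [h0] using hcd
        simp [this]
      · simp
        field_simp
        ring
  · have h0 : c ≠ 0 := by
      rintro h0
      rw [h0, norm_zero] at hcd
      exact absurd hcd (not_lt.2 (norm_nonneg _))
    refine ⟨specialElement (-(d / c)) (-1) 1 0 (by ring), specialElement_mem _ ?_ (by simp) (by simp)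
      (by simp), ?_⟩
    · rw [norm_neg, norm_div]
      exact div_le_one_of_le₀ hcd.le (norm_nonneg _)
    · rw [H.mul_g₁, Units.val_mul, specialElement_g₁, Matrix.mul_apply, Fin.sum_univ_two, ← hc, ← hd]
      simp
      field_simp
      ring

/-- With diagonal entries `a` and `b`, the relation `a * b = Nm l` says that `a / b` is the norm of
`l / b`. So `x` is the conjugate of `l / b`. -/
theorem exists_eq_u₂_mul_torus {h : H p D}
    (h0 : (h.g₁ : Matrix (Fin 2) (Fin 2) ℚ_[p]) 1 0 = 0) :
    ∃ (ξ : ℚ_[p]) (b : ℚ_[p]ˣ) (x : (Ep p D)ˣ), h = u₂ ξ * torus (b, x) := by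
  have hdet := h.det_eq
  rw [Matrix.det_fin_two, h0, mul_zero, sub_zero] at hdet
  have hN : QuadraticAlgebra.norm (h.l : Ep p D) ≠ 0 := (unitNorm p D h.l).ne_zero
  have hd : (h.g₁ : Matrix (Fin 2) (Fin 2) ℚ_[p]) 1 1 ≠ 0 := by
    intro hd
    rw [hd, mul_zero] at hdet
    exact hN hdet.symm
  set b : ℚ_[p]ˣ := Units.mk0 _ hd with hb
  refine ⟨(h.g₁ : Matrix (Fin 2) (Fin 2) ℚ_[p]) 0 1 / b, b, star ((scalarUnit p D b)⁻¹ * h.l), ?_⟩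
  refine H.ext (Units.ext ?_) ?_
  · have h2 : (b : ℚ_[p]) * QuadraticAlgebra.norm
        ((star ((scalarUnit p D b)⁻¹ * h.l) : (Ep p D)ˣ) : Ep p D) =
        (h.g₁ : Matrix (Fin 2) (Fin 2) ℚ_[p]) 0 0 := by
      rw [Units.coe_star, QuadraticAlgebra.norm_star, Units.val_mul, map_mul, ← hdet, ← map_inv,
        val_scalarUnit, QuadraticAlgebra.norm_algebraMap, Units.val_inv_eq_inv_val, hb,
        Units.val_mk0]
      field_simp
    rw [H.mul_g₁, Units.val_mul, torus_g₁, u₂_g₁, h2]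
    ext i j
    fin_cases i <;> fin_cases j <;> simp [Matrix.mul_apply, h0, hb, hd]
  · rw [H.mul_l, u₂_l, one_mul, torus_l', star_star, mul_inv_cancel_left]

variable {ι : Type} {x : ι → (Ep p D)ˣ}

/-- The representatives of the double cosets of `H` by the upper triangular unipotent subgroup and
the maximal compact subgroup. -/
def torusPoint (x : ι → (Ep p D)ˣ) (q : ℤ × ι) : H p D := torus (unitP p ^ q.1, x q.2)

theorem norm_unitP_zpow (m : ℤ) : ‖((unitP p ^ m : ℚ_[p]ˣ) : ℚ_[p])‖ = (p : ℝ) ^ (-m) := by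
  rw [Units.val_zpow_eq_zpow_val, val_unitP, Padic.norm_p_zpow]

/-- After triangularisation, the unit parts of `b` and of `x` are moved into the compact group. -/
theorem exists_iwasawa (hx : O.IsTransversal x) (h : H p D) :
    ∃ (ξ : ℚ_[p]) (q : ℤ × ι), ∃ κ ∈ O.integralSubgroup, h = u₂ ξ * torusPoint x q * κ := by
  obtain ⟨κ, hκ, h0⟩ := exists_upper_triangular O h
  obtain ⟨ξ, b, y, hb⟩ := exists_eq_u₂_mul_torus h0
  obtain ⟨i, hi, -⟩ := hx y
  have hp1 : (p : ℝ) ≠ 0 := by exact_mod_cast hp.out.ne_zero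
  have h1 : torus (unitP p ^ (b : ℚ_[p]).valuation, x i) *
      torus ((unitP p ^ (b : ℚ_[p]).valuation)⁻¹ * b, (x i)⁻¹ * y) = torus (b, y) := by
    rw [← map_mul, Prod.mk_mul_mk, mul_inv_cancel_left, mul_inv_cancel_left]
  refine ⟨ξ, ((b : ℚ_[p]).valuation, i),
    torus ((unitP p ^ (b : ℚ_[p]).valuation)⁻¹ * b, (x i)⁻¹ * y) * κ⁻¹,
    mul_mem (torus_mem_integralSubgroup ?_ hi) (inv_mem hκ), ?_⟩
  · rw [Units.val_mul, Units.val_inv_eq_inv_val, norm_mul, norm_inv, norm_unitP_zpow,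
      Padic.norm_eq_zpow_neg_valuation b.ne_zero, inv_mul_cancel₀ (zpow_ne_zero _ hp1)]
  · rw [eq_comm, ← mul_assoc, mul_inv_eq_iff_eq_mul, hb, ← h1, mul_assoc]
    rfl

/-- Distinct `q` give disjoint double cosets, and the `ξ` that keep `torusPoint x q` in its coset of
the compact group form a ball of radius `‖Nm x‖`. This radius is the origin of `weight`. -/
theorem torusPoint_inv_mul_mem (hx : O.IsTransversal x) {q q' : ℤ × ι} {ξ : ℚ_[p]} :
    (torusPoint x q')⁻¹ * (u₂ ξ * torusPoint x q) ∈ O.integralSubgroup ↔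
      q' = q ∧ ‖ξ‖ ≤ ‖(unitNorm p D (x q.2) : ℚ_[p])‖ := by
  rw [torusPoint, torusPoint, torus_inv_mul_mem_integralSubgroup, norm_unitP_zpow, norm_unitP_zpow,
    zpow_right_inj₀ (by exact_mod_cast hp.out.pos) (by exact_mod_cast hp.out.one_lt.ne'), neg_inj]
  constructor
  · rintro ⟨h1, h2, h3⟩
    have h4 : q'.2 = q.2 := (hx (x q.2)).unique h2 (by rw [inv_mul_cancel]; exact one_mem _)
    exact ⟨Prod.ext h1.symm h4, h4 ▸ h3⟩
  · rintro ⟨rfl, h⟩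
    exact ⟨rfl, by rw [inv_mul_cancel]; exact one_mem _, h⟩

end Iwasawa

/-! ### Measures of balls and of compact open subgroups -/

section Measures

variable {p : ℕ} [hp : Fact p.Prime] {D : ℕ}

theorem haarQp_closedBall_eq (y z : ℚ_[p]) (r : ℝ) :
    haarQp p (Metric.closedBall y r) = haarQp p (Metric.closedBall z r) := by
  have h : (fun x => x + (z - y)) ⁻¹' Metric.closedBall z r = Metric.closedBall y r := by
    ext x
    simp only [Set.mem_preimage, Metric.mem_closedBall, dist_eq_norm]
    congr! 2
    ring
  rw [← h, measure_preimage_add_right]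

/-- The smaller balls are indexed by the residue modulo `p` of the `p`-adic integer `x / a`. -/
theorem closedBall_eq_iUnion {a : ℚ_[p]} (ha : a ≠ 0) : Metric.closedBall 0 ‖a‖ =
    ⋃ i : Fin p, Metric.closedBall ((i : ℕ) * a) ‖(p : ℚ_[p]) * a‖ := by
  ext x
  simp only [Set.mem_iUnion, Metric.mem_closedBall, dist_eq_norm, sub_zero]
  constructor
  · intro hx
    have h1 : ‖x / a‖ ≤ 1 := by
      rw [norm_div]
      exact div_le_one_of_le₀ hx (norm_nonneg _)
    obtain ⟨z, hz⟩ : ∃ z : ℤ_[p], (z : ℚ_[p]) = x / a := ⟨⟨x / a, h1⟩, rfl⟩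
    obtain ⟨n, hn, hmem⟩ := PadicInt.exists_mem_range z
    refine ⟨⟨n, hn⟩, ?_⟩
    rw [PadicInt.maximalIdeal_eq_span_p, Ideal.mem_span_singleton] at hmem
    obtain ⟨c, hc⟩ := hmem
    have h2 := congr_arg (fun z : ℤ_[p] => (z : ℚ_[p])) hc
    simp only [PadicInt.coe_sub, PadicInt.coe_mul, PadicInt.coe_natCast, hz] at h2
    have h3 : x - n * a = p * c * a := by
      rw [← h2, sub_mul, div_mul_cancel₀ _ ha]
    rw [h3, mul_right_comm, norm_mul]
    exact mul_le_of_le_one_right (norm_nonneg _) c.2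
  · rintro ⟨i, hi⟩
    have h1 : ‖((i : ℕ) : ℚ_[p])‖ ≤ 1 := by
      exact_mod_cast Padic.norm_int_le_one (p := p) ((i : ℕ) : ℤ)
    have h2 : ‖(p : ℚ_[p]) * a‖ ≤ ‖a‖ := by
      rw [norm_mul]
      exact mul_le_of_le_one_left (norm_nonneg _) Padic.norm_p_lt_one.le
    have h3 : ‖((i : ℕ) : ℚ_[p]) * a‖ ≤ ‖a‖ := by
      rw [norm_mul]
      exact mul_le_of_le_one_left (norm_nonneg _) h1
    have h4 := Padic.nonarchimedean (x - ((i : ℕ) : ℚ_[p]) * a) (((i : ℕ) : ℚ_[p]) * a)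
    rw [sub_add_cancel] at h4
    exact h4.trans (max_le (hi.trans h2) h3)

theorem pairwiseDisjoint_closedBall {a : ℚ_[p]} (ha : a ≠ 0) : Pairwise
    (Function.onFun Disjoint fun i : Fin p => Metric.closedBall ((i : ℕ) * a) ‖(p : ℚ_[p]) * a‖) := by
  intro i j hij
  refine Set.disjoint_left.2 fun x hx hy => hij ?_
  rw [Metric.mem_closedBall, dist_eq_norm] at hx hy
  have h1 : ‖(((i : ℕ) : ℚ_[p]) - ((j : ℕ) : ℚ_[p])) * a‖ ≤ ‖(p : ℚ_[p]) * a‖ := by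
    have h2 := Padic.nonarchimedean (x - ((j : ℕ) : ℚ_[p]) * a) (-(x - ((i : ℕ) : ℚ_[p]) * a))
    rw [norm_neg] at h2
    rw [show (((i : ℕ) : ℚ_[p]) - ((j : ℕ) : ℚ_[p])) * a =
      x - ((j : ℕ) : ℚ_[p]) * a + -(x - ((i : ℕ) : ℚ_[p]) * a) by ring]
    exact h2.trans (max_le hy hx)
  rw [norm_mul, norm_mul, mul_le_mul_iff_left₀ (norm_pos_iff.2 ha)] at h1
  have h2 : ‖(((i : ℕ) - (j : ℕ) : ℤ) : ℚ_[p])‖ < 1 := by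
    push_cast
    exact h1.trans_lt Padic.norm_p_lt_one
  rw [Padic.norm_intCast_lt_one_iff] at h2
  obtain ⟨c, hc⟩ := h2
  have hi := i.2
  have hj := j.2
  have hc0 : c = 0 := by
    by_contra h0
    rcases lt_or_gt_of_ne h0 with h | h
    · have : (p : ℤ) * c ≤ (p : ℤ) * (-1) := by gcongr; omega
      omega
    · have : (p : ℤ) * 1 ≤ (p : ℤ) * c := by gcongr; omega
      omega
  rw [hc0, mul_zero] at hc
  exact Fin.ext (by omega)

theorem haarQp_closedBall_norm_eq_mul {a : ℚ_[p]} (ha : a ≠ 0) :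
    haarQp p (Metric.closedBall 0 ‖a‖) = p * haarQp p (Metric.closedBall 0 ‖(p : ℚ_[p]) * a‖) := by
  rw [closedBall_eq_iUnion ha, measure_iUnion (pairwiseDisjoint_closedBall ha)
    fun i => Metric.isClosed_closedBall.measurableSet, tsum_fintype]
  simp_rw [haarQp_closedBall_eq _ (0 : ℚ_[p])]
  simp

/-- The volume of a ball in `ℚ_p` is its radius. -/
theorem haarQp_closedBall_norm (y : ℚ_[p]) {a : ℚ_[p]} (ha : a ≠ 0) :
    haarQp p (Metric.closedBall y ‖a‖) = ENNReal.ofReal ‖a‖ := by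
  have hp0 : (p : ℝ) ≠ 0 := by exact_mod_cast hp.out.ne_zero
  have hp1 : (0 : ℝ) < p := by exact_mod_cast hp.out.pos
  have hcast : (p : ℝ≥0∞) = ENNReal.ofReal (p : ℝ) := by simp
  have hstep : ∀ m : ℤ, haarQp p (Metric.closedBall 0 ((p : ℝ) ^ (-m))) =
      p * haarQp p (Metric.closedBall 0 ((p : ℝ) ^ (-(m + 1)))) := by
    intro m
    have h := haarQp_closedBall_norm_eq_mul (p := p)
      (zpow_ne_zero m (natCast_prime_ne_zero p))
    rwa [← zpow_one_add₀ (natCast_prime_ne_zero p), Padic.norm_p_zpow,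
      Padic.norm_p_zpow, add_comm] at h
  have hpow : ∀ m : ℤ, ENNReal.ofReal ((p : ℝ) ^ (-m)) =
      p * ENNReal.ofReal ((p : ℝ) ^ (-(m + 1))) := by
    intro m
    rw [hcast, ← ENNReal.ofReal_mul hp1.le, ← zpow_one_add₀ hp0]
    congr 2
    ring
  have key : ∀ m : ℤ, haarQp p (Metric.closedBall 0 ((p : ℝ) ^ (-m))) =
      ENNReal.ofReal ((p : ℝ) ^ (-m)) := by
    intro m
    have hpE : (p : ℝ≥0∞) ≠ 0 := by exact_mod_cast hp.out.ne_zero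
    -- Both sides are scaled by `p` from one radius to the next, so the normalisation on `ℤ_p`
    -- determines all radii, larger and smaller.
    induction m using Int.induction_on with
    | zero => simpa using haarQp_closedBall p 0
    | succ m ih =>
      rw [hstep, hpow] at ih
      exact (ENNReal.mul_right_inj hpE (ENNReal.natCast_ne_top p)).1 ih
    | pred m ih =>
      rw [hstep, hpow, show -(m : ℤ) - 1 + 1 = -m by ring, ih]
  rw [haarQp_closedBall_eq y 0, Padic.norm_eq_zpow_neg_valuation ha, key]

variable {G : Type*} [Group G]

theorem existsUnique_out_inv_mul_mem {K L : Subgroup G} {g : G} (hg : g ∈ K) :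
    ∃! j : K ⧸ L.subgroupOf K, ((j.out : K) : G)⁻¹ * g ∈ L := by
  have key : ∀ j : K ⧸ L.subgroupOf K, ((j.out : K) : G)⁻¹ * g ∈ L ↔
      j = QuotientGroup.mk (⟨g, hg⟩ : K) := by
    intro j
    conv_rhs => rw [← QuotientGroup.out_eq' j]
    rw [QuotientGroup.eq, Subgroup.mem_subgroupOf]
    rfl
  simp_rw [key]
  exact existsUnique_eq

theorem sum_indicator_out {K L : Subgroup G} (hLK : L ≤ K) [Fintype (K ⧸ L.subgroupOf K)] (g : G) :
    ∑ j : K ⧸ L.subgroupOf K, (L : Set G).indicator (1 : G → ℝ≥0∞) (((j.out : K) : G)⁻¹ * g) =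
      (K : Set G).indicator 1 g := by
  classical
  by_cases hg : g ∈ K
  · obtain ⟨j, hj, huniq⟩ := existsUnique_out_inv_mul_mem (L := L) hg
    rw [Finset.sum_eq_single_of_mem j (Finset.mem_univ j), Set.indicator_of_mem hj,
      Set.indicator_of_mem (SetLike.mem_coe.2 hg), Pi.one_apply, Pi.one_apply]
    intro i _ hi
    exact Set.indicator_of_notMem (fun h => hi (huniq i h)) _
  · rw [Set.indicator_of_notMem (SetLike.mem_coe.not.2 hg)]
    refine Finset.sum_eq_zero fun j _ => Set.indicator_of_notMem (fun h => hg ?_) _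
    have := mul_mem (j.out : K).2 (hLK h)
    rwa [mul_inv_cancel_left] at this

/-- `K` is the disjoint union of left translates of `L`, all of the same measure. -/
theorem measure_eq_card_mul [TopologicalSpace G] [IsTopologicalGroup G] [MeasurableSpace G]
    [BorelSpace G] (μ : Measure G) [μ.IsMulLeftInvariant] {K L : Subgroup G} (hLK : L ≤ K)
    [Fintype (K ⧸ L.subgroupOf K)] (hL : IsOpen (L : Set G)) (hK : IsOpen (K : Set G)) :
    μ K = Fintype.card (K ⧸ L.subgroupOf K) * μ L := by
  rw [← lintegral_indicator_one hK.measurableSet]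
  simp_rw [← sum_indicator_out hLK]
  have hm : Measurable ((L : Set G).indicator (1 : G → ℝ≥0∞)) :=
    measurable_one.indicator hL.measurableSet
  rw [lintegral_finsetSum Finset.univ (f := fun (j : K ⧸ L.subgroupOf K) g =>
    (L : Set G).indicator (1 : G → ℝ≥0∞) (((j.out : K) : G)⁻¹ * g))
    fun j _ => hm.comp (continuous_const_mul _).measurable]
  simp_rw [lintegral_mul_left_eq_self (μ := μ) (fun g => (L : Set G).indicator (1 : G → ℝ≥0∞) g),
    lintegral_indicator_one hL.measurableSet]
  simp

theorem finite_quotient_of_isOpen_of_isCompact [TopologicalSpace G] [IsTopologicalGroup G]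
    {K L : Subgroup G} (hK : IsCompact (K : Set G)) (hL : IsOpen (L : Set G)) :
    Finite (K ⧸ L.subgroupOf K) := by
  have : CompactSpace K := isCompact_iff_compactSpace.1 hK
  exact Subgroup.quotient_finite_of_isOpen _ (hL.preimage continuous_subtype_val)

/-- The volumes of two compact open subgroups are commensurable. -/
theorem exists_measure_eq_mul [TopologicalSpace G] [IsTopologicalGroup G] [MeasurableSpace G]
    [BorelSpace G] (μ : Measure G) [μ.IsMulLeftInvariant] {K L : Subgroup G}
    (hK : IsOpen (K : Set G)) (hK' : IsCompact (K : Set G)) (hL : IsOpen (L : Set G))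
    (hL' : IsCompact (L : Set G)) :
    ∃ m n : ℕ, m ≠ 0 ∧ n ≠ 0 ∧ m * μ K = n * μ L := by
  have h : IsOpen ((K ⊓ L : Subgroup G) : Set G) := hK.inter hL
  have h1 := finite_quotient_of_isOpen_of_isCompact hK' h
  have h2 := finite_quotient_of_isOpen_of_isCompact hL' h
  cases nonempty_fintype (K ⧸ (K ⊓ L).subgroupOf K)
  cases nonempty_fintype (L ⧸ (K ⊓ L).subgroupOf L)
  refine ⟨Fintype.card (L ⧸ (K ⊓ L).subgroupOf L), Fintype.card (K ⧸ (K ⊓ L).subgroupOf K),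
    Fintype.card_ne_zero, Fintype.card_ne_zero, ?_⟩
  rw [measure_eq_card_mul μ inf_le_left h hK, measure_eq_card_mul μ inf_le_right h hL]
  ring

end Measures

/-! ### The Haar measure on `H` -/

section HaarOnH

variable {p : ℕ} [hp : Fact p.Prime] {D : ℕ}

variable (p D) in
/-- The subgroup `H(ℤ_p)`. -/
def integralPoints : Subgroup (H p D) where
  carrier := Hint p D
  one_mem' := ⟨norm_one_apply_le_one, by simp [norm_one_apply_le_one], isIntegral_one,
    by simpa using isIntegral_one⟩
  mul_mem' := by
    rintro g h ⟨h1, h2, h3, h4⟩ ⟨h5, h6, h7, h8⟩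
    refine ⟨?_, ?_, ?_, ?_⟩
    · rw [H.mul_g₁, Units.val_mul]
      exact norm_mul_apply_le_one h1 h5
    · rw [H.mul_g₁, _root_.mul_inv_rev, Units.val_mul]
      exact norm_mul_apply_le_one h6 h2
    · rw [H.mul_l, Units.val_mul]
      exact h3.mul h7
    · rw [H.mul_l, _root_.mul_inv_rev, Units.val_mul]
      exact h8.mul h4
  inv_mem' := by
    rintro g ⟨h1, h2, h3, h4⟩
    exact ⟨h2, by simpa using h1, h4, by simpa using h3⟩

theorem isIntegral_omega : IsIntegral ℤ_[p] (QuadraticAlgebra.omega : Ep p D) := by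
  refine IsIntegral.of_pow two_pos ?_
  have h : (QuadraticAlgebra.omega : Ep p D) ^ 2 = algebraMap ℤ_[p] (Ep p D) (-(D : ℤ_[p])) := by
    rw [IsScalarTower.algebraMap_apply ℤ_[p] ℚ_[p], pow_two]
    ext <;> simp
  rw [h]
  exact isIntegral_algebraMap

theorem isIntegral_of_norm_le_one {a : ℚ_[p]} (ha : ‖a‖ ≤ 1) :
    IsIntegral ℤ_[p] (algebraMap ℚ_[p] (Ep p D) a) := by
  obtain ⟨z, rfl⟩ : ∃ z : ℤ_[p], algebraMap ℤ_[p] ℚ_[p] z = a := ⟨⟨a, ha⟩, rfl⟩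
  rw [← IsScalarTower.algebraMap_apply ℤ_[p] ℚ_[p]]
  exact isIntegral_algebraMap

theorem norm_le_one_of_isIntegral {a : ℚ_[p]}
    (ha : IsIntegral ℤ_[p] (algebraMap ℚ_[p] (Ep p D) a)) : ‖a‖ ≤ 1 := by
  have h1 : IsIntegral ℤ_[p] a :=
    (isIntegral_algHom_iff (IsScalarTower.toAlgHom ℤ_[p] ℚ_[p] (Ep p D))
      (algebraMap ℚ_[p] (Ep p D)).injective).1 ha
  obtain ⟨z, rfl⟩ := IsIntegrallyClosed.isIntegral_iff.1 h1
  exact z.2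

theorem isIntegral_star {x : Ep p D} (hx : IsIntegral ℤ_[p] x) : IsIntegral ℤ_[p] (star x) := by
  obtain ⟨f, hf, h0⟩ := hx
  refine ⟨f, hf, ?_⟩
  have h1 := congr_arg (starRingEnd (Ep p D)) h0
  rw [map_zero, Polynomial.hom_eval₂] at h1
  convert! h1 using 2
  ext a <;>
  · rw [RingHom.comp_apply, IsScalarTower.algebraMap_apply ℤ_[p] ℚ_[p], starRingEnd_apply]
    simp

theorem isOpen_isIntegral : IsOpen {x : Ep p D | IsIntegral ℤ_[p] x} := by
  refine AddSubgroup.isOpen_of_mem_nhds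
    (integralClosure ℤ_[p] (Ep p D)).toSubring.toAddSubgroup (g := 0) ?_
  have h1 : IsOpen ({x : Ep p D | ‖x.re‖ ≤ 1} ∩ {x : Ep p D | ‖x.im‖ ≤ 1}) :=
    (isOpen_norm_le_one (continuous_re p D)).inter (isOpen_norm_le_one (continuous_im p D))
  refine mem_of_superset (h1.mem_nhds ⟨by simp, by simp⟩) ?_
  rintro x ⟨h2, h3⟩
  have h4 : x = algebraMap ℚ_[p] (Ep p D) x.re +
      algebraMap ℚ_[p] (Ep p D) x.im * QuadraticAlgebra.omega := by
    ext <;> simp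
  change IsIntegral ℤ_[p] x
  rw [h4]
  exact (isIntegral_of_norm_le_one h2).add ((isIntegral_of_norm_le_one h3).mul isIntegral_omega)

variable (p) in
-- Integral elements have integral traces, and `2 * re` and `2 * D * im` are the traces of `x` and
-- of `δ * star x`. This bounds both coordinates without a description of the maximal order.
theorem exists_isCompact_isIntegral (hD : D ≠ 0) :
    ∃ C : Set (Ep p D), IsCompact C ∧ ∀ x, IsIntegral ℤ_[p] x → x ∈ C := by
  have hD' : (D : ℚ_[p]) ≠ 0 := by exact_mod_cast hD
  refine ⟨equivProdHomeo p D ⁻¹' (Metric.closedBall 0 ‖(2 : ℚ_[p])⁻¹‖ ×ˢ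
    Metric.closedBall 0 ‖(2 * D : ℚ_[p])⁻¹‖), (equivProdHomeo p D).isCompact_preimage.2
      ((isCompact_closedBall _ _).prod (isCompact_closedBall _ _)), fun x hx => ?_⟩
  have h1 : ‖2 * x.re‖ ≤ 1 := by
    refine norm_le_one_of_isIntegral (D := D) ?_
    have h2 := hx.add (isIntegral_star hx)
    convert! h2 using 1
    ext <;> simp
    ring
  have h3 : ‖2 * D * x.im‖ ≤ 1 := by
    refine norm_le_one_of_isIntegral (D := D) ?_
    have h2 := isIntegral_omega.mul ((isIntegral_star hx).sub hx)
    convert! h2 using 1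
    ext <;> simp
    ring
  refine ⟨mem_closedBall_zero_iff.2 ?_, mem_closedBall_zero_iff.2 ?_⟩
  · change ‖x.re‖ ≤ _
    rw [norm_mul] at h1
    rw [norm_inv, ← one_div, le_div_iff₀ (norm_pos_iff.2 two_ne_zero), mul_comm]
    exact h1
  · change ‖x.im‖ ≤ _
    rw [norm_mul] at h3
    rw [norm_inv, ← one_div, le_div_iff₀ (norm_pos_iff.2 (mul_ne_zero two_ne_zero hD')), mul_comm]
    exact h3

theorem isOpen_integralPoints : IsOpen (integralPoints p D : Set (H p D)) := by
  have h1 : IsOpen {h : H p D | IsIntegral ℤ_[p] (h.l : Ep p D)} :=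
    isOpen_isIntegral.preimage (Units.continuous_val.comp continuous_l)
  exact (isOpen_norm_entry_le_one p D).inter (((isOpen_norm_entry_le_one p D).preimage
    continuous_inv).inter (h1.inter (h1.preimage continuous_inv)))

theorem isCompact_integralPoints (hD : D ≠ 0) :
    IsCompact (integralPoints p D : Set (H p D)) := by
  obtain ⟨C, hC, h⟩ := exists_isCompact_isIntegral p hD
  exact isCompact_of_subset (Subgroup.isClosed_of_isOpen _ isOpen_integralPoints) hC
    fun g hg => ⟨hg.1, hg.2.1, h _ hg.2.2.1, h _ hg.2.2.2⟩

theorem haar_Hint_ne_zero : Measure.haar (Hint p D) ≠ 0 :=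
  (isOpen_integralPoints.measure_pos _ ⟨1, one_mem (integralPoints p D)⟩).ne'

theorem haar_Hint_ne_top (hD : D ≠ 0) : Measure.haar (Hint p D) ≠ ∞ :=
  (isCompact_integralPoints hD).measure_ne_top

instance : (haarH p D).IsMulLeftInvariant := by
  unfold haarH
  infer_instance

theorem haarH_Hint (hD : D ≠ 0) : haarH p D (Hint p D) = 1 := by
  rw [haarH, Measure.smul_apply, smul_eq_mul,
    ENNReal.inv_mul_cancel haar_Hint_ne_zero (haar_Hint_ne_top hD)]

/-- The volume of a compact open subgroup of `H` is a rational number. -/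
theorem exists_haarH_eq (hD : D ≠ 0) {K : Subgroup (H p D)} (hK : IsOpen (K : Set (H p D)))
    (hK' : IsCompact (K : Set (H p D))) :
    haarH p D K ≠ ∞ ∧ ∃ r : ℚ, (haarH p D K).toReal = r := by
  obtain ⟨m, n, hm, hn, h⟩ := exists_measure_eq_mul (haarH p D) hK hK' isOpen_integralPoints
    (isCompact_integralPoints hD)
  have h1 : haarH p D (integralPoints p D : Set (H p D)) = 1 := haarH_Hint hD
  rw [h1, mul_one] at h
  have h2 : haarH p D K = n / m := by
    rw [ENNReal.eq_div_iff (by exact_mod_cast hm) (ENNReal.natCast_ne_top m), h]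
  refine ⟨h2 ▸ ENNReal.div_ne_top (ENNReal.natCast_ne_top n) (by exact_mod_cast hm), n / m, ?_⟩
  rw [h2]
  simp

end HaarOnH

/-! ### The quotient measure -/

section Quotient

variable {p : ℕ} [hp : Fact p.Prime] {D : ℕ} {O : LocalOrder p D} {ι : Type} {x : ι → (Ep p D)ˣ}

/-- The weight of a double coset. -/
def weight (y : (Ep p D)ˣ) : ℝ≥0∞ := ENNReal.ofReal ‖(unitNorm p D y : ℚ_[p])‖⁻¹

variable (O x) in
/-- A function on `H` whose integrals over the cosets of `U₂` are equal to `1`. -/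
def density (h : H p D) : ℝ≥0∞ :=
  ∑' q : ℤ × ι, weight (x q.2) *
    (O.integralSubgroup : Set (H p D)).indicator 1 ((torusPoint x q)⁻¹ * h)

theorem measurable_indicator_translate {K : Subgroup (H p D)} (hK : IsOpen (K : Set (H p D)))
    (t : H p D) : Measurable fun h => (K : Set (H p D)).indicator (1 : H p D → ℝ≥0∞) (t⁻¹ * h) :=
  (measurable_one.indicator hK.measurableSet).comp (continuous_const_mul _).measurable

theorem measurable_density [Countable ι] : Measurable (density O x) :=
  Measurable.tsum fun _ =>
    (measurable_indicator_translate O.isOpen_integralSubgroup _).const_mul _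

/-- On the coset of `u₂ ξ₀ * torusPoint x q * κ` only the term of index `q` survives. It is the
indicator of a ball of radius and volume `‖Nm x‖`, and `weight` is the reciprocal. -/
theorem lintegral_density (hx : O.IsTransversal x) (h : H p D) :
    ∫⁻ ξ, density O x (u₂ ξ * h) ∂(haarQp p) = 1 := by
  obtain ⟨ξ₀, q, κ, hκ, rfl⟩ := exists_iwasawa hx h
  have hmem : ∀ ξ q', (torusPoint x q')⁻¹ * (u₂ ξ * (u₂ ξ₀ * torusPoint x q * κ)) ∈
      O.integralSubgroup ↔ q' = q ∧ ‖ξ + ξ₀‖ ≤ ‖(unitNorm p D (x q.2) : ℚ_[p])‖ := by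
    intro ξ q'
    rw [← torusPoint_inv_mul_mem hx, u₂_add, ← Subgroup.mul_mem_cancel_right _ hκ
      (y := (torusPoint x q')⁻¹ * (u₂ ξ * u₂ ξ₀ * torusPoint x q))]
    simp only [mul_assoc]
  have hval : ∀ ξ, density O x (u₂ ξ * (u₂ ξ₀ * torusPoint x q * κ)) = weight (x q.2) *
      (Metric.closedBall (-ξ₀) ‖(unitNorm p D (x q.2) : ℚ_[p])‖).indicator 1 ξ := by
    classical
    intro ξ
    rw [density, tsum_eq_single q]
    · simp only [Set.indicator_apply, SetLike.mem_coe, hmem, Metric.mem_closedBall, dist_eq_norm,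
        sub_neg_eq_add, true_and, Pi.one_apply]
    · intro q' hq'
      rw [Set.indicator_of_notMem, mul_zero]
      exact fun h => hq' ((hmem ξ q').1 h).1
  have h0 : 0 < ‖(unitNorm p D (x q.2) : ℚ_[p])‖ := norm_pos_iff.2 (Units.ne_zero _)
  simp_rw [hval]
  rw [lintegral_const_mul _ (measurable_one.indicator Metric.isClosed_closedBall.measurableSet),
    lintegral_indicator_one Metric.isClosed_closedBall.measurableSet,
    haarQp_closedBall_norm _ (Units.ne_zero _), weight,
    ← ENNReal.ofReal_mul (inv_nonneg.2 (norm_nonneg _)), inv_mul_cancel₀ h0.ne', ENNReal.ofReal_one]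

instance : SFinite (haarH p D) := by
  unfold haarH
  infer_instance

theorem mk_u₂_mul (ξ : ℚ_[p]) (h : H p D) : (Quotient.mk _ (u₂ ξ * h) : UH p D) = Quotient.mk _ h :=
  Quotient.sound (QuotientGroup.rightRel_apply.2 ⟨-ξ, by
    rw [← u₂_inv, _root_.mul_inv_rev, mul_inv_cancel_left]⟩)

/-- Only the mass placed on each coset of `U₂` matters. The slice and the density both place mass
one there, for the slice on almost every coset. Unlike the slice, the density is right invariant
under the compact group, so it fits the invariance of the integrand. -/
theorem quotientMeasure_eq_map [Countable ι] (hx : O.IsTransversal x) :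
    quotientMeasure p D = ((haarH p D).withDensity (density O x)).map (Quotient.mk _) := by
  ext A hA
  have hB : MeasurableSet ((Quotient.mk _ : H p D → UH p D) ⁻¹' A) := measurable_quotient_mk'' hA
  set B := (Quotient.mk _ : H p D → UH p D) ⁻¹' A with hBdef
  rw [quotientMeasure, Measure.map_apply measurable_quotient_mk'' hA,
    Measure.map_apply measurable_quotient_mk'' hA, ← hBdef, withDensity_apply _ hB,
    ← lintegral_indicator hB, ← lintegral_slice p D _ (measurable_density.indicator hB),
    ← lintegral_indicator_one hB]
  refine lintegral_congr fun h => ?_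
  have hu : ∀ ξ, u₂ ξ * h ∈ B ↔ h ∈ B := by
    intro ξ
    rw [hBdef, Set.mem_preimage, Set.mem_preimage, mk_u₂_mul]
  by_cases hh : h ∈ B
  · simp_rw [Set.indicator_of_mem ((hu _).2 hh), lintegral_density hx, Set.indicator_of_mem hh]
    rfl
  · simp_rw [Set.indicator_of_notMem fun h' => hh ((hu _).1 h'), Set.indicator_of_notMem hh]
    simp

variable (O) in
/-- Representatives of the cosets of an open subgroup in the maximal compact subgroup. -/
def cosetPoint (K : Subgroup (H p D)) (j : O.integralSubgroup ⧸ K.subgroupOf O.integralSubgroup) :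
    H p D := (j.out : O.integralSubgroup)

theorem cosetPoint_mem (K : Subgroup (H p D))
    (j : O.integralSubgroup ⧸ K.subgroupOf O.integralSubgroup) :
    cosetPoint O K j ∈ O.integralSubgroup := (j.out : O.integralSubgroup).2

/-- Each left coset of the compact group is a finite disjoint union of left cosets of `K`, and on
these an integrand invariant under `K` is constant. -/
theorem withDensity_density [Countable ι] {K : Subgroup (H p D)} (hK : IsOpen (K : Set (H p D)))
    (hKO : K ≤ O.integralSubgroup) :
    (haarH p D).withDensity (density O x) =
      Measure.sum fun i : (ℤ × ι) × (O.integralSubgroup ⧸ K.subgroupOf O.integralSubgroup) =>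
        weight (x i.1.2) • (haarH p D).restrict
          {h | (torusPoint x i.1 * cosetPoint O K i.2)⁻¹ * h ∈ K} := by
  have := finite_quotient_of_isOpen_of_isCompact O.isCompact_integralSubgroup hK
  cases nonempty_fintype (O.integralSubgroup ⧸ K.subgroupOf O.integralSubgroup)
  have hA : ∀ t : H p D, MeasurableSet {h | t⁻¹ * h ∈ K} := fun t =>
    (hK.preimage (continuous_const_mul t⁻¹)).measurableSet
  have h1 : density O x =
      ∑' i : (ℤ × ι) × (O.integralSubgroup ⧸ K.subgroupOf O.integralSubgroup),
        weight (x i.1.2) • Set.indicator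
          {h | (torusPoint x i.1 * cosetPoint O K i.2)⁻¹ * h ∈ K} (1 : H p D → ℝ≥0∞) := by
    ext h
    rw [tsum_apply (Pi.summable.2 fun _ => ENNReal.summable), ENNReal.tsum_prod
      (f := fun q j => (weight (x q.2) • Set.indicator
        {h | (torusPoint x q * cosetPoint O K j)⁻¹ * h ∈ K} (1 : H p D → ℝ≥0∞)) h), density]
    refine tsum_congr fun q => ?_
    rw [tsum_fintype, ← sum_indicator_out hKO, Finset.mul_sum]
    refine Finset.sum_congr rfl fun j _ => ?_
    rw [Pi.smul_apply, smul_eq_mul]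
    congr 1
    simp only [_root_.mul_inv_rev, mul_assoc]
    rfl
  rw [h1, withDensity_tsum fun i => (measurable_one.indicator (hA _)).const_smul _]
  congr 1
  ext1 i
  rw [withDensity_smul _ (measurable_one.indicator (hA _)), withDensity_indicator_one (hA _)]

/-- The integral over `U₂ \ H` of a function that is invariant under a compact open subgroup. -/
theorem integral_quotientMeasure [Countable ι] (hx : O.IsTransversal x) (hD : D ≠ 0)
    {K : Subgroup (H p D)} (hK : IsOpen (K : Set (H p D))) (hKO : K ≤ O.integralSubgroup)
    {f : H p D → ℂ} (hu : ∀ ξ h, f (u₂ ξ * h) = f h) (hf : ∀ h, ∀ κ ∈ K, f (h * κ) = f h)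
    (hs : Summable fun i : (ℤ × ι) × (O.integralSubgroup ⧸ K.subgroupOf O.integralSubgroup) =>
      ‖(‖(unitNorm p D (x i.1.2) : ℚ_[p])‖⁻¹ : ℂ) * f (torusPoint x i.1 * cosetPoint O K i.2)‖) :
    Integrable (fun q : UH p D => f q.out) (quotientMeasure p D) ∧
      ∫ q : UH p D, f q.out ∂(quotientMeasure p D) = (haarH p D K).toReal *
        ∑' i : (ℤ × ι) × (O.integralSubgroup ⧸ K.subgroupOf O.integralSubgroup),
          (‖(unitNorm p D (x i.1.2) : ℚ_[p])‖⁻¹ : ℂ) *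
            f (torusPoint x i.1 * cosetPoint O K i.2) := by
  have := finite_quotient_of_isOpen_of_isCompact O.isCompact_integralSubgroup hK
  have hKc : IsCompact (K : Set (H p D)) := O.isCompact_integralSubgroup.of_isClosed_subset
    (Subgroup.isClosed_of_isOpen _ hK) hKO
  obtain ⟨htop, -⟩ := exists_haarH_eq hD hK hKc
  have hfc : Continuous f := by
    refine (IsLocallyConstant.iff_exists_open f).2 (fun h => ⟨{g | h⁻¹ * g ∈ K},
      hK.preimage (continuous_const_mul h⁻¹), ?_, fun g hg => ?_⟩) |>.continuous
    · simp [one_mem]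
    · have := hf h _ hg
      rwa [mul_inv_cancel_left] at this
  have hout : ∀ h : H p D, f (Quotient.mk _ h : UH p D).out = f h := by
    intro h
    obtain ⟨y, hy⟩ := QuotientGroup.rightRel_apply.1
      (Quotient.mk_out (s := QuotientGroup.rightRel (U₂ p D)) h)
    have h1 : h = u₂ y * (Quotient.mk (QuotientGroup.rightRel (U₂ p D)) h).out := by
      rw [hy]; group
    conv_rhs => rw [h1, hu]
  have hmeas : Measurable fun q : UH p D => f q.out := by
    refine measurable_from_quotient.2 ?_
    simpa only [Function.comp_def, hout] using hfc.measurable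
  set A : (ℤ × ι) × (O.integralSubgroup ⧸ K.subgroupOf O.integralSubgroup) → Set (H p D) :=
    fun i => {h | (torusPoint x i.1 * cosetPoint O K i.2)⁻¹ * h ∈ K} with hAdef
  have hA : ∀ i, MeasurableSet (A i) := fun i =>
    (hK.preimage (continuous_const_mul _)).measurableSet
  have hAv : ∀ i, haarH p D (A i) = haarH p D K := fun i =>
    measure_preimage_mul (haarH p D) (torusPoint x i.1 * cosetPoint O K i.2)⁻¹ K
  have hAf : ∀ i, Set.EqOn f (fun _ => f (torusPoint x i.1 * cosetPoint O K i.2)) (A i) := by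
    intro i h hh
    have := hf (torusPoint x i.1 * cosetPoint O K i.2) _ hh
    rwa [mul_inv_cancel_left] at this
  have hint : ∀ i, IntegrableOn f (A i) (haarH p D) := fun i =>
    (integrableOn_congr_fun (hAf i) (hA i)).2 (integrableOn_const (by rwa [hAv]))
  have hval : ∀ i, ∫ h in A i, f h ∂(haarH p D) =
      (haarH p D K).toReal * f (torusPoint x i.1 * cosetPoint O K i.2) := by
    intro i
    rw [setIntegral_congr_fun (hA i) (hAf i), setIntegral_const, Measure.real, hAv]
    simp
  have hnval : ∀ i, ∫ h in A i, ‖f h‖ ∂(haarH p D) =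
      (haarH p D K).toReal * ‖f (torusPoint x i.1 * cosetPoint O K i.2)‖ := by
    intro i
    rw [setIntegral_congr_fun (hA i) (fun h hh => congr_arg norm (hAf i hh)), setIntegral_const,
      Measure.real, hAv]
    simp
  have hw : ∀ y : (Ep p D)ˣ, (weight y).toReal = ‖(unitNorm p D y : ℚ_[p])‖⁻¹ := fun y =>
    ENNReal.toReal_ofReal (inv_nonneg.2 (norm_nonneg _))
  have hfint : Integrable f ((haarH p D).withDensity (density O x)) := by
    rw [withDensity_density hK hKO]
    refine integrable_sum_measure (fun i => (hint i).smul_measure ENNReal.ofReal_ne_top) ?_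
    convert! hs.mul_left (haarH p D K).toReal using 2 with i
    rw [integral_smul_measure, hnval, hw, norm_mul, smul_eq_mul, norm_inv, Complex.norm_real,
      norm_norm]
    ring
  rw [quotientMeasure_eq_map hx]
  constructor
  · rw [integrable_map_measure hmeas.aestronglyMeasurable measurable_quotient_mk''.aemeasurable]
    simpa only [Function.comp_def, hout] using hfint
  · rw [integral_map measurable_quotient_mk''.aemeasurable hmeas.aestronglyMeasurable]
    simp_rw [hout]
    rw [withDensity_density hK hKO] at hfint ⊢
    rw [integral_sum_measure hfint, ← tsum_mul_left]
    refine tsum_congr fun i => ?_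
    rw [integral_smul_measure, hval, hw, Complex.real_smul, Complex.ofReal_inv]
    ring

end Quotient

/-! ### Local constancy of the integrand -/

section Invariance

variable {p : ℕ} [hp : Fact p.Prime] {D : ℕ}

theorem continuous_embed : Continuous (embed : H p D →* GU p D) := by
  have key : ∀ F : H p D → H p D, Continuous F →
      Continuous fun h => embedMatrix ((F h).g₁ : Matrix (Fin 2) (Fin 2) ℚ_[p]) ((F h).l : Ep p D) := by
    intro F hF
    have h1 : ∀ i j, Continuous fun h => algebraMap ℚ_[p] (Ep p D)
        (((F h).g₁ : Matrix (Fin 2) (Fin 2) ℚ_[p]) i j) := fun i j =>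
      continuous_algebraMap_Ep.comp ((continuous_entry p D i j).comp hF)
    have h2 : Continuous fun h => ((F h).l : Ep p D) :=
      Units.continuous_val.comp (continuous_l.comp hF)
    refine continuous_matrix fun i j => ?_
    fin_cases i <;> fin_cases j <;>
      first | exact continuous_const | exact h2 | exact h1 _ _
  exact Continuous.subtype_mk
    (Units.continuous_iff.2 ⟨key _ continuous_id, key _ continuous_inv⟩) _

/-- A continuous character of `ℚ_pˣ` is trivial near `1`. -/
theorem eventually_character_eq_one {ν : ℚ_[p]ˣ →* ℂˣ} (hν : Continuous ν) :
    ∀ᶠ a in 𝓝 (1 : ℚ_[p]ˣ), ν a = 1 := by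
  have hc : Continuous fun a : ℚ_[p]ˣ => ‖(ν a : ℂ) - 1‖ :=
    ((Units.continuous_val.comp hν).sub continuous_const).norm
  have hnhds : {a : ℚ_[p]ˣ | ‖(ν a : ℂ) - 1‖ < 1 / 2} ∈ 𝓝 (1 : ℚ_[p]ˣ) :=
    hc.continuousAt.preimage_mem_nhds (Iio_mem_nhds (by simp))
  rw [Units.isEmbedding_val₀.isInducing.nhds_eq_comap, mem_comap] at hnhds
  obtain ⟨t, ht, htsub⟩ := hnhds
  rw [Units.val_one] at ht
  obtain ⟨ε, hε, hball⟩ := Metric.mem_nhds_iff.1 ht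
  set r := min ε 1 with hr
  have hr0 : 0 < r := lt_min hε one_pos
  have key : ∀ {a b : ℚ_[p]}, ‖a - 1‖ < r → ‖b - 1‖ < r → ‖a * b - 1‖ < r := by
    intro a b ha hb
    have h1 : ‖a‖ ≤ 1 := by
      have := Padic.nonarchimedean (a - 1) 1
      rw [sub_add_cancel, norm_one] at this
      exact this.trans (max_le (ha.le.trans (min_le_right _ _)) le_rfl)
    have h2 := Padic.nonarchimedean (a * (b - 1)) (a - 1)
    rw [show a * (b - 1) + (a - 1) = a * b - 1 by ring, norm_mul] at h2
    exact h2.trans_lt (max_lt ((mul_le_of_le_one_left (norm_nonneg _) h1).trans_lt hb) ha)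
  -- By the ultrametric inequality and `r ≤ 1` these elements form a group. The character maps it
  -- close to `1`, hence to `1`.
  let B : Subgroup ℚ_[p]ˣ :=
    { carrier := {a | ‖(a : ℚ_[p]) - 1‖ < r ∧ ‖((a⁻¹ : ℚ_[p]ˣ) : ℚ_[p]) - 1‖ < r}
      one_mem' := by simpa using hr0
      mul_mem' := by
        rintro a b ⟨h1, h2⟩ ⟨h3, h4⟩
        refine ⟨?_, ?_⟩
        · rw [Units.val_mul]
          exact key h1 h3
        · rw [_root_.mul_inv_rev, Units.val_mul]
          exact key h4 h2
      inv_mem' := by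
        rintro a ⟨h1, h2⟩
        exact ⟨h2, by rwa [inv_inv]⟩ }
  have hcont : ∀ F : ℚ_[p]ˣ → ℚ_[p]ˣ, Continuous F → F 1 = 1 →
      {a | ‖(F a : ℚ_[p]) - 1‖ < r} ∈ 𝓝 (1 : ℚ_[p]ˣ) := by
    intro F hF h1
    have hc : Continuous fun a => ‖(F a : ℚ_[p]) - 1‖ :=
      ((Units.continuous_val.comp hF).sub continuous_const).norm
    exact hc.continuousAt.preimage_mem_nhds (Iio_mem_nhds (by simpa [h1] using hr0))
  filter_upwards [hcont _ continuous_id rfl, hcont _ continuous_inv inv_one] with a h1 h2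
  refine MonoidHom.eq_one_of_mapsTo ν (B := B) (fun b hb => le_of_lt (htsub (hball ?_))) ⟨h1, h2⟩
  rw [Metric.mem_ball, dist_eq_norm]
  exact hb.1.trans_le (min_le_left _ _)

/-- A Schwartz function is invariant under a neighbourhood of `1`. -/
theorem eventually_vecMul_eq {Φ : (Fin 2 → ℚ_[p]) → ℂ} (hΦ : IsLocallyConstant Φ)
    (hΦc : HasCompactSupport Φ) :
    ∀ᶠ κ : H p D in 𝓝 1, ∀ w, Φ (w ᵥ* (κ.g₁ : Matrix (Fin 2) (Fin 2) ℚ_[p])) = Φ w := by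
  have hcont : Continuous fun x : H p D × (Fin 2 → ℚ_[p]) =>
      x.2 ᵥ* (x.1.g₁ : Matrix (Fin 2) (Fin 2) ℚ_[p]) :=
    continuous_snd.matrix_vecMul (Units.continuous_val.comp (continuous_g₁.comp continuous_fst))
  have hopen : IsOpen {x : H p D × (Fin 2 → ℚ_[p]) |
      Φ (x.2 ᵥ* (x.1.g₁ : Matrix (Fin 2) (Fin 2) ℚ_[p])) = Φ x.2} := by
    have h1 : IsLocallyConstant fun x : H p D × (Fin 2 → ℚ_[p]) =>
        Φ (x.2 ᵥ* (x.1.g₁ : Matrix (Fin 2) (Fin 2) ℚ_[p])) - Φ x.2 :=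
      (hΦ.comp_continuous hcont).sub (hΦ.comp_continuous continuous_snd)
    convert! h1.isOpen_fiber 0 using 2
    simp [sub_eq_zero]
  obtain ⟨u, v, hu, -, h1u, hv, huv⟩ := generalized_tube_lemma
    (isCompact_singleton (x := (1 : H p D))) hΦc hopen (by
      rintro ⟨κ, w⟩ ⟨rfl, -⟩
      simp)
  have hU : u ∈ 𝓝 (1 : H p D) := hu.mem_nhds (h1u rfl)
  have hU' : Inv.inv ⁻¹' u ∈ 𝓝 (1 : H p D) :=
    continuous_inv.continuousAt.preimage_mem_nhds (by rwa [inv_one])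
  have key : ∀ κ ∈ u, ∀ w, Φ w ≠ 0 → Φ (w ᵥ* (κ.g₁ : Matrix (Fin 2) (Fin 2) ℚ_[p])) = Φ w :=
    fun κ hκ w hw => @huv (κ, w) ⟨hκ, hv (subset_tsupport _ hw)⟩
  filter_upwards [hU, hU'] with κ h1 h2 w
  -- The tube lemma only speaks of points of the support. If `w` is a zero of `Φ` but its translate
  -- is not, applying it to `κ⁻¹` at the translate gives a contradiction.
  by_cases h0 : Φ w = 0
  · by_contra h3
    rw [h0] at h3
    have h4 := key _ h2 _ h3
    have h5 : (κ.g₁ : Matrix (Fin 2) (Fin 2) ℚ_[p]) *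
        ((κ⁻¹).g₁ : Matrix (Fin 2) (Fin 2) ℚ_[p]) = 1 := by
      rw [H.inv_g₁, ← Units.val_mul, mul_inv_cancel, Units.val_one]
    rw [Matrix.vecMul_vecMul, h5, Matrix.vecMul_one, h0] at h4
    exact h3 h4.symm
  · exact key κ h1 w h0

/-- The integrand is invariant under a compact open subgroup, for all `s` simultaneously. -/
theorem exists_integrand_invariant (O : LocalOrder p D) {V : Type*} [AddCommGroup V] [Module ℂ V]
    {π : Representation ℂ (GU p D) V} (hsm : IsSmooth π) (Λ : V →ₗ[ℂ] ℂ) (v : V)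
    {Φ : (Fin 2 → ℚ_[p]) → ℂ} (hΦ : IsLocallyConstant Φ) (hΦc : HasCompactSupport Φ)
    {ν : ℚ_[p]ˣ →* ℂˣ} (hν : Continuous ν) :
    ∃ K : Subgroup (H p D), IsOpen (K : Set (H p D)) ∧ K ≤ O.integralSubgroup ∧
      ∀ s h, ∀ κ ∈ K, integrand Φ (fun g => Λ (π g v)) ν s (h * κ) =
        integrand Φ (fun g => Λ (π g v)) ν s h := by
  obtain ⟨Kv, hKv, hv⟩ := hsm v
  let K : Subgroup (H p D) :=
    { carrier := {κ | κ ∈ O.integralSubgroup ∧ embed κ ∈ Kv ∧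
        ν (Matrix.GeneralLinearGroup.det κ.g₁) = 1 ∧
        ∀ w, Φ (w ᵥ* (κ.g₁ : Matrix (Fin 2) (Fin 2) ℚ_[p])) = Φ w}
      one_mem' := ⟨one_mem _, by simp [one_mem], by simp, by simp⟩
      mul_mem' := by
        rintro a b ⟨h1, h2, h3, h4⟩ ⟨h5, h6, h7, h8⟩
        refine ⟨mul_mem h1 h5, ?_, ?_, fun w => ?_⟩
        · rw [map_mul]
          exact mul_mem h2 h6
        · rw [H.mul_g₁, map_mul, map_mul, h3, h7, one_mul]
        · rw [H.mul_g₁, Units.val_mul, ← Matrix.vecMul_vecMul, h8, h4]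
      inv_mem' := by
        rintro a ⟨h1, h2, h3, h4⟩
        refine ⟨inv_mem h1, ?_, ?_, fun w => ?_⟩
        · rw [map_inv]
          exact inv_mem h2
        · rw [H.inv_g₁, map_inv, map_inv, h3, inv_one]
        · rw [← h4 (w ᵥ* _), Matrix.vecMul_vecMul, H.inv_g₁, ← Units.val_mul, inv_mul_cancel,
            Units.val_one, Matrix.vecMul_one] }
  have hdet : Continuous fun κ : H p D => Matrix.GeneralLinearGroup.det κ.g₁ := by
    refine Units.continuous_iff.2 ⟨?_, ?_⟩
    · exact (Units.continuous_val.comp continuous_g₁).matrix_det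
    · have h : Continuous fun κ : H p D =>
          ((κ⁻¹).g₁ : Matrix (Fin 2) (Fin 2) ℚ_[p]).det :=
        (Units.continuous_val.comp (continuous_g₁.comp continuous_inv)).matrix_det
      exact h
  refine ⟨K, Subgroup.isOpen_of_mem_nhds K (g := 1) ?_, fun κ hκ => hκ.1, ?_⟩
  · have h1 : (O.integralSubgroup : Set (H p D)) ∈ 𝓝 1 :=
      O.isOpen_integralSubgroup.mem_nhds (one_mem _)
    have h2 : embed ⁻¹' (Kv : Set (GU p D)) ∈ 𝓝 (1 : H p D) :=
      (hKv.preimage continuous_embed).mem_nhds (by simp [one_mem])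
    have h3 : ∀ᶠ κ : H p D in 𝓝 1, ν (Matrix.GeneralLinearGroup.det κ.g₁) = 1 :=
      (hdet.tendsto' 1 1 (by simp)).eventually (eventually_character_eq_one hν)
    filter_upwards [h1, h2, h3, eventually_vecMul_eq hΦ hΦc] with κ h4 h5 h6 h7
    exact ⟨h4, h5, h6, h7⟩
  · rintro s h κ ⟨h1, h2, h3, h4⟩
    have h5 : ‖((h * κ).g₁ : Matrix (Fin 2) (Fin 2) ℚ_[p]).det‖ =
        ‖(h.g₁ : Matrix (Fin 2) (Fin 2) ℚ_[p]).det‖ := by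
      rw [H.mul_g₁, Units.val_mul, Matrix.det_mul, norm_mul, O.norm_det_eq_one h1, mul_one]
    unfold integrand
    rw [h5, H.mul_g₁, map_mul, map_mul, h3, mul_one, Units.val_mul, ← Matrix.vecMul_vecMul, h4,
      map_mul embed]
    simp only [map_mul π, Module.End.mul_apply, hv _ h2]

end Invariance

/-! ### Rationality of the local integral -/

section Rationality

theorem RationalSum.prod_of_finite {k : Type*} [Field k] [Algebra k ℂ] {ι κ : Type*} [Finite κ]
    {a : κ → ι → ℂ} {e : ι → ℤ} (h : ∀ j, RationalSum k (a j) e) :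
    RationalSum k (fun i : ι × κ => a i.2 i.1) fun i => e i.1 := by
  classical
  cases nonempty_fintype κ
  have h1 : (fun i : ι × κ => a i.2 i.1) = fun i => ∑ j, if i.2 = j then a j i.1 else 0 := by
    ext i
    simp
  rw [h1]
  refine RationalSum.sum fun j _ => RationalSum.of_injective (g := fun i => (i, j))
    (fun _ _ h => congr_arg Prod.fst h) ?_ (by simpa using h j)
  rintro ⟨i, j'⟩ hi
  exact if_neg fun h => hi ⟨i, by simp_all⟩

variable {p : ℕ} [hp : Fact p.Prime] {D : ℕ}

/-- This is how `‖det‖ ^ s` becomes a monomial in `X = p ^ (-s)`. -/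
theorem ofReal_zpow_cpow (e : ℤ) (s : ℂ) :
    (((p : ℝ) ^ (-e) : ℝ) : ℂ) ^ s = ((p : ℂ) ^ (-s)) ^ e := by
  have hp1 : (0 : ℝ) < p := by exact_mod_cast hp.out.pos
  have hp0 : (p : ℂ) ≠ 0 := by exact_mod_cast hp.out.ne_zero
  rw [Complex.cpow_def_of_ne_zero (by exact_mod_cast (zpow_pos hp1 _).ne'),
    ← Complex.ofReal_log (zpow_pos hp1 _).le, Real.log_zpow, Complex.cpow_def_of_ne_zero hp0,
    ← Complex.natCast_log, ← Complex.exp_int_mul]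
  congr 1
  push_cast
  ring

/-- The absolute value of `ℚ_p` as a homomorphism to `ℂˣ`. -/
def absHom (p : ℕ) [Fact p.Prime] : ℚ_[p]ˣ →* ℂˣ :=
  Units.map (Complex.ofRealHom.toMonoidHom.comp (normHom : ℚ_[p] →*₀ ℝ).toMonoidHom)

@[simp] theorem val_absHom (a : ℚ_[p]ˣ) : (absHom p a : ℂ) = (‖(a : ℚ_[p])‖ : ℝ) := rfl

/-- The character `x ↦ ν (Nm x) / |Nm x|` of `E_pˣ`. -/
def torusCharacter (ν : ℚ_[p]ˣ →* ℂˣ) : (Ep p D)ˣ →* ℂˣ :=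
  (ν / absHom p).comp (unitNorm p D)

theorem val_torusCharacter (ν : ℚ_[p]ˣ →* ℂˣ) (x : (Ep p D)ˣ) : (torusCharacter ν x : ℂ) =
    ν (unitNorm p D x) * ((‖(unitNorm p D x : ℚ_[p])‖ : ℝ) : ℂ)⁻¹ := by
  change ((ν (unitNorm p D x) / absHom p (unitNorm p D x) : ℂˣ) : ℂ) = _
  rw [Units.val_div_eq_div_val, val_absHom, div_eq_mul_inv]

theorem norm_valuation_isAlgebraic (a : ℚ_[p]ˣ) :
    IsAlgebraic ℚ (((‖(a : ℚ_[p])‖ : ℝ) : ℂ)⁻¹) := by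
  have h : (((‖(a : ℚ_[p])‖ : ℝ) : ℂ)⁻¹) = algebraMap ℚ ℂ ((p : ℚ) ^ (a : ℚ_[p]).valuation) := by
    rw [Padic.norm_eq_zpow_neg_valuation a.ne_zero]
    simp
  rw [h]
  exact isAlgebraic_algebraMap _

theorem det_torusPoint {ι : Type} (x : ι → (Ep p D)ˣ) (q : ℤ × ι) :
    Matrix.GeneralLinearGroup.det (torusPoint x q).g₁ =
      (unitP p ^ 2) ^ q.1 * unitNorm p D (x q.2) := by
  refine Units.ext ?_
  have h : (unitP p ^ 2) ^ q.1 = unitP p ^ q.1 * unitP p ^ q.1 := by rw [pow_two, mul_zpow]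
  rw [Matrix.GeneralLinearGroup.val_det_apply, torusPoint, torus_g₁, Matrix.det_fin_two_of, h,
    Units.val_mul, Units.val_mul, val_unitNorm]
  ring

theorem norm_det_torusPoint {ι : Type} (x : ι → (Ep p D)ˣ) (q : ℤ × ι) :
    ‖((torusPoint x q).g₁ : Matrix (Fin 2) (Fin 2) ℚ_[p]).det‖ =
      (p : ℝ) ^ (-(2 * q.1 + (unitNorm p D (x q.2) : ℚ_[p]).valuation)) := by
  have hp0 : (p : ℝ) ≠ 0 := by exact_mod_cast hp.out.ne_zero
  rw [torusPoint, torus_g₁, Matrix.det_fin_two_of, ← val_unitNorm, mul_zero, sub_zero, norm_mul,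
    norm_mul, norm_unitP_zpow, Padic.norm_eq_zpow_neg_valuation (Units.ne_zero _), ← zpow_add₀ hp0,
    ← zpow_add₀ hp0]
  congr 1
  ring

theorem vecMul_torusPoint {ι : Type} (x : ι → (Ep p D)ˣ) (q : ℤ × ι) :
    ![0, 1] ᵥ* ((torusPoint x q).g₁ : Matrix (Fin 2) (Fin 2) ℚ_[p]) =
      (p : ℚ_[p]) ^ q.1 • ![0, 1] := by
  rw [torusPoint, torus_g₁]
  ext i
  fin_cases i <;> simp [Matrix.vecMul, dotProduct, Fin.sum_univ_two]

/-- Separation of variables: the determinant at the torus point is `p ^ (2 * m) * Nm x`, so the part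
in `m` is a power of `ν (p ^ 2)` times a value of `Φ`, and the part in `x` is a character that
includes the weight `‖Nm x‖⁻¹`. All dependence on `s` sits in the last factor. -/
theorem integrand_torusPoint_mul {O : LocalOrder p D} {ι : Type} (x : ι → (Ep p D)ˣ) (q : ℤ × ι)
    {κ : H p D} (hκ : κ ∈ O.integralSubgroup) (Φ : (Fin 2 → ℚ_[p]) → ℂ) {V : Type*} [AddCommGroup V]
    [Module ℂ V] (π : Representation ℂ (GU p D) V) (Λ : V →ₗ[ℂ] ℂ) (v : V) (ν : ℚ_[p]ˣ →* ℂˣ)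
    (s : ℂ) :
    (‖(unitNorm p D (x q.2) : ℚ_[p])‖⁻¹ : ℂ) *
        integrand Φ (fun g => Λ (π g v)) ν s (torusPoint x q * κ) =
      (((ν (unitP p ^ 2) ^ q.1 : ℂˣ) : ℂ) * ((ν (Matrix.GeneralLinearGroup.det κ.g₁) : ℂ) *
        Φ ((p : ℚ_[p]) ^ q.1 • (![0, 1] ᵥ* (κ.g₁ : Matrix (Fin 2) (Fin 2) ℚ_[p])))) *
        ((torusCharacter ν (x q.2) : ℂ) *
          Λ (π (torusG (x q.2) * scalarG (unitP p ^ q.1)) (π (embed κ) v)))) *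
      ((p : ℂ) ^ (-s)) ^ (2 * q.1 + (unitNorm p D (x q.2) : ℚ_[p]).valuation) := by
  have h1 : embed (torusPoint x q) = torusG (x q.2) * scalarG (unitP p ^ q.1) := embed_torus_eq _ _
  unfold integrand
  rw [H.mul_g₁, map_mul Matrix.GeneralLinearGroup.det, map_mul ν, det_torusPoint, map_mul ν,
    map_zpow ν, Units.val_mul, Units.val_mul, Units.val_mul, Matrix.det_mul, norm_mul,
    O.norm_det_eq_one hκ, mul_one, norm_det_torusPoint, ofReal_zpow_cpow, ← Matrix.vecMul_vecMul,
    vecMul_torusPoint, Matrix.smul_vecMul, map_mul embed, h1, val_torusCharacter]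
  simp only [map_mul π _ (embed κ), Module.End.mul_apply]
  ring

/-- For `m → -∞` the vector leaves the compact support, and for `m → ∞` it enters a neighbourhood of
the origin where `Φ` is constant. -/
theorem exists_forall_zpow_smul_eq {Φ : (Fin 2 → ℚ_[p]) → ℂ} (hΦ : IsLocallyConstant Φ)
    (hΦc : HasCompactSupport Φ) {w : Fin 2 → ℚ_[p]} (hw : w ≠ 0) :
    ∃ A B : ℤ, (∀ m < A, Φ ((p : ℚ_[p]) ^ m • w) = 0) ∧
      ∀ m, B ≤ m → Φ ((p : ℚ_[p]) ^ m • w) = Φ ((p : ℚ_[p]) ^ B • w) := by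
  have hp1 : (1 : ℝ) < p := by exact_mod_cast hp.out.one_lt
  have hnorm : ∀ m : ℤ, ‖(p : ℚ_[p]) ^ m • w‖ = (p : ℝ) ^ (-m) * ‖w‖ := by
    intro m
    rw [norm_smul, Padic.norm_p_zpow]
  have hw0 : 0 < ‖w‖ := norm_pos_iff.2 hw
  obtain ⟨C, hC⟩ := hΦc.isBounded.exists_norm_le
  obtain ⟨a, ha⟩ := pow_unbounded_of_one_lt (C / ‖w‖) hp1
  obtain ⟨ε, hε, hball⟩ := Metric.mem_nhds_iff.1
    ((hΦ.isOpen_fiber (Φ 0)).mem_nhds (rfl : Φ 0 = Φ 0))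
  obtain ⟨b, hb⟩ := exists_pow_lt_of_lt_one (div_pos hε hw0) (inv_lt_one_of_one_lt₀ hp1)
  have hB : ∀ m : ℤ, (b : ℤ) ≤ m → Φ ((p : ℚ_[p]) ^ m • w) = Φ 0 := by
    intro m hm
    refine hball ?_
    rw [mem_ball_zero_iff, hnorm, ← lt_div_iff₀ hw0]
    refine lt_of_le_of_lt ?_ hb
    rw [inv_pow, ← zpow_natCast, ← _root_.zpow_neg]
    exact zpow_le_zpow_right₀ hp1.le (by omega)
  refine ⟨-a, b, fun m hm => ?_, fun m hm => (hB m hm).trans (hB b le_rfl).symm⟩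
  by_contra h
  have h1 := hC _ (subset_tsupport _ h)
  rw [hnorm, ← le_div_iff₀ hw0] at h1
  have h2 : (p : ℝ) ^ a ≤ (p : ℝ) ^ (-m) := by
    rw [← zpow_natCast]
    exact zpow_le_zpow_right₀ hp1.le (by omega)
  exact absurd (h2.trans h1) (not_le.2 ha)

theorem vecMul_ne_zero (κ : H p D) :
    ![0, 1] ᵥ* (κ.g₁ : Matrix (Fin 2) (Fin 2) ℚ_[p]) ≠ 0 := by
  intro h
  have h5 : (κ.g₁ : Matrix (Fin 2) (Fin 2) ℚ_[p]) *
      ((κ⁻¹).g₁ : Matrix (Fin 2) (Fin 2) ℚ_[p]) = 1 := by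
    rw [H.inv_g₁, ← Units.val_mul, mul_inv_cancel, Units.val_one]
  have h1 := congr_arg (fun w => w ᵥ* ((κ⁻¹).g₁ : Matrix (Fin 2) (Fin 2) ℚ_[p])) h
  simp only [Matrix.vecMul_vecMul, h5, Matrix.vecMul_one, Matrix.zero_vecMul] at h1
  simpa using congr_fun h1 1

theorem mem_range_algebraicClosure {z : ℂ} (h : IsAlgebraic ℚ z) :
    z ∈ (algebraMap (algebraicClosure ℚ ℂ) ℂ).range :=
  ⟨⟨z, mem_algebraicClosure_iff.2 h⟩, rfl⟩

/-- For large `Re s` the local integral converges absolutely, and it is a rational function of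
`p ^ (-s)`. -/
theorem exists_rational_localIntegral (hD : D ≠ 0) {ψ : AddChar ℚ_[p] Circle} (hψ : Continuous ψ)
    (hψ1 : ψ ≠ 1) {V : Type*} [AddCommGroup V] [Module ℂ V] {π : Representation ℂ (GU p D) V}
    (hadm : IsAdmissible π) {W : GU p D → ℂ} (hW : IsWhittakerFunction ψ π W)
    (hWalg : ∀ g, IsAlgebraic ℚ (W g)) {Φ : (Fin 2 → ℚ_[p]) → ℂ} (hΦ : IsLocallyConstant Φ)
    (hΦc : HasCompactSupport Φ) (hΦalg : ∀ x, IsAlgebraic ℚ (Φ x)) {ν : ℚ_[p]ˣ →* ℂˣ}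
    (hν : Continuous ν) (hνalg : ∀ x, IsAlgebraic ℚ (ν x : ℂ)) :
    ∃ F : ℂ → ℂ, IsRationalNearZero (algebraicClosure ℚ ℂ) F ∧ ∃ σ : ℝ, ∀ s : ℂ, σ < s.re →
      LocalIntegrable Φ W ν s ∧ localIntegral Φ W ν s = F ((p : ℂ) ^ (-s)) := by
  have hinv := fun s => integrand_u₂_mul Φ ν s hW
  obtain ⟨Λ, -, hΛ, v, hv⟩ := hW
  obtain rfl : W = fun g => Λ (π g v) := funext hv
  obtain ⟨O, ι, _, x, hx, hx'⟩ := exists_isTransversal p hD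
  obtain ⟨K, hK, hKO, hKinv⟩ := exists_integrand_invariant O hadm.1 Λ v hΦ hΦc hν
  have hfin := finite_quotient_of_isOpen_of_isCompact O.isCompact_integralSubgroup hK
  have hKc : IsCompact (K : Set (H p D)) := O.isCompact_integralSubgroup.of_isClosed_subset
    (Subgroup.isClosed_of_isOpen _ hK) hKO
  obtain ⟨-, r, hr⟩ := exists_haarH_eq hD hK hKc
  -- Only finitely many translates of `v` occur, so one congruence subgroup fixes all of them.
  choose Kv hKv hKv' using fun j => hadm.1 (π (embed (cosetPoint O K j)) v)
  obtain ⟨n, hn, hsub⟩ := O.exists_congruence_subset (U := ⋂ j, (Kv j : Set (GU p D)))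
    (by
      rw [iInter_mem]
      exact fun j => (hKv j).mem_nhds (one_mem _))
  set a : (O.integralSubgroup ⧸ K.subgroupOf O.integralSubgroup) → ℤ × ι → ℂ := fun j q =>
    ((ν (unitP p ^ 2) ^ q.1 : ℂˣ) : ℂ) *
      ((ν (Matrix.GeneralLinearGroup.det (cosetPoint O K j).g₁) : ℂ) * Φ ((p : ℚ_[p]) ^ q.1 •
        (![0, 1] ᵥ* ((cosetPoint O K j).g₁ : Matrix (Fin 2) (Fin 2) ℚ_[p])))) *
      ((torusCharacter ν (x q.2) : ℂ) * Λ (π (torusG (x q.2) * scalarG (unitP p ^ q.1))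
        (π (embed (cosetPoint O K j)) v))) with ha
  set e : ℤ × ι → ℤ := fun q => 2 * q.1 + (unitNorm p D (x q.2) : ℚ_[p]).valuation with he
  have hsum : ∀ j, RationalSum (algebraicClosure ℚ ℂ) (a j) e := by
    intro j
    obtain ⟨A, B, hA, hB⟩ := exists_forall_zpow_smul_eq hΦ hΦc (vecMul_ne_zero (cosetPoint O K j))
    refine rationalSum_scalarG_torusG hadm hD hn hψ hψ1 hΛ (torusCharacter ν)
      (fun y => mem_range_algebraicClosure ?_) hx' (n := n)
      (f := fun g => Λ (π g (π (embed (cosetPoint O K j)) v))) ⟨⟨_, fun κ hκ => ?_, rfl⟩,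
        fun g => mem_range_algebraicClosure ?_⟩ (ν (unitP p ^ 2))
      (fun m => mem_range_algebraicClosure ?_) (fun m => _ * Φ ((p : ℚ_[p]) ^ m • _))
      (fun m => mem_range_algebraicClosure ((hνalg _).mul (hΦalg _))) (A := A) (B := B)
      (fun m hm => by rw [hA m hm, mul_zero]) (fun m hm => by rw [hB m hm])
    · rw [val_torusCharacter]
      exact (hνalg _).mul (norm_valuation_isAlgebraic _)
    · exact hKv' j κ (Set.mem_iInter.1 (hsub hκ) j)
    -- A translate of `v` gives a right translate of `W`, so algebraicity of the values is
    -- inherited.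
    · simpa only [map_mul, Module.End.mul_apply] using hWalg (g * embed (cosetPoint O K j))
    · rw [← map_zpow]
      exact hνalg _
  have htot := RationalSum.prod_of_finite hsum
  -- The rational number `r` is the volume of `K`, so this factor keeps the coefficients algebraic.
  refine ⟨fun X => algebraMap (algebraicClosure ℚ ℂ) ℂ (algebraMap ℚ _ r) *
    ∑' i : (ℤ × ι) × (O.integralSubgroup ⧸ K.subgroupOf O.integralSubgroup),
      a i.2 i.1 * X ^ e i.1, ?_, ?_⟩
  · simpa using (isRationalNearZero_monomial (algebraicClosure ℚ ℂ)
      (algebraMap ℚ _ r) 0).mul htot.2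
  obtain ⟨σ, hσ⟩ := exists_forall_natCast_cpow p htot.1
  refine ⟨σ, fun s hs => ?_⟩
  have hterm : ∀ i : (ℤ × ι) × (O.integralSubgroup ⧸ K.subgroupOf O.integralSubgroup),
      (‖(unitNorm p D (x i.1.2) : ℚ_[p])‖⁻¹ : ℂ) * integrand Φ (fun g => Λ (π g v)) ν s
        (torusPoint x i.1 * cosetPoint O K i.2) = a i.2 i.1 * ((p : ℂ) ^ (-s)) ^ e i.1 := fun i =>
    integrand_torusPoint_mul x i.1 (cosetPoint_mem K i.2) Φ π Λ v ν s
  have h1 := hσ s hs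
  simp_rw [← hterm] at h1
  obtain ⟨h2, h3⟩ := integral_quotientMeasure hx hD hK hKO (hinv s) (hKinv s) h1
  refine ⟨h2, h3.trans ?_⟩
  simp_rw [hterm, hr]
  simp

end Rationality

end PicardLocal

end

theorem mainTheorem10 (p : ℕ) [Fact p.Prime] (D : ℕ) (hD : PicardLocal.IsFundamental D)
    (ψ : AddChar ℚ_[p] Circle) (hψ : Continuous ψ) (hψ1 : ψ ≠ 1)
    {V : Type*} [AddCommGroup V] [Module ℂ V] (π : Representation ℂ (PicardLocal.GU p D) V)
    (hirr : π.IsIrreducible) (hadm : PicardLocal.IsAdmissible π)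
    (W : PicardLocal.GU p D → ℂ) (hW : PicardLocal.IsWhittakerFunction ψ π W)
    (hWalg : ∀ g, IsAlgebraic ℚ (W g))
    (Φ : (Fin 2 → ℚ_[p]) → ℂ) (hΦ : IsLocallyConstant Φ) (hΦc : HasCompactSupport Φ)
    (hΦalg : ∀ x, IsAlgebraic ℚ (Φ x))
    (ν₁ : ℚ_[p]ˣ →* ℂˣ) (hν : Continuous ν₁) (hνalg : ∀ x, IsAlgebraic ℚ (ν₁ x : ℂ)) :
    ∃ (M : ℂ → ℂ) (P Q : Polynomial ℂ),
      (∀ n, IsAlgebraic ℚ (P.coeff n)) ∧ (∀ n, IsAlgebraic ℚ (Q.coeff n)) ∧ Q ≠ 0 ∧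
      (∀ s : ℂ, M s = P.eval ((p : ℂ) ^ (-s)) / Q.eval ((p : ℂ) ^ (-s))) ∧
      Meromorphic M ∧
      (∃ σ : ℝ, ∀ s : ℂ, σ < s.re →
        PicardLocal.LocalIntegrable Φ W ν₁ s ∧ Q.eval ((p : ℂ) ^ (-s)) ≠ 0 ∧
          M s = PicardLocal.localIntegral Φ W ν₁ s) ∧
      (∀ (r : ℚ) (c : ℂ), Tendsto M (𝓝[≠] (r : ℂ)) (𝓝 c) → IsAlgebraic ℚ c) := by
  obtain ⟨F, hF, σ, hσ⟩ := PicardLocal.exists_rational_localIntegral hD.1.ne' hψ hψ1 hadm hW hWalg hΦ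
    hΦc hΦalg hν hνalg
  obtain ⟨M, P, Q, hP, hQ, hQ0, hM, hmero, ⟨σ', hσ'⟩, hlim⟩ :=
    hF.exists_meromorphic (fun x => mem_algebraicClosure_iff.1 x.2) p
  -- One half plane is for absolute convergence, the other for the nonvanishing of `Q` and the
  -- agreement with the sum of the series.
  refine ⟨M, P, Q, hP, hQ, hQ0, hM, hmero, ⟨max σ σ', fun s hs => ?_⟩, hlim⟩
  obtain ⟨h1, h2⟩ := hσ s ((le_max_left _ _).trans_lt hs)
  obtain ⟨h3, h4⟩ := hσ' s ((le_max_right _ _).trans_lt hs)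
  exact ⟨h1, h3, h4.trans h2.symm⟩
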